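/- **Theorem 4.1.** All graphs are finite, undirected, without loops or multiple edges. For a vertex $x$ of a graph $\Gamma$, let $\Gamma_1(x)$ be the set of neighbours of $x$. A graph is *amply regular* with parameters $(v,k,\lambda,\mu)$ if it has $v$ vertices, is regular of degree $k$, any two adjacent vertices have exactly $\lambda$ common neighbours, and any two vertices at distance $2$ have exactly $\mu$ common neighbours. A connected graph $\Gamma$ is *distance-regular* with intersection numbers $b_i,c_i$ if for any two vertices $u,w$ at distance $i$ there are exactly $c_i$ neighbours of $w$ at distance $i-1$ from $u$ and exactly $b_i$ neighbours of $w$ at distance $i+1$ from $u$; put $a_1=b_0-b_1-c_1$. For a connected non-complete graph $\Gamma$, let $c\ge 2$ be the largest integer such that for each vertex $x$ and each pair of distinct nonadjacent vertices $y,z\in\Gamma_1(x)$ there is a set of $c$ pairwise nonadjacent vertices in $\Gamma_1(x)$ containing $y$ and $z$. (a) Let $\Gamma$ be a connected non-complete amply regular graph with parameters $(v,k,\lambda,\mu)$ and $\mu>1$, and suppose that $$\mu-1=\max\left\{\frac{c'(\lambda+1)-k}{\binom{c'}{2}}\;:\;2\le c'\le c\right\}.$$ Then $\mu=2$ and $\Gamma$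 is isomorphic to the icosahedron, the Doro graph or the Conway–Smith graph. (b) In particular, let $\Gamma$ be a distance-regular graph of diameter at least $2$ with intersection numbers $b_i,c_i$ and $c_2\ge2$, and suppose that $$c_2-1=\max\left\{\frac{c'(a_1+1)-b_0}{\binom{c'}{2}}\;:\;2\le c'\le c\right\}.$$ Then $c_2=2$ and $\Gamma$ is isomorphic to the icosahedron, the Doro graph or the Conway–Smith graph. Here the icosahedron, the Doro graph and the Conway–Smith graph are the unique distance-regular graphs with intersection arrays $\{b_0,b_1,\ldots;c_1,c_2,\ldots\}$ equal to $\{5,2,1;1,2,5\}$ (12 vertices), $\{10,6,4;1,2,5\}$ (65 vertices) and $\{10,6,4,1;1,2,6,10\}$ (63 vertices), respectively. -/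

import Mathlib

namespace KoolenPark

/-- `G` has `v` vertices, is regular of degree `k`, any two adjacent vertices have exactly `lam`
common neighbours, and any two vertices at distance 2 have exactly `mu` common neighbours. -/
structure IsAmplyRegular {V : Type*} [Fintype V] [DecidableEq V] (G : SimpleGraph V)
    [DecidableRel G.Adj] (v k lam mu : ℕ) : Prop where
  card : Fintype.card V = v
  regular : G.IsRegularOfDegree k
  of_adj : ∀ u w, G.Adj u w → Fintype.card (G.commonNeighbors u w) = lam
  of_dist_two : ∀ u w, G.dist u w = 2 → Fintype.card (G.commonNeighbors u w) = mu

/-- `G` is distance-regular with intersection numbers `b i`, `c i`. (The values of the sequences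
beyond the diameter are irrelevant.) -/
structure IsDistanceRegular {V : Type*} [Fintype V] [DecidableEq V] (G : SimpleGraph V)
    [DecidableRel G.Adj] (b c : ℕ → ℕ) : Prop where
  connected : G.Connected
  card_closer : ∀ i u w, G.dist u w = i →
    ((G.neighborFinset w).filter (fun x => G.dist u x + 1 = i)).card = c i
  card_farther : ∀ i u w, G.dist u w = i →
    ((G.neighborFinset w).filter (fun x => G.dist u x = i + 1)).card = b i

/-- For each vertex `x` and every pair of nonadjacent vertices `y`, `z` of the local graph of `x`,
there is a coclique of size `c` in the local graph of `x` containing `y` and `z`. -/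
def HasLocalCocliques {V : Type*} (G : SimpleGraph V) (c : ℕ) : Prop :=
  ∀ x y z : V, G.Adj x y → G.Adj x z → y ≠ z → ¬ G.Adj y z →
    ∃ S : Finset V, G.IsNIndepSet c S ∧ (∀ s ∈ S, G.Adj x s) ∧ y ∈ S ∧ z ∈ S

/-- With `c ≥ 2` maximal such that `HasLocalCocliques G c`, the equality
`mu - 1 = max {(c' (lam + 1) - k) / (c' choose 2) | 2 ≤ c' ≤ c}` holds. -/
def AttainsMuBound {V : Type*} (G : SimpleGraph V) (k lam mu : ℚ) : Prop :=
  ∃ c : ℕ, IsGreatest {n : ℕ | 2 ≤ n ∧ HasLocalCocliques G n} c ∧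
    IsGreatest {r : ℚ | ∃ c' : ℕ, 2 ≤ c' ∧ c' ≤ c ∧
      r = ((c' : ℚ) * (lam + 1) - k) / (c'.choose 2 : ℚ)} (mu - 1)

/-! ### The icosahedron -/

/-- The icosahedron. The vertices `(s, none)` are two opposite poles, and the `(s, some i)`,
for `i` mod 5, form the pentagon of neighbours of the pole `(s, none)`. The vertex
`(true, some i)` of one pentagon is joined to `(false, some i)` and `(false, some (i + 1))`. -/
def icosahedron : SimpleGraph (Bool × Option (ZMod 5)) :=
  SimpleGraph.fromRel fun p q => match p, q with
    | (s, none), (t, some _) => s = t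
    | (true, some i), (false, some j) => j = i ∨ j = i + 1
    | (true, some i), (true, some j) => j = i + 1
    | (false, some i), (false, some j) => j = i + 1
    | _, _ => False

/-! ### The Doro graph -/

/-- The elliptic quadratic form `x₀² + x₁² + x₂² + 2 x₃²` on `𝔽₅⁴` (its discriminant `2` is a
nonsquare), as a symmetric bilinear form. -/
def ellipticForm (x y : Fin 4 → ZMod 5) : ZMod 5 :=
  x 0 * y 0 + x 1 * y 1 + x 2 * y 2 + 2 * (x 3 * y 3)

theorem ellipticForm_comm (x y : Fin 4 → ZMod 5) : ellipticForm x y = ellipticForm y x := by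
  simp only [ellipticForm]; ring

/-- The 65 points of the projective space `PG(3,5)` on which the elliptic quadratic form takes
nonzero square values. Each such point is spanned by exactly two vectors of norm `1`, which are
opposite; it is represented by the one whose first nonzero coordinate is `1` or `2`. -/
abbrev DoroVertex : Type :=
  {x : Fin 4 → ZMod 5 // ellipticForm x x = 1 ∧
    ∃ i, (∀ j < i, x j = 0) ∧ (x i = 1 ∨ x i = 2)}

/-- The Doro graph, the distance-regular graph on 65 vertices with intersection array
`{10,6,4;1,2,5}`: two points of `DoroVertex` are adjacent if they are orthogonal. -/
def doroGraph : SimpleGraph DoroVertex where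
  Adj x y := ellipticForm x.1 y.1 = 0
  symm := ⟨fun x y h => (ellipticForm_comm y.1 x.1).trans h⟩
  loopless := ⟨fun x h => by
    have h1 : ellipticForm x.1 x.1 = 1 := x.2.1
    exact absurd (h1.symm.trans h) (by decide)⟩

/-! ### The Conway-Smith graph -/

/-- The additive group of the field `𝔽₄ = {0, 1, ω, ω²}`; `(s, t)` stands for `s + t ω`. -/
abbrev F4 : Type := ZMod 2 × ZMod 2

/-- Multiplication by `ω` in `𝔽₄`, where `ω² = 1 + ω`. -/
def mulOmega (x : F4) : F4 := (x.2, x.1 + x.2)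

/-- The codeword `(a, b, c, f(1), f(ω), f(ω²))` of the hexacode,
where `f(t) = a t² + b t + c`. -/
def hexacodeword (a b c : F4) : Fin 6 → F4 :=
  ![a, b, c, a + b + c,
    mulOmega (mulOmega a) + mulOmega b + c,
    mulOmega a + mulOmega (mulOmega b) + c]

/-- Hamming weight. -/
def weight (x : Fin 6 → F4) : ℕ := (Finset.univ.filter fun i => x i ≠ 0).card

/-- The 63 vectors of `𝔽₄⁶` consisting of the 18 vectors of weight 1 and the 45 words of weight 4
of the hexacode. -/
abbrev ConwaySmithVertex : Type :=
  {x : Fin 6 → F4 // weight x = 1 ∨ (weight x = 4 ∧ ∃ a b c, x = hexacodeword a b c)}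

/-- The Conway-Smith graph (the `3.Sym(7)`-graph), the distance-regular graph on 63 vertices with
intersection array `{10,6,4,1;1,2,6,10}`: two distinct vectors of `ConwaySmithVertex` are adjacent
if their supports meet and they agree on the intersection of their supports. -/
def conwaySmithGraph : SimpleGraph ConwaySmithVertex where
  Adj x y := x ≠ y ∧ (∃ i, x.1 i ≠ 0 ∧ y.1 i ≠ 0) ∧
    ∀ i, x.1 i ≠ 0 → y.1 i ≠ 0 → x.1 i = y.1 i
  symm := ⟨fun _ _ h => ⟨h.1.symm, h.2.1.imp fun _ hi => hi.symm,
    fun i hx hy => (h.2.2 i hy hx).symm⟩⟩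
  loopless := ⟨fun _ h => h.1 rfl⟩

/-- `G` is (isomorphic to) the icosahedron, the Doro graph or the Conway-Smith graph. -/
def IsKnownTerwilliger {V : Type*} (G : SimpleGraph V) : Prop :=
  Nonempty (G ≃g icosahedron) ∨ Nonempty (G ≃g doroGraph) ∨ Nonempty (G ≃g conwaySmithGraph)

end KoolenPark

/-! Write b = μ - 1 and fix a vertex x. In the local graph of x all closed neighbourhoods have size
λ + 1. For a coclique S of size n, let m(v) be the number of elements of S that dominate v. Summing
(m(v) - 1)(m(v) - 2) ≥ 0 over all v gives the inequality behind the bound, since two nonadjacent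
neighbours of x have at most b common neighbours besides x. In the case of equality
(`bonferroni_tight`, `localData`) every vertex is dominated once or twice by S, and all common
neighbours of two vertices at distance 2 are equal or adjacent to each other.

These conditions determine the local graph up to twins (`LocalData.structure_all`). All twin classes
have size b, adjacent non-twins have no common closed neighbours outside their own two classes, and
either n = 2 and λ + 1 = 3b, or n = 4 and λ + 1 = 4b. So the local graph is a clique extension of
the pentagon or of the Petersen graph. Comparing twins in the local graphs of two adjacent vertices
forces b = 1 (`locallyMoore`). Thus μ = 2, and G is locally pentagon with k = 5 or locally Petersen
with k = 10.

For the classification it suffices to find a homomorphism from a known graph M to G. By `Rigid` such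
a map is bijective on neighbourhoods, is injective because M has diameter at most 4 and short closed
walks in G can be lifted, and is surjective because G is connected. So it is enough to name vertices
of G in such a way that every edge of M becomes an edge of G.

In the locally pentagon case the twelve names are immediate. In the locally Petersen case, label the
neighbours of x by the Petersen graph. Over each edge pq of it there are two vertices at distance
two from x, and for fixed p these form a hexagon, which has a 2-colouring. A vertex u at distance
three has among its neighbours a cycle of such vertices, whose underlying edges run around a
pentagon or a hexagon of the Petersen graph; `conf_type` shows that the kind is the same for all u.
The kind determines, modulo 2, how the colourings at the two ends of an edge compare around a
pentagon (`AllClose.sum`, `NoneClose.sum`). Since pentagons generate the cycles of the Petersen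
graph, the colourings can be normalised by one bit κ (`exists_gauge`). All names and their
adjacencies then depend on κ only: pentagons lead to the Doro graph and hexagons to the Conway–Smith
graph, by a finite check. -/

set_option linter.unusedSectionVars false

/-! ### Local graphs attaining the bound: cocliques and privately dominated vertices. -/

namespace KoolenPark

/-- A graph, given by its closed neighbourhoods `N v`, which are all of size `d`; two nonadjacent
vertices have `b` common neighbours, forming a clique; every pair of nonadjacent vertices lies in a
coclique of size `n`, and every such coclique dominates every vertex once or twice. -/
structure LocalData {W : Type*} [Fintype W] [DecidableEq W] (N : W → Finset W) (n d b : ℕ) :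
    Prop where
  refl : ∀ v, v ∈ N v
  symm : ∀ u v, u ∈ N v → v ∈ N u
  card : ∀ v, (N v).card = d
  inter : ∀ u v, u ∉ N v → (N u ∩ N v).card = b
  clique : ∀ u v s t, u ∉ N v → s ∈ N u → s ∈ N v → t ∈ N u → t ∈ N v → s ∈ N t
  cover : ∀ S : Finset W, S.card = n → (∀ s ∈ S, ∀ t ∈ S, s ≠ t → s ∉ N t) →
    ∀ v, (N v ∩ S).card = 1 ∨ (N v ∩ S).card = 2
  ext : ∀ u v, u ∉ N v → ∃ S : Finset W, S.card = n ∧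
    (∀ s ∈ S, ∀ t ∈ S, s ≠ t → s ∉ N t) ∧ u ∈ S ∧ v ∈ S
  pos : 1 ≤ b
  lt : d < Fintype.card W
  two_le : 2 ≤ n

namespace LocalData

variable {W : Type*} [Fintype W] [DecidableEq W] {N : W → Finset W} {n d b : ℕ}

/-- A coclique of size `n`. -/
def Coc (N : W → Finset W) (n : ℕ) (S : Finset W) : Prop :=
  S.card = n ∧ ∀ s ∈ S, ∀ t ∈ S, s ≠ t → s ∉ N t

/-- The vertices dominated by `s` only. -/
def priv (N : W → Finset W) (S : Finset W) (s : W) : Finset W :=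
  Finset.univ.filter fun v => N v ∩ S = {s}

/-- The vertices with the same closed neighbourhood as `v`. -/
def tw (N : W → Finset W) (v : W) : Finset W := Finset.univ.filter fun u => N u = N v

theorem mem_priv {S : Finset W} {s v : W} : v ∈ priv N S s ↔ N v ∩ S = {s} := by simp [priv]

theorem mem_tw {u v : W} : u ∈ tw N v ↔ N u = N v := by simp [tw]

theorem comm (h : LocalData N n d b) {u v : W} : u ∈ N v ↔ v ∈ N u := ⟨h.symm u v, h.symm v u⟩

theorem double_count (h : LocalData N n d b) (S A : Finset W) :
    ∑ t ∈ S, (A ∩ N t).card = ∑ v ∈ A, (N v ∩ S).card := by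
  simp only [← Finset.filter_mem_eq_inter, Finset.card_filter]
  have h1 : ∀ t, (∑ v ∈ A, if v ∈ N t then 1 else 0) = ((A.filter fun v => v ∈ N t).card) := by
    intro t; rw [Finset.card_filter]
  have h2 : ∀ v, ((N v).filter fun t => t ∈ S).card = ∑ t ∈ S, if v ∈ N t then 1 else 0 := by
    intro v
    rw [← Finset.card_filter]
    congr 1
    ext t
    simp only [Finset.mem_filter]
    rw [h.comm (u := t) (v := v)]
    tauto
  rw [Finset.sum_comm]
  refine Finset.sum_congr rfl fun v _ => ?_
  rw [← h2, Finset.card_filter]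

theorem sum_dominated (h : LocalData N n d b) {S : Finset W} (hS : Coc N n S) (A : Finset W) :
    ∑ v ∈ A, (N v ∩ S).card = A.card + (A.filter fun v => (N v ∩ S).card = 2).card := by
  rw [Finset.card_filter, Finset.card_eq_sum_ones, ← Finset.sum_add_distrib]
  refine Finset.sum_congr rfl fun v _ => ?_
  rcases h.cover S hS.1 hS.2 v with h1 | h1 <;> simp [h1]

theorem sum_inter_of_disjoint (h : LocalData N n d b) {R : Finset W} {v : W}
    (hv : ∀ t ∈ R, t ∉ N v) : ∑ t ∈ R, (N v ∩ N t).card = R.card * b := by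
  rw [Finset.sum_congr rfl fun t ht => h.inter v t fun h1 => hv t ht (h.symm _ _ h1)]
  simp

theorem self_mem_priv (h : LocalData N n d b) {S : Finset W} (hS : Coc N n S) {s : W}
    (hs : s ∈ S) : s ∈ priv N S s := by
  rw [mem_priv]
  ext t
  simp only [Finset.mem_inter, Finset.mem_singleton]
  constructor
  · rintro ⟨h1, h2⟩
    by_contra h3
    exact hS.2 t h2 s hs h3 h1
  · rintro rfl
    exact ⟨h.refl _, hs⟩

theorem priv_subset {S : Finset W} {s v : W} (h : LocalData N n d b) (hv : v ∈ priv N S s) :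
    v ∈ N s := by
  rw [mem_priv] at hv
  have : s ∈ N v ∩ S := by simp [hv]
  exact h.symm _ _ (Finset.mem_inter.1 this).1

theorem not_mem_of_priv {S : Finset W} {s t v : W} (hv : v ∈ priv N S s) (ht : t ∈ S)
    (hts : t ≠ s) : t ∉ N v := by
  rw [mem_priv] at hv
  intro h1
  have : t ∈ N v ∩ S := Finset.mem_inter.2 ⟨h1, ht⟩
  rw [hv] at this
  exact hts (Finset.mem_singleton.1 this)

theorem mem_priv_of_card {S : Finset W} {s v : W} (h : LocalData N n d b) (hs : s ∈ S)
    (hv : v ∈ N s) (h1 : (N v ∩ S).card = 1) : v ∈ priv N S s := by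
  rw [mem_priv]
  obtain ⟨t, ht⟩ := Finset.card_eq_one.1 h1
  have : s ∈ N v ∩ S := Finset.mem_inter.2 ⟨h.symm _ _ hv, hs⟩
  rw [ht] at this ⊢
  rw [Finset.mem_singleton.1 this]

theorem card_of_mem_priv {S : Finset W} {s v : W} (hv : v ∈ priv N S s) :
    (N v ∩ S).card = 1 := by
  rw [mem_priv] at hv
  simp [hv]

/-- Double counting of the dominations between `N p` and `S`: every `t ≠ s` in `S` is nonadjacent to
`p` and contributes `b`, while every `v ∈ N p` contributes 1 or 2. -/
theorem sum_inter_priv (h : LocalData N n d b) {S : Finset W} (hS : Coc N n S) {s p : W}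
    (hs : s ∈ S) (hp : p ∈ priv N S s) :
    (N p ∩ N s).card + (n - 1) * b =
      d + ((N p).filter fun v => (N v ∩ S).card = 2).card := by
  have h1 := h.double_count S (N p)
  rw [h.sum_dominated hS, h.card, ← Finset.add_sum_erase _ _ hs,
    h.sum_inter_of_disjoint, Finset.card_erase_of_mem hs, hS.1] at h1
  · exact h1
  · intro t ht
    rw [Finset.mem_erase] at ht
    exact not_mem_of_priv hp ht.2 ht.1

theorem card_priv (h : LocalData N n d b) {S : Finset W} (hS : Coc N n S) {s : W}
    (hs : s ∈ S) : (priv N S s).card + (n - 1) * b = d := by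
  have h1 := h.sum_inter_priv hS hs (h.self_mem_priv hS hs)
  rw [Finset.inter_self, h.card] at h1
  have h2 : priv N S s = (N s).filter fun v => ¬ (N v ∩ S).card = 2 := by
    ext v
    rw [Finset.mem_filter]
    constructor
    · intro hv
      exact ⟨h.priv_subset hv, by rw [card_of_mem_priv hv]; decide⟩
    · rintro ⟨h3, h4⟩
      exact h.mem_priv_of_card hs h3 ((h.cover S hS.1 hS.2 v).resolve_right h4)
  have h3 := Finset.card_filter_add_card_filter_not (s := N s) (fun v => (N v ∩ S).card = 2)
  rw [h.card, ← h2] at h3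
  omega

/-- Comparing `sum_inter_priv` for `p` and for `s` gives |N p ∩ N s| = |priv s| + |T|, with T the
doubly dominated part of `N p`. But N p ∩ N s is covered by its parts in priv s and in T, so both
lie in it entirely. -/
theorem priv_aux (h : LocalData N n d b) {S : Finset W} (hS : Coc N n S) {s p : W}
    (hs : s ∈ S) (hp : p ∈ priv N S s) :
    priv N S s ⊆ N p ∧ ∀ v ∈ N p, (N v ∩ S).card = 2 → v ∈ N s := by
  have h1 := h.sum_inter_priv hS hs hp
  have h2 := h.card_priv hS hs
  set T := (N p).filter fun v => (N v ∩ S).card = 2 with hT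
  have hsub : N p ∩ N s ⊆ (priv N S s ∩ N p) ∪ (T ∩ N s) := by
    intro v hv
    rw [Finset.mem_inter] at hv
    rw [Finset.mem_union, Finset.mem_inter, Finset.mem_inter, hT, Finset.mem_filter]
    rcases h.cover S hS.1 hS.2 v with h3 | h3
    · exact Or.inl ⟨h.mem_priv_of_card hs hv.2 h3, hv.1⟩
    · exact Or.inr ⟨⟨hv.1, h3⟩, hv.2⟩
  have h3 := (Finset.card_le_card hsub).trans (Finset.card_union_le _ _)
  have h4 := Finset.card_le_card (Finset.inter_subset_left (s₁ := priv N S s) (s₂ := N p))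
  have h5 := Finset.card_le_card (Finset.inter_subset_left (s₁ := T) (s₂ := N s))
  have h6 : priv N S s ∩ N p = priv N S s :=
    Finset.eq_of_subset_of_card_le Finset.inter_subset_left (by omega)
  have h7 : T ∩ N s = T := Finset.eq_of_subset_of_card_le Finset.inter_subset_left (by omega)
  refine ⟨Finset.inter_eq_left.1 h6, fun v hv hv2 => ?_⟩
  have : v ∈ T := Finset.mem_filter.2 ⟨hv, hv2⟩
  exact Finset.inter_eq_left.1 h7 this

/-- A vertex that is dominated by two elements of `S` other than `s` has no neighbours that are
dominated by `s` only. -/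
theorem priv_not_adj (h : LocalData N n d b) {S : Finset W} (hS : Coc N n S) {s p v t r : W}
    (hs : s ∈ S) (hp : p ∈ priv N S s) (hv : v ∈ N p) (ht : t ∈ S) (hr : r ∈ S) (htr : t ≠ r)
    (hvt : v ∈ N t) (hvr : v ∈ N r) : v ∈ N s := by
  refine (h.priv_aux hS hs hp).2 v hv ?_
  refine (h.cover S hS.1 hS.2 v).resolve_left fun h1 => ?_
  obtain ⟨w, hw⟩ := Finset.card_eq_one.1 h1
  have h2 : t ∈ N v ∩ S := Finset.mem_inter.2 ⟨h.symm _ _ hvt, ht⟩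
  have h3 : r ∈ N v ∩ S := Finset.mem_inter.2 ⟨h.symm _ _ hvr, hr⟩
  rw [hw, Finset.mem_singleton] at h2 h3
  exact htr (h2.trans h3.symm)

theorem not_three (h : LocalData N n d b) {S : Finset W} (hS : Coc N n S) {v s t r : W}
    (hs : s ∈ S) (ht : t ∈ S) (hr : r ∈ S) (h1 : s ≠ t) (h2 : s ≠ r) (h3 : t ≠ r)
    (hvs : v ∈ N s) (hvt : v ∈ N t) (hvr : v ∈ N r) : False := by
  have h4 : ({s, t, r} : Finset W) ⊆ N v ∩ S := by
    intro u hu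
    simp only [Finset.mem_insert, Finset.mem_singleton] at hu
    rcases hu with rfl | rfl | rfl <;> simp [*, h.comm (v := v)]
  have h5 := Finset.card_le_card h4
  rw [Finset.card_eq_three.2 ⟨s, t, r, h1, h2, h3, rfl⟩] at h5
  rcases h.cover S hS.1 hS.2 v with h6 | h6 <;> omega

theorem dominated (h : LocalData N n d b) {S : Finset W} (hS : Coc N n S) (v : W) :
    ∃ s ∈ S, v ∈ N s := by
  have : (N v ∩ S).Nonempty := by
    rw [← Finset.card_pos]
    rcases h.cover S hS.1 hS.2 v with h6 | h6 <;> omega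
  obtain ⟨s, hs⟩ := this
  rw [Finset.mem_inter] at hs
  exact ⟨s, hs.2, h.symm _ _ hs.1⟩

theorem mem_priv_of (h : LocalData N n d b) {S : Finset W} (hS : Coc N n S) {v s : W}
    (hv : ∀ t ∈ S, t ≠ s → v ∉ N t) : v ∈ priv N S s := by
  rw [mem_priv]
  obtain ⟨t, ht, hvt⟩ := h.dominated hS v
  have hts : t = s := by
    by_contra h1
    exact hv t ht h1 hvt
  subst hts
  ext r
  simp only [Finset.mem_inter, Finset.mem_singleton]
  constructor
  · rintro ⟨h1, h2⟩
    by_contra h3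
    exact hv r h2 h3 (h.symm _ _ h1)
  · rintro rfl
    exact ⟨h.symm _ _ hvt, ht⟩

theorem exists_not_mem (h : LocalData N n d b) (v : W) : ∃ u, u ∉ N v := by
  by_contra! h1
  have := Finset.card_le_card (fun u _ => h1 u : Finset.univ ⊆ N v)
  rw [Finset.card_univ, h.card] at this
  exact absurd h.lt (by omega)

/-! ### Pentagons -/

/-- An induced pentagon together with a coclique `R` of size `n - 2` of vertices not adjacent
to it. -/
structure Pent (N : W → Finset W) (n : ℕ) (R : Finset W) (p q r s t : W) : Prop where
  pq : p ∈ N q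
  qr : q ∈ N r
  rs : r ∈ N s
  st : s ∈ N t
  tp : t ∈ N p
  pr : p ∉ N r
  qs : q ∉ N s
  rt : r ∉ N t
  sp : s ∉ N p
  tq : t ∉ N q
  coc : Coc N (n - 2) R
  hp : ∀ x ∈ R, p ∉ N x
  hq : ∀ x ∈ R, q ∉ N x
  hr : ∀ x ∈ R, r ∉ N x
  hs : ∀ x ∈ R, s ∉ N x
  ht : ∀ x ∈ R, t ∉ N x

namespace Pent

variable {R : Finset W} {p q r s t : W}

theorem rotate (h : Pent N n R p q r s t) : Pent N n R q r s t p :=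
  ⟨h.qr, h.rs, h.st, h.tp, h.pq, h.qs, h.rt, h.sp, h.tq, h.pr, h.coc, h.hq, h.hr, h.hs, h.ht, h.hp⟩

end Pent

theorem coc_insert (h : LocalData N n d b) {R : Finset W} (hR : Coc N (n - 2) R) {p q : W}
    (hpq : p ∉ N q) (hp : ∀ x ∈ R, p ∉ N x) (hq : ∀ x ∈ R, q ∉ N x) :
    Coc N n (insert p (insert q R)) := by
  have hpR : p ∉ R := fun h1 => hp p h1 (h.refl _)
  have hqR : q ∉ R := fun h1 => hq q h1 (h.refl _)
  have hne : p ≠ q := fun h1 => hpq (h1 ▸ h.refl _)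
  have := h.two_le
  refine ⟨?_, ?_⟩
  · rw [Finset.card_insert_of_notMem (by simp [hne, hpR]), Finset.card_insert_of_notMem hqR, hR.1]
    omega
  · intro s hs t ht hst
    rw [Finset.mem_insert, Finset.mem_insert] at hs ht
    rcases hs with rfl | rfl | hs <;> rcases ht with rfl | rfl | ht
    · exact absurd rfl hst
    · exact hpq
    · exact hp _ ht
    · rwa [h.comm]
    · exact absurd rfl hst
    · exact hq _ ht
    · rw [h.comm]; exact hp _ hs
    · rw [h.comm]; exact hq _ hs
    · exact hR.2 s hs t ht hst

theorem Pent.coc_pr (h : LocalData N n d b) {R : Finset W} {p q r s t : W}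
    (hP : Pent N n R p q r s t) : Coc N n (insert p (insert r R)) :=
  h.coc_insert hP.coc hP.pr hP.hp hP.hr

/-- A common neighbour of `x ∈ R` and a vertex of the pentagon is adjacent to exactly one of the
neighbours of that vertex. -/
theorem Pent.edge (h : LocalData N n d b) {R : Finset W} {p q r s t : W}
    (hP : Pent N n R p q r s t) {x y : W} (hx : x ∈ R) (hyx : y ∈ N x) (hyp : y ∈ N p) :
    y ∉ N r ∧ y ∉ N s ∧ ((y ∈ N q ∧ y ∉ N t) ∨ (y ∈ N t ∧ y ∉ N q)) := by
  have nR : ∀ {v}, (∀ x ∈ R, v ∉ N x) → v ∉ R := fun hv h1 => hv _ h1 (h.refl _)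
  have ne : ∀ {v}, (∀ x ∈ R, v ∉ N x) → v ≠ x := fun hv h1 => nR hv (h1 ▸ hx)
  have hpr : p ≠ r := fun h1 => hP.pr (h1 ▸ h.refl _)
  have hsp : s ≠ p := fun h1 => hP.sp (h1 ▸ h.refl _)
  have htq : t ≠ q := fun h1 => hP.tq (h1 ▸ h.refl _)
  have c1 := Pent.coc_pr h hP
  have c2 := Pent.coc_pr h hP.rotate.rotate.rotate
  have c3 := Pent.coc_pr h hP.rotate.rotate.rotate.rotate
  have h1 : y ∉ N r := fun hyr => h.not_three c1 (by simp) (by simp) (by simp [hx]) hpr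
    (ne hP.hp) (ne hP.hr) hyp hyr hyx
  have h2 : y ∉ N s := fun hys => h.not_three c2 (by simp) (by simp) (by simp [hx]) hsp
    (ne hP.hs) (ne hP.hp) hys hyp hyx
  refine ⟨h1, h2, ?_⟩
  by_cases hq : y ∈ N q <;> by_cases ht : y ∈ N t
  · exact (h.not_three c3 (by simp) (by simp) (by simp [hx]) htq (ne hP.ht) (ne hP.hq)
      ht hq hyx).elim
  · exact Or.inl ⟨hq, ht⟩
  · exact Or.inr ⟨ht, hq⟩
  -- A vertex `y` adjacent to neither `q` nor `t` would be dominated by `x` alone in the coclique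
  -- `t, q, R`. Its neighbour `p` is dominated by `t` and `q`, so `priv_not_adj` would make `p`
  -- adjacent to `x`.
  · have hy : y ∈ priv N (insert t (insert q R)) x := by
      refine h.mem_priv_of c3 fun z hz hzx hyz => ?_
      rw [Finset.mem_insert, Finset.mem_insert] at hz
      rcases hz with rfl | rfl | hz
      · exact ht hyz
      · exact hq hyz
      · exact h.not_three c1 (s := p) (t := x) (r := z) (by simp) (by simp [hx]) (by simp [hz])
          (ne hP.hp) (fun h1 => nR hP.hp (h1 ▸ hz)) (Ne.symm hzx) hyp hyx hyz
    exact (hP.hp x hx (h.priv_not_adj c3 (by simp [hx]) hy (h.symm _ _ hyp) (by simp)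
      (by simp : q ∈ _) htq (h.symm _ _ hP.tp) hP.pq)).elim

/-- A common neighbour `y` of `x`, `p`, `q` would satisfy `N y ∩ N s ⊆ N p ∩ N s`. Both sets have
size `b`, so they agree; but `t` lies in the second and is not adjacent to `y`. -/
theorem Pent.false_aux (h : LocalData N n d b) {R : Finset W} {p q r s t : W}
    (hP : Pent N n R p q r s t) {x y : W} (hx : x ∈ R) (hyx : y ∈ N x) (hyp : y ∈ N p)
    (hyq : y ∈ N q) : False := by
  obtain ⟨hyr, hys, h0⟩ := hP.edge h hx hyx hyp
  have hyt : y ∉ N t := h0.elim (fun h1 => h1.2) fun h1 => absurd hyq h1.2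
  have nR : ∀ {v}, (∀ x ∈ R, v ∉ N x) → v ∉ R := fun hv h1 => hv _ h1 (h.refl _)
  have ne : ∀ {v z}, z ∈ R → (∀ x ∈ R, v ∉ N x) → v ≠ z := fun hz hv h1 => nR hv (h1 ▸ hz)
  have hpr : p ≠ r := fun h1 => hP.pr (h1 ▸ h.refl _)
  have hqs : q ≠ s := fun h1 => hP.qs (h1 ▸ h.refl _)
  have htq : t ≠ q := fun h1 => hP.tq (h1 ▸ h.refl _)
  have hsp : s ≠ p := fun h1 => hP.sp (h1 ▸ h.refl _)
  have c1 := Pent.coc_pr h hP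
  have c2 := Pent.coc_pr h hP.rotate
  have c3 := Pent.coc_pr h hP.rotate.rotate.rotate
  have c4 := Pent.coc_pr h hP.rotate.rotate.rotate.rotate
  have hsub : N y ∩ N s ⊆ N p ∩ N s := by
    intro z hz
    obtain ⟨hzy, hzs⟩ := Finset.mem_inter.1 hz
    refine Finset.mem_inter.2 ⟨?_, hzs⟩
    by_cases hR : ∃ x' ∈ R, z ∈ N x'
    · exfalso
      obtain ⟨x', hx', hzx'⟩ := hR
      obtain ⟨hzp, hzq, h1⟩ := Pent.edge h hP.rotate.rotate.rotate hx' hzx' hzs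
      by_cases hxx : x' = x
      · subst hxx
        rcases h1 with ⟨h1, h2⟩ | ⟨h1, h2⟩
        · exact hzp (h.symm _ _ (h.clique y t p z hyt (h.symm _ _ hyp) (h.symm _ _ hP.tp) hzy h1))
        · exact hzq (h.symm _ _ (h.clique y r q z hyr (h.symm _ _ hyq) hP.qr hzy h1))
      have hother : ∀ x'' ∈ R, x'' ≠ x' → z ∉ N x'' := fun x'' h2 h3 h4 =>
        h.not_three c3 (s := s) (t := x') (r := x'') (by simp) (by simp [hx']) (by simp [h2])
          (ne hx' hP.hs) (ne h2 hP.hs) (Ne.symm h3) hzs hzx' h4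
      have hyx' : y ∉ N x' := fun h2 => h.not_three c1 (s := p) (t := x) (r := x') (by simp)
        (by simp [hx]) (by simp [hx']) (ne hx hP.hp) (ne hx' hP.hp) (Ne.symm hxx) hyp hyx h2
      rcases h1 with ⟨h1, h2⟩ | ⟨h1, h2⟩
      · have hz' : z ∈ priv N (insert p (insert r R)) x' := by
          refine h.mem_priv_of c1 fun w hw hwx => ?_
          rw [Finset.mem_insert, Finset.mem_insert] at hw
          rcases hw with rfl | rfl | hw
          exacts [hzp, h2, hother _ hw hwx]
        exact hyx' (h.priv_not_adj c1 (by simp [hx']) hz' (h.symm _ _ hzy) (by simp)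
          (by simp [hx] : x ∈ _) (ne hx hP.hp) hyp hyx)
      · have hz' : z ∈ priv N (insert t (insert q R)) x' := by
          refine h.mem_priv_of c4 fun w hw hwx => ?_
          rw [Finset.mem_insert, Finset.mem_insert] at hw
          rcases hw with rfl | rfl | hw
          exacts [h2, hzq, hother _ hw hwx]
        exact hyx' (h.priv_not_adj c4 (by simp [hx']) hz' (h.symm _ _ hzy) (by simp)
          (by simp [hx] : x ∈ _) (ne hx hP.hq) hyq hyx)
    · push Not at hR
      by_contra hzp
      have hz' : z ∈ priv N (insert s (insert p R)) s := by
        refine h.mem_priv_of c3 fun w hw hwx => ?_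
        rw [Finset.mem_insert, Finset.mem_insert] at hw
        rcases hw with rfl | rfl | hw
        exacts [(hwx rfl).elim, hzp, hR _ hw]
      exact hys (h.priv_not_adj c3 (by simp) hz' (h.symm _ _ hzy) (by simp)
          (by simp [hx] : x ∈ _) (ne hx hP.hp) hyp hyx)
  have heq := Finset.eq_of_subset_of_card_le hsub
    (by rw [h.inter y s hys, h.inter p s fun h1 => hP.sp (h.symm _ _ h1)])
  have : t ∈ N p ∩ N s := Finset.mem_inter.2 ⟨hP.tp, h.symm _ _ hP.st⟩
  rw [← heq] at this
  exact hyt (h.symm _ _ (Finset.mem_inter.1 this).1)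

/-- Since `b ≥ 1`, an `x ∈ R` has a common neighbour with `p`. By `Pent.edge` it is adjacent also to
`q` or to `t`, and `Pent.false_aux` excludes both. Hence such pentagons occur only for n = 2. -/
theorem Pent.empty (h : LocalData N n d b) {R : Finset W} {p q r s t : W}
    (hP : Pent N n R p q r s t) : R = ∅ := by
  by_contra hR
  obtain ⟨x, hx⟩ := Finset.nonempty_iff_ne_empty.2 hR
  have h1 : (N p ∩ N x).card = b := h.inter p x (hP.hp x hx)
  have h2 : (N p ∩ N x).Nonempty := by
    rw [← Finset.card_pos, h1]; exact h.pos
  obtain ⟨y, hy⟩ := h2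
  rw [Finset.mem_inter] at hy
  rcases (hP.edge h hx hy.2 hy.1).2.2 with h3 | h3
  · exact hP.false_aux h hx hy.2 hy.1 h3.1
  · exact Pent.false_aux h hP.rotate.rotate.rotate.rotate hx hy.2 h3.1 hy.1

/-- The pentagon is `s w t q p` with `q` privately dominated by `t`. The vertices `q` and `p` are
adjacent, because otherwise `q, p, R` would be a coclique of size `n` that does not dominate `w`. -/
theorem exists_pent (h : LocalData N n d b) {S : Finset W} (hS : Coc N n S) {s t w p : W}
    (hs : s ∈ S) (ht : t ∈ S) (hst : s ≠ t) (hws : w ∈ N s) (hwt : w ∈ N t)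
    (hp : p ∈ priv N S s) (hpw : p ∉ N w) :
    ∃ R q, Pent N n R s w t q p := by
  set R := (S.erase s).erase t with hR
  have hRS : ∀ x ∈ R, x ∈ S ∧ x ≠ s ∧ x ≠ t := fun x hx => by
    simp only [hR, Finset.mem_erase] at hx; exact ⟨hx.2.2, hx.2.1, hx.1⟩
  have hcR : Coc N (n - 2) R := by
    refine ⟨?_, fun x hx y hy => hS.2 x (hRS x hx).1 y (hRS y hy).1⟩
    rw [hR, Finset.card_erase_of_mem (by simp [ht, hst.symm]), Finset.card_erase_of_mem hs, hS.1]
    omega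
  have hsR : ∀ x ∈ R, s ∉ N x := fun x hx => hS.2 s hs x (hRS x hx).1 (hRS x hx).2.1.symm
  have htR : ∀ x ∈ R, t ∉ N x := fun x hx => hS.2 t ht x (hRS x hx).1 (hRS x hx).2.2.symm
  have hwR : ∀ x ∈ R, w ∉ N x := fun x hx h1 => h.not_three hS hs ht (hRS x hx).1 hst
    (hRS x hx).2.1.symm (hRS x hx).2.2.symm hws hwt h1
  have hprivR : ∀ {v u}, (u = s ∨ u = t) → v ∈ priv N S u → ∀ x ∈ R, v ∉ N x := by
    intro v u hu hv x hx h1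
    refine not_mem_of_priv hv (hRS x hx).1 ?_ (h.symm _ _ h1)
    rcases hu with rfl | rfl
    exacts [(hRS x hx).2.1, (hRS x hx).2.2]
  have hpR := hprivR (Or.inl rfl) hp
  -- If all private vertices of `t` were adjacent to `w`, then in the coclique `p, w, R` the private
  -- vertices of `p` would be private for `s` in `S` and different from `s`. By `card_priv` the two
  -- sets have equal size.
  have hq : ∃ q ∈ priv N S t, q ∉ N w := by
    by_contra! hq
    have c := h.coc_insert hcR hpw hpR hwR
    have h1 := h.card_priv c (Finset.mem_insert_self _ _)
    have h2 := h.card_priv hS hs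
    have h3 : priv N (insert p (insert w R)) p ⊆ (priv N S s).erase s := by
      intro v hv
      have hvw : v ∉ N w := fun h1 => not_mem_of_priv hv (by simp)
        (fun h2 => hpw (h2 ▸ h.refl _)) (h.symm _ _ h1)
      have hvR : ∀ x ∈ R, v ∉ N x := fun x hx h1 => not_mem_of_priv hv (by simp [hx])
        (fun h2 => hpR x hx (h2 ▸ h.refl _)) (h.symm _ _ h1)
      refine Finset.mem_erase.2 ⟨fun h1 => hvw (h1 ▸ h.symm _ _ hws), ?_⟩
      have hvt : v ∉ N t := fun hvt => by
        by_cases hvs : v ∈ N s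
        · exact hvw (h.clique s t v w (hS.2 s hs t ht hst) hvs hvt hws hwt)
        · refine hvw (hq v (h.mem_priv_of hS fun x hx hxt => ?_))
          by_cases hxs : x = s
          · rwa [hxs]
          · exact hvR x (by simp [hR, hx, hxs, hxt])
      refine h.mem_priv_of hS fun x hx hxs => ?_
      by_cases hxt : x = t
      · rwa [hxt]
      · exact hvR x (by simp [hR, hx, hxs, hxt])
    have h4 := Finset.card_le_card h3
    rw [Finset.card_erase_of_mem (h.self_mem_priv hS hs)] at h4
    have h5 := Finset.card_pos.2 ⟨s, h.self_mem_priv hS hs⟩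
    omega
  obtain ⟨q, hq, hqw⟩ := hq
  have hqR := hprivR (Or.inr rfl) hq
  refine ⟨R, q, h.symm _ _ hws, hwt, h.symm _ _ (h.priv_subset hq), ?_, h.priv_subset hp,
    hS.2 s hs t ht hst, fun h1 => hqw (h.symm _ _ h1), not_mem_of_priv hp ht hst.symm,
    fun h1 => not_mem_of_priv hq hs hst (h.symm _ _ h1), hpw, hcR, hsR, hwR, htR, hqR, hpR⟩
  by_contra hqp
  obtain ⟨x, hx, hwx⟩ := h.dominated (h.coc_insert hcR hqp hqR hpR) w
  rw [Finset.mem_insert, Finset.mem_insert] at hx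
  rcases hx with rfl | rfl | hx
  exacts [hqw (h.symm _ _ hwx), hpw (h.symm _ _ hwx), hwR x hx hwx]

end LocalData

end KoolenPark

/-! ### Local graphs with n ≥ 3: reduction to n = 4. -/

namespace KoolenPark
namespace LocalData

variable {W : Type*} [Fintype W] [DecidableEq W] {N : W → Finset W} {n d b : ℕ}

/-- A nonadjacent pair `p`, `w` would produce a pentagon with n - 2 > 0 further vertices, against
`Pent.empty`. -/
theorem full (h : LocalData N n d b) (hn : 3 ≤ n) {S : Finset W} (hS : Coc N n S) {s t w p : W}
    (hs : s ∈ S) (ht : t ∈ S) (hst : s ≠ t) (hws : w ∈ N s) (hwt : w ∈ N t)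
    (hp : p ∈ priv N S s) : p ∈ N w := by
  by_contra hpw
  obtain ⟨R, q, hP⟩ := h.exists_pent hS hs ht hst hws hwt hp hpw
  have h1 := hP.coc.1
  rw [hP.empty h, Finset.card_empty] at h1
  omega

theorem exists_coc (h : LocalData N n d b) (v : W) : ∃ S, Coc N n S ∧ v ∈ S := by
  obtain ⟨u, hu⟩ := h.exists_not_mem v
  obtain ⟨S, h1, h2, h3, h4⟩ := h.ext u v hu
  exact ⟨S, ⟨h1, h2⟩, h4⟩

theorem exists_two {S : Finset W} (h : LocalData N n d b) {v : W}
    (hv : (N v ∩ S).card = 2) : ∃ s ∈ S, ∃ t ∈ S, s ≠ t ∧ v ∈ N s ∧ v ∈ N t := by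
  obtain ⟨s, t, hst, h1⟩ := Finset.card_eq_two.1 hv
  have h2 : s ∈ N v ∩ S := by simp [h1]
  have h3 : t ∈ N v ∩ S := by simp [h1]
  rw [Finset.mem_inter] at h2 h3
  exact ⟨s, h2.2, t, h3.2, hst, h.symm _ _ h2.1, h.symm _ _ h3.1⟩

/-- If `p` is private for `s`, then `N s ⊆ N p`: singly dominated vertices of `N s` are covered by
`priv_aux`, doubly dominated ones by `full`. Equal sizes make `p` a twin of `s`. So twin classes
have the size given by `card_priv`, independently of the coclique. -/
theorem priv_eq_tw (h : LocalData N n d b) (hn : 3 ≤ n) {S : Finset W} (hS : Coc N n S) {s : W}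
    (hs : s ∈ S) : priv N S s = tw N s := by
  ext p
  rw [mem_tw]
  constructor
  · intro hp
    refine (Finset.eq_of_subset_of_card_le (fun v hv => ?_) (by rw [h.card, h.card])).symm
    rcases h.cover S hS.1 hS.2 v with h1 | h1
    · exact (h.priv_aux hS hs hp).1 (h.mem_priv_of_card hs hv h1)
    · obtain ⟨x, hx, y, hy, hxy, hvx, hvy⟩ := h.exists_two h1
      by_cases hxs : x = s
      · subst hxs
        exact h.symm _ _ (h.full hn hS hx hy hxy hvx hvy hp)
      · exact h.symm _ _ (h.full hn hS hs hx (Ne.symm hxs) hv hvx hp)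
  · intro hp
    have := h.self_mem_priv hS hs
    rw [mem_priv] at this ⊢
    rwa [hp]

theorem card_tw (h : LocalData N n d b) (hn : 3 ≤ n) (v : W) :
    (tw N v).card + (n - 1) * b = d := by
  obtain ⟨S, hS, hv⟩ := h.exists_coc v
  rw [← h.priv_eq_tw hn hS hv, h.card_priv hS hv]

theorem self_mem_tw (v : W) : v ∈ tw N v := mem_tw.2 rfl

theorem tw_pos (v : W) : 1 ≤ (tw N v).card := Finset.card_pos.2 ⟨v, self_mem_tw v⟩

theorem tw_disjoint {u v : W} (huv : N u ≠ N v) : Disjoint (tw N u) (tw N v) := by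
  rw [Finset.disjoint_left]
  intro x hx hx'
  exact huv ((mem_tw.1 hx).symm.trans (mem_tw.1 hx'))

theorem tw_subset (h : LocalData N n d b) {u v : W} (huv : u ∈ N v) : tw N u ⊆ N v := by
  intro x hx
  rw [h.comm, mem_tw.1 hx]
  exact h.symm _ _ huv

/-- The number of pairs of common closed neighbours for two nonadjacent neighbours of a vertex. -/
theorem inter_add_inter (h : LocalData N n d b) (hn : 3 ≤ n) {w y z : W} (hyz : y ∉ N z)
    (hwy : w ∈ N y) (hwz : w ∈ N z) : (N w ∩ N y).card + (N w ∩ N z).card = n * b := by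
  obtain ⟨S, hS1, hS2, hy, hz⟩ := h.ext y z hyz
  have hS : Coc N n S := ⟨hS1, hS2⟩
  have hne : y ≠ z := fun h1 => hyz (h1 ▸ h.refl _)
  have h1 := h.double_count S (N w)
  have hR : ∀ t ∈ (S.erase y).erase z, t ∉ N w := by
    intro t ht htw
    simp only [Finset.mem_erase] at ht
    exact h.not_three hS hy hz ht.2.2 hne (Ne.symm ht.2.1) (Ne.symm ht.1) hwy hwz (h.symm _ _ htw)
  rw [h.sum_dominated hS, h.card, ← Finset.add_sum_erase _ _ hy,
    ← Finset.add_sum_erase _ _ (Finset.mem_erase.2 ⟨hne.symm, hz⟩),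
    h.sum_inter_of_disjoint hR, Finset.card_erase_of_mem (Finset.mem_erase.2 ⟨hne.symm, hz⟩),
    Finset.card_erase_of_mem hy, hS1] at h1
  -- A vertex of `N w` dominated once belongs to `y` or `z`: a private vertex of a third element of
  -- `S` is not adjacent to the doubly dominated `w`. Inserting the size d - (n - 1)b of a twin
  -- class turns the count `h1` into nb.
  have h2 : ((N w).filter fun v => ¬ (N v ∩ S).card = 2) = tw N y ∪ tw N z := by
    rw [← h.priv_eq_tw hn hS hy, ← h.priv_eq_tw hn hS hz]
    ext v
    rw [Finset.mem_filter, Finset.mem_union]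
    constructor
    · rintro ⟨hv, h3⟩
      have h4 := (h.cover S hS.1 hS.2 v).resolve_right h3
      obtain ⟨t, ht, hvt⟩ := h.dominated hS v
      have hvp := h.mem_priv_of_card ht hvt h4
      by_contra hcon
      push Not at hcon
      have hty : t ≠ y := fun h1 => hcon.1 (h1 ▸ hvp)
      have htz : t ≠ z := fun h1 => hcon.2 (h1 ▸ hvp)
      exact h.not_three hS hy hz ht hne hty.symm htz.symm hwy hwz
        (h.priv_not_adj hS ht hvp (h.symm _ _ hv) hy hz hne hwy hwz)
    · rintro (hv | hv)
      · exact ⟨h.full hn hS hy hz hne hwy hwz hv, by rw [card_of_mem_priv hv]; decide⟩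
      · exact ⟨h.full hn hS hz hy hne.symm hwz hwy hv, by rw [card_of_mem_priv hv]; decide⟩
  have h3 := Finset.card_filter_add_card_filter_not (s := N w) (fun v => (N v ∩ S).card = 2)
  rw [h2, h.card, Finset.card_union_of_disjoint
    (tw_disjoint fun h1 : N y = N z => hyz (h1 ▸ h.refl y))] at h3
  have h4 := h.card_tw hn y
  have h5 := h.card_tw hn z
  obtain ⟨m, rfl⟩ : ∃ m, n = m + 3 := ⟨n - 3, by omega⟩
  simp only [show m + 3 - 1 = m + 2 by omega, show m + 2 - 1 = m + 1 by omega] at *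
  nlinarith

theorem inter_subset (h : LocalData N n d b) {w y z : W} (hyz : y ∉ N z)
    (hwy : w ∈ N y) (hwz : w ∈ N z) : N y ∩ N z ⊆ N w := by
  intro x hx
  rw [Finset.mem_inter] at hx
  exact h.clique y z x w hyz hx.1 hx.2 hwy hwz

/-- Otherwise `N w` is the union of `N w ∩ N y` and `N w ∩ N z`, which meet in the `b` vertices of
`N y ∩ N z`. This gives d = nb - b, leaving no room for the twin class of `y`. -/
theorem exists_third (h : LocalData N n d b) (hn : 3 ≤ n) {w y z : W} (hyz : y ∉ N z)
    (hwy : w ∈ N y) (hwz : w ∈ N z) : ∃ v ∈ N w, v ∉ N y ∧ v ∉ N z := by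
  by_contra! hcon
  have h1 := h.inter_add_inter hn hyz hwy hwz
  have h2 := Finset.card_union_add_card_inter (N w ∩ N y) (N w ∩ N z)
  have h3 : N w ∩ N y ∪ N w ∩ N z = N w := by
    ext v
    simp only [Finset.mem_union, Finset.mem_inter]
    constructor
    · tauto
    · intro hv
      by_cases h4 : v ∈ N y
      · tauto
      · exact Or.inr ⟨hv, hcon v hv h4⟩
  have h4 : N w ∩ N y ∩ (N w ∩ N z) = N y ∩ N z := by
    have := h.inter_subset hyz hwy hwz
    ext v
    have := @this v
    simp only [Finset.mem_inter] at *
    tauto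
  rw [h3, h4, h.card, h.inter y z hyz, h1] at h2
  have h5 := h.card_tw hn y
  have h6 := tw_pos (N := N) y
  obtain ⟨m, rfl⟩ : ∃ m, n = m + 3 := ⟨n - 3, by omega⟩
  simp only [show m + 3 - 1 = m + 2 by omega] at *
  nlinarith

/-- The vertex `w` has three pairwise nonadjacent neighbours, one of them `y`. The three
intersection sizes have pairwise sums nb, so each is nb/2. -/
theorem two_mul_inter (h : LocalData N n d b) (hn : 3 ≤ n) {w y : W} (hy : w ∈ N y)
    (hwy : N w ≠ N y) : 2 * (N w ∩ N y).card = n * b := by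
  have : ∃ z ∈ N w, z ∉ N y := by
    by_contra! h1
    exact hwy (Finset.eq_of_subset_of_card_le h1 (by rw [h.card, h.card]))
  obtain ⟨z, hzw, hzy⟩ := this
  have hwz := h.symm _ _ hzw
  obtain ⟨v, hvw, hvz, hvy⟩ := h.exists_third hn hzy hwz hy
  have hwv := h.symm _ _ hvw
  have h1 := h.inter_add_inter hn hzy hwz hy
  have h2 := h.inter_add_inter hn hvz hwv hwz
  have h3 := h.inter_add_inter hn hvy hwv hy
  omega

/-- For n = 3, extend a nonadjacent pair with common neighbour `w` to a coclique. A neighbour `u` of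
`w` outside both closed neighbourhoods is private for the third element, which forces `w` to be
dominated three times. -/
theorem four_le (h : LocalData N n d b) (hn : 3 ≤ n) : 4 ≤ n := by
  by_contra hn4
  obtain rfl : n = 3 := by omega
  obtain ⟨v⟩ : Nonempty W := Fintype.card_pos_iff.1 (lt_of_le_of_lt (Nat.zero_le _) h.lt)
  obtain ⟨z, hyz⟩ := h.exists_not_mem v
  have h1 : (N z ∩ N v).Nonempty := by
    rw [← Finset.card_pos, h.inter z v hyz]; exact h.pos
  obtain ⟨w, hw⟩ := h1
  rw [Finset.mem_inter] at hw
  obtain ⟨u, huw, huy, huz⟩ := h.exists_third hn hyz hw.1 hw.2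
  obtain ⟨S, hS1, hS2, hy, hz⟩ := h.ext z v hyz
  have hS : Coc N 3 S := ⟨hS1, hS2⟩
  have hne : z ≠ v := fun h1 => hyz (h1 ▸ h.refl _)
  have hu : (N u ∩ S).card = 1 := by
    have h2 : N u ∩ S ⊆ (S.erase z).erase v := by
      intro t ht
      rw [Finset.mem_inter] at ht
      rw [Finset.mem_erase, Finset.mem_erase]
      exact ⟨fun h1 => huz (h.symm _ _ (h1 ▸ ht.1)), fun h1 => huy (h.symm _ _ (h1 ▸ ht.1)), ht.2⟩
    have h3 := Finset.card_le_card h2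
    rw [Finset.card_erase_of_mem (Finset.mem_erase.2 ⟨hne.symm, hz⟩), Finset.card_erase_of_mem hy,
      hS1] at h3
    rcases h.cover S hS.1 hS.2 u with h6 | h6 <;> omega
  obtain ⟨t, ht, hut⟩ := h.dominated hS u
  have hup := h.mem_priv_of_card ht hut hu
  have hty : t ≠ z := fun h1 => huy (h1 ▸ hut)
  have htz : t ≠ v := fun h1 => huz (h1 ▸ hut)
  exact h.not_three hS hy hz ht hne hty.symm htz.symm hw.1 hw.2
    (h.priv_not_adj hS ht hup (h.symm _ _ huw) hy hz hne hw.1 hw.2)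

theorem card_union_three (A B C : Finset W) : (A ∪ B ∪ C).card + (A ∩ B).card + (A ∩ C).card +
    (B ∩ C).card = A.card + B.card + C.card + (A ∩ B ∩ C).card := by
  have h1 := Finset.card_union_add_card_inter (A ∪ B) C
  have h2 := Finset.card_union_add_card_inter A B
  have h3 := Finset.card_union_add_card_inter (A ∩ C) (B ∩ C)
  rw [← Finset.union_inter_distrib_right] at h3
  have h4 : A ∩ C ∩ (B ∩ C) = A ∩ B ∩ C := by ext; simp only [Finset.mem_inter]; tauto
  rw [h4] at h3
  omega

/-- Inclusion–exclusion for `N y`, `N z`, `N v` inside `N w` gives 3nb/2 - 3b + |N y ∩ N z ∩ N v| ≤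
d = |tw w| + (n - 1)b. The triple intersection contains `tw w`, so n ≤ 4, and for n = 4 both
inequalities are equalities. -/
theorem triple (h : LocalData N n d b) (hn : 3 ≤ n) {w y z v : W} (hyz : y ∉ N z)
    (hwy : w ∈ N y) (hwz : w ∈ N z) (hvw : v ∈ N w) (hvy : v ∉ N y) (hvz : v ∉ N z) :
    n = 4 ∧ N y ∩ N z ∩ N v = tw N w := by
  have hwv := h.symm _ _ hvw
  have ne : ∀ {x : W}, w ∈ N x → (∃ s, s ∈ N w ∧ s ∉ N x) → N w ≠ N x := by
    rintro x hx ⟨s, hs, hs'⟩ h1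
    exact hs' (h1 ▸ hs)
  have h1 := h.two_mul_inter hn hwy (ne hwy ⟨v, hvw, hvy⟩)
  have h2 := h.two_mul_inter hn hwz (ne hwz ⟨v, hvw, hvz⟩)
  have h3 := h.two_mul_inter hn hwv (ne hwv ⟨y, h.symm _ _ hwy, fun h1 => hvy (h.symm _ _ h1)⟩)
  have h4 := card_union_three (N w ∩ N y) (N w ∩ N z) (N w ∩ N v)
  have e : ∀ {p q}, p ∉ N q → w ∈ N p → w ∈ N q → (N w ∩ N p ∩ (N w ∩ N q)) = N p ∩ N q := by
    intro p q hpq hp hq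
    have := h.inter_subset hpq hp hq
    ext x
    have := @this x
    simp only [Finset.mem_inter] at *
    tauto
  have hyv : y ∉ N v := fun h1 => hvy (h.symm _ _ h1)
  have hzv : z ∉ N v := fun h1 => hvz (h.symm _ _ h1)
  have hsubw := h.inter_subset hyz hwy hwz
  rw [e hyz hwy hwz, e hyv hwy hwv, e hzv hwz hwv, h.inter _ _ hyz, h.inter _ _ hyv,
    h.inter _ _ hzv] at h4
  have h5 : N w ∩ N y ∪ N w ∩ N z ∪ N w ∩ N v ⊆ N w := by
    intro x hx
    simp only [Finset.mem_union, Finset.mem_inter] at hx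
    tauto
  have h5 := Finset.card_le_card h5
  rw [h.card] at h5
  have h6 : N y ∩ N z ∩ (N w ∩ N v) = N y ∩ N z ∩ N v := by
    ext x
    have := @hsubw x
    simp only [Finset.mem_inter] at *
    tauto
  rw [h6] at h4
  have h7 : tw N w ⊆ N y ∩ N z ∩ N v := by
    intro x hx
    simp only [Finset.mem_inter]
    exact ⟨⟨h.tw_subset hwy hx, h.tw_subset hwz hx⟩, h.tw_subset hwv hx⟩
  have h8 := Finset.card_le_card h7
  have h9 := h.card_tw hn w
  have h10 := h.four_le hn
  have hb := h.pos
  obtain ⟨m, rfl⟩ : ∃ m, n = m + 4 := ⟨n - 4, by omega⟩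
  simp only [show m + 4 - 1 = m + 3 by omega] at *
  have hm : m = 0 := by
    by_contra hm
    have : 1 ≤ m := by omega
    nlinarith
  subst hm
  exact ⟨rfl, (Finset.eq_of_subset_of_card_le h7 (by omega)).symm⟩

/-- Let `v` be a third neighbour of `w` as in `exists_third`. If `e ∈ N y ∩ N z` is not a twin of
`w`, then `N e ∩ N w` has size 2b. It contains the disjoint classes of `y` and `z` and, apart from
them, `N y ∩ N z` and `N e ∩ N v`, two sets of size `b` meeting inside `tw w`. That is more than 2b
vertices. -/
theorem inter_eq_tw (h : LocalData N n d b) (hn : 3 ≤ n) {w y z : W} (hyz : y ∉ N z)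
    (hwy : w ∈ N y) (hwz : w ∈ N z) : n = 4 ∧ N y ∩ N z = tw N w := by
  obtain ⟨v, hvw, hvy, hvz⟩ := h.exists_third hn hyz hwy hwz
  obtain ⟨h4, htr⟩ := h.triple hn hyz hwy hwz hvw hvy hvz
  refine ⟨h4, ?_⟩
  refine Finset.Subset.antisymm (fun e he => ?_) (fun x hx => ?_)
  swap
  · exact Finset.mem_inter.2 ⟨h.tw_subset hwy hx, h.tw_subset hwz hx⟩
  by_contra hew
  rw [mem_tw] at hew
  have hee := Finset.mem_inter.1 he
  have hew' : e ∈ N w := h.inter_subset hyz hwy hwz he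
  have hev : e ∉ N v := fun h1 => hew (mem_tw.1 (htr ▸ Finset.mem_inter.2 ⟨he, h1⟩))
  have h1 := h.two_mul_inter hn hew' hew
  have hb1 : N y ∩ N z ⊆ N e ∩ N w := Finset.subset_inter (h.inter_subset hyz hee.1 hee.2)
    (h.inter_subset hyz hwy hwz)
  have hb2 : N e ∩ N v ⊆ N e ∩ N w := Finset.subset_inter Finset.inter_subset_left
    (h.inter_subset hev (h.symm _ _ hew') (h.symm _ _ hvw))
  have hb3 : tw N y ⊆ N e ∩ N w := Finset.subset_inter
    (h.tw_subset (h.symm _ _ hee.1)) (h.tw_subset (h.symm _ _ hwy))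
  have hb4 : tw N z ⊆ N e ∩ N w := Finset.subset_inter
    (h.tw_subset (h.symm _ _ hee.2)) (h.tw_subset (h.symm _ _ hwz))
  have hyv : y ∉ N v := fun h1 => hvy (h.symm _ _ h1)
  have hzv : z ∉ N v := fun h1 => hvz (h.symm _ _ h1)
  have d1 : Disjoint (tw N y) (tw N z) := tw_disjoint fun h1 => hyz (h1 ▸ h.refl y)
  have d2 : Disjoint (tw N y ∪ tw N z) (N y ∩ N z ∪ N e ∩ N v) := by
    rw [Finset.disjoint_left]
    intro x hx hx'
    simp only [Finset.mem_union, Finset.mem_inter, mem_tw] at hx hx'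
    rcases hx with hx | hx <;> rcases hx' with hx' | hx'
    · exact hyz (h.symm _ _ (hx ▸ h.symm _ _ hx'.2))
    · exact hvy (hx ▸ h.symm _ _ hx'.2)
    · exact hyz (hx ▸ h.symm _ _ hx'.1)
    · exact hvz (hx ▸ h.symm _ _ hx'.2)
  have h2 : (tw N y ∪ tw N z) ∪ (N y ∩ N z ∪ N e ∩ N v) ⊆ N e ∩ N w :=
    Finset.union_subset (Finset.union_subset hb3 hb4) (Finset.union_subset hb1 hb2)
  have h3 := Finset.card_le_card h2
  rw [Finset.card_union_of_disjoint d2, Finset.card_union_of_disjoint d1] at h3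
  have h5 := Finset.card_union_add_card_inter (N y ∩ N z) (N e ∩ N v)
  rw [h.inter _ _ hyz, h.inter _ _ hev] at h5
  have h6 : N y ∩ N z ∩ (N e ∩ N v) ⊆ tw N w := by
    rw [← htr]
    intro x hx
    simp only [Finset.mem_inter] at *
    tauto
  have h6 := Finset.card_le_card h6
  have h7 := h.card_tw hn y
  have h8 := h.card_tw hn z
  have h9 := h.card_tw hn w
  have h10 := tw_pos (N := N) y
  subst h4
  omega

/-- Structure of the local graph when its cocliques have at least three elements. -/
theorem structure_of_three_le (h : LocalData N n d b) (hn : 3 ≤ n) :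
    n = 4 ∧ d = 4 * b ∧ (∀ v, (tw N v).card = b) ∧
      ∀ u v, u ∈ N v → N u ≠ N v → N u ∩ N v = tw N u ∪ tw N v := by
  obtain ⟨v⟩ : Nonempty W := Fintype.card_pos_iff.1 (lt_of_le_of_lt (Nat.zero_le _) h.lt)
  obtain ⟨z, hyz⟩ := h.exists_not_mem v
  have h1 : (N z ∩ N v).Nonempty := by
    rw [← Finset.card_pos, h.inter z v hyz]; exact h.pos
  obtain ⟨w, hw⟩ := h1
  rw [Finset.mem_inter] at hw
  obtain ⟨rfl, h2⟩ := h.inter_eq_tw hn hyz hw.1 hw.2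
  have h3 := h.inter z v hyz
  rw [h2] at h3
  have h4 := h.card_tw hn w
  have h5 : ∀ v, (tw N v).card = b := fun v => by
    have := h.card_tw hn v
    omega
  refine ⟨rfl, by omega, h5, fun u v huv hne => ?_⟩
  symm
  refine Finset.eq_of_subset_of_card_le (Finset.union_subset
    (Finset.subset_inter (h.tw_subset (h.refl _)) (h.tw_subset huv))
    (Finset.subset_inter (h.tw_subset (h.symm _ _ huv)) (h.tw_subset (h.refl _)))) ?_
  rw [Finset.card_union_of_disjoint (tw_disjoint hne), h5, h5]
  have := h.two_mul_inter hn huv hne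
  omega

end LocalData
end KoolenPark

/-! ### Local graphs with n = 2: clique extensions of the pentagon. -/

namespace KoolenPark
namespace LocalData

variable {W : Type*} [Fintype W] [DecidableEq W] {N : W → Finset W} {n d b : ℕ}

/-- For n = 2 every nonadjacent pair is itself a coclique of the required size, so it dominates
everything. -/
theorem no_three (h : LocalData N 2 d b) {p q : W} (hpq : p ∉ N q) (v : W) :
    v ∈ N p ∨ v ∈ N q := by
  have hS : Coc N 2 {p, q} := by
    have hne : p ≠ q := fun h1 => hpq (h1 ▸ h.refl _)
    refine ⟨Finset.card_pair hne, ?_⟩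
    intro s hs t ht hst
    simp only [Finset.mem_insert, Finset.mem_singleton] at hs ht
    rcases hs with rfl | rfl <;> rcases ht with rfl | rfl
    · exact absurd rfl hst
    · exact hpq
    · rwa [h.comm]
    · exact absurd rfl hst
  obtain ⟨s, hs, hv⟩ := h.dominated hS v
  simp only [Finset.mem_insert, Finset.mem_singleton] at hs
  rcases hs with rfl | rfl <;> tauto

/-- Take a common neighbour `w` of a nonadjacent pair and `u` not adjacent to `w`. Common neighbours
of the pair form a clique, so `u` is dominated only once and `exists_pent` applies. -/
theorem exists_pent_two (h : LocalData N 2 d b) : ∃ p q r s t, Pent N 2 ∅ p q r s t := by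
  obtain ⟨v⟩ : Nonempty W := Fintype.card_pos_iff.1 (lt_of_le_of_lt (Nat.zero_le _) h.lt)
  obtain ⟨z, hyz⟩ := h.exists_not_mem v
  have h1 : (N z ∩ N v).Nonempty := by
    rw [← Finset.card_pos, h.inter z v hyz]; exact h.pos
  obtain ⟨w, hw⟩ := h1
  rw [Finset.mem_inter] at hw
  obtain ⟨S, hS1, hS2, hz, hv⟩ := h.ext z v hyz
  have hS : Coc N 2 S := ⟨hS1, hS2⟩
  have hne : z ≠ v := fun h1 => hyz (h1 ▸ h.refl _)
  obtain ⟨u, hu⟩ := h.exists_not_mem w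
  rcases h.cover S hS1 hS2 u with h1 | h1
  · obtain ⟨t, ht, hut⟩ := h.dominated hS u
    have hup := h.mem_priv_of_card ht hut h1
    obtain ⟨r, hr, hrt⟩ : ∃ r ∈ S, r ≠ t := by
      by_cases h3 : t = z
      · exact ⟨v, hv, fun h4 => hne (h3.symm.trans h4.symm)⟩
      · exact ⟨z, hz, fun h4 => h3 h4.symm⟩
    have hwS : ∀ s ∈ S, w ∈ N s := by
      have h5 : ({z, v} : Finset W) = S := Finset.eq_of_subset_of_card_le
        (by intro x hx
            simp only [Finset.mem_insert, Finset.mem_singleton] at hx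
            rcases hx with rfl | rfl <;> assumption)
        (by rw [hS1, Finset.card_pair hne])
      intro s hs
      rw [← h5] at hs
      simp only [Finset.mem_insert, Finset.mem_singleton] at hs
      rcases hs with rfl | rfl
      exacts [hw.1, hw.2]
    obtain ⟨R, q, hP⟩ := h.exists_pent hS ht hr hrt.symm (hwS t ht) (hwS r hr) hup hu
    have := hP.empty h
    subst this
    exact ⟨_, _, _, _, _, hP⟩
  · exfalso
    obtain ⟨s, hs, t, ht, hst, h3, h4⟩ := h.exists_two h1
    have h5 : ({s, t} : Finset W) = S := Finset.eq_of_subset_of_card_le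
      (by intro x hx
          simp only [Finset.mem_insert, Finset.mem_singleton] at hx
          rcases hx with rfl | rfl <;> assumption)
      (by rw [hS1, Finset.card_pair hst])
    have h6 : u ∈ N z ∧ u ∈ N v := by
      rw [← h5] at hz hv
      simp only [Finset.mem_insert, Finset.mem_singleton] at hz hv
      rcases hz with rfl | rfl <;> rcases hv with rfl | rfl <;> tauto
    exact hu (h.clique z v u w hyz h6.1 h6.2 hw.1 hw.2)

/-- `v` plays the same role as `p` with respect to the pentagon. -/
theorem Pent.one_class (h : LocalData N 2 d b) {p q r s t : W} (hP : Pent N 2 ∅ p q r s t)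
    {v : W} (hr : v ∉ N r) (hs : v ∉ N s) : v ∈ N p ∧ v ∈ N q ∧ v ∈ N t := by
  have h1 := (h.no_three hP.pr v).resolve_right hr
  have h2 := (h.no_three hP.rt v).resolve_left hr
  have h3 := (h.no_three hP.qs v).resolve_right hs
  exact ⟨h1, h3, h2⟩

/-- A vertex cannot miss `p` and see both `q` and `t`, since common neighbours of a nonadjacent pair
form a clique. With `no_three` this leaves vertices that miss exactly an edge of the pentagon, or
see all of it. -/
theorem Pent.classes (h : LocalData N 2 d b) {p q r s t : W} (hP : Pent N 2 ∅ p q r s t) (v : W) :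
    (v ∉ N r ∧ v ∉ N s) ∨ (v ∉ N s ∧ v ∉ N t) ∨ (v ∉ N t ∧ v ∉ N p) ∨ (v ∉ N p ∧ v ∉ N q) ∨
      (v ∉ N q ∧ v ∉ N r) := by
  have one : ∀ {p q r s t : W}, Pent N 2 ∅ p q r s t → v ∉ N p → v ∈ N q → v ∈ N t → False :=
    fun hP h1 h2 h3 => hP.tq (h.clique v _ _ _ h1 (h.symm _ _ h3) hP.tp (h.symm _ _ h2)
      (h.symm _ _ hP.pq))
  have o1 := one hP
  have o2 := one hP.rotate
  have o3 := one hP.rotate.rotate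
  have o4 := one hP.rotate.rotate.rotate
  have o5 := one hP.rotate.rotate.rotate.rotate
  have c1 := h.no_three hP.pr
  have c2 := h.no_three hP.qs
  have c3 := h.no_three hP.rt
  have c4 := h.no_three hP.sp
  have c5 := h.no_three hP.tq
  obtain ⟨u, hu⟩ := h.exists_not_mem v
  have d : ∀ {x y : W}, x ∉ N y → v ∈ N x → v ∈ N y → u ∈ N x → u ∈ N y → False :=
    fun hxy h1 h2 h3 h4 => hxy (h.clique u v _ _ hu (h.symm _ _ h3) (h.symm _ _ h1)
      (h.symm _ _ h4) (h.symm _ _ h2))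
  have d1 := d hP.pr
  have d2 := d hP.qs
  have d3 := d hP.rt
  have d4 := d hP.sp
  have d5 := d hP.tq
  have e1 := c1 u
  have e2 := c2 u
  have e3 := c3 u
  have e4 := c4 u
  have e5 := c5 u
  specialize c1 v
  specialize c2 v
  specialize c3 v
  specialize c4 v
  specialize c5 v
  clear one d hu hP
  -- If `v` sees the whole pentagon, a vertex `u` not adjacent to `v` sees exactly one vertex of
  -- each nonadjacent pair. This is impossible, as the five nonadjacent pairs form an odd cycle.
  by_cases v ∈ N p <;> by_cases v ∈ N q <;> by_cases v ∈ N r <;> by_cases v ∈ N s <;>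
    by_cases v ∈ N t <;> simp_all
  by_cases u ∈ N p <;> simp_all

theorem Pent.eq_of_class (h : LocalData N 2 d b) {p q r s t : W} (hP : Pent N 2 ∅ p q r s t)
    {v : W} (hr : v ∉ N r) (hs : v ∉ N s) : N v = N p := by
  have hv := Pent.one_class h hP hr hs
  ext u
  rcases Pent.classes h hP u with h1 | h1 | h1 | h1 | h1
  · exact iff_of_true (h.symm _ _ ((h.no_three h1.1 v).resolve_right hr))
      (Pent.one_class h hP h1.1 h1.2).1
  · exact iff_of_true (h.symm _ _ ((h.no_three h1.1 v).resolve_right hs))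
      (Pent.one_class h hP.rotate h1.1 h1.2).2.2
  · refine iff_of_false (fun h2 => h1.1 ?_) h1.2
    exact h.clique v s u t hs h2 (Pent.one_class h hP.rotate.rotate h1.1 h1.2).2.1
      (h.symm _ _ hv.2.2) (h.symm _ _ hP.st)
  · refine iff_of_false (fun h2 => h1.2 ?_) h1.1
    exact h.clique v r u q hr h2 (Pent.one_class h hP.rotate.rotate.rotate h1.1 h1.2).2.2
      (h.symm _ _ hv.2.1) hP.qr
  · exact iff_of_true (h.symm _ _ ((h.no_three h1.2 v).resolve_right hr))
      (Pent.one_class h hP.rotate.rotate.rotate.rotate h1.1 h1.2).2.1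

theorem Pent.replace (h : LocalData N 2 d b) {p q r s t : W} (hP : Pent N 2 ∅ p q r s t)
    {v : W} (hv : N v = N p) : Pent N 2 ∅ v q r s t where
  pq := by rw [h.comm, hv]; exact h.symm _ _ hP.pq
  qr := hP.qr
  rs := hP.rs
  st := hP.st
  tp := hv ▸ hP.tp
  pr := by rw [h.comm, hv]; exact fun h1 => hP.pr (h.symm _ _ h1)
  qs := hP.qs
  rt := hP.rt
  sp := hv ▸ hP.sp
  tq := hP.tq
  coc := hP.coc
  hp := by simp
  hq := by simp
  hr := by simp
  hs := by simp
  ht := by simp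

theorem exists_pent_at (h : LocalData N 2 d b) (v : W) : ∃ q r s t, Pent N 2 ∅ v q r s t := by
  obtain ⟨p, q, r, s, t, hP⟩ := h.exists_pent_two
  rcases Pent.classes h hP v with h1 | h1 | h1 | h1 | h1
  · exact ⟨_, _, _, _, hP.replace h (hP.eq_of_class h h1.1 h1.2)⟩
  · exact ⟨_, _, _, _, Pent.replace h hP.rotate (Pent.eq_of_class h hP.rotate h1.1 h1.2)⟩
  · exact ⟨_, _, _, _, Pent.replace h hP.rotate.rotate
      (Pent.eq_of_class h hP.rotate.rotate h1.1 h1.2)⟩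
  · exact ⟨_, _, _, _, Pent.replace h hP.rotate.rotate.rotate
      (Pent.eq_of_class h hP.rotate.rotate.rotate h1.1 h1.2)⟩
  · exact ⟨_, _, _, _, Pent.replace h hP.rotate.rotate.rotate.rotate
      (Pent.eq_of_class h hP.rotate.rotate.rotate.rotate h1.1 h1.2)⟩

theorem Pent.mem_iff (h : LocalData N 2 d b) {p q r s t : W} (hP : Pent N 2 ∅ p q r s t) (u : W) :
    u ∈ N p ↔ N u = N p ∨ N u = N q ∨ N u = N t := by
  constructor
  · intro hu
    rcases Pent.classes h hP u with h1 | h1 | h1 | h1 | h1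
    · exact Or.inl (hP.eq_of_class h h1.1 h1.2)
    · exact Or.inr (Or.inl (Pent.eq_of_class h hP.rotate h1.1 h1.2))
    · exact absurd hu h1.2
    · exact absurd hu h1.1
    · exact Or.inr (Or.inr (Pent.eq_of_class h hP.rotate.rotate.rotate.rotate h1.1 h1.2))
  · rintro (h1 | h1 | h1) <;> rw [h.comm, h1]
    exacts [h.refl _, hP.pq, h.symm _ _ hP.tp]

theorem Pent.inter_eq_tw (h : LocalData N 2 d b) {p q r s t : W} (hP : Pent N 2 ∅ p q r s t) :
    N q ∩ N t = tw N p := by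
  ext u
  rw [Finset.mem_inter, mem_tw, Pent.mem_iff h hP.rotate,
    Pent.mem_iff h hP.rotate.rotate.rotate.rotate]
  have h1 : N q ≠ N t := fun h1 => hP.tq (h1 ▸ h.refl _)
  have h2 : N r ≠ N t := fun h1 => hP.rt (h1 ▸ h.refl _)
  have h3 : N q ≠ N s := fun h1 => hP.qs (h1 ▸ h.refl _)
  have h4 : N r ≠ N s := fun h1 => by
    have h5 := hP.qr
    rw [h1] at h5
    exact hP.qs h5
  constructor
  · rintro ⟨h5 | h5 | h5, h6 | h6 | h6⟩ <;> simp_all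
  · intro h5
    exact ⟨Or.inr (Or.inr h5), Or.inr (Or.inl h5)⟩

/-- Each closed neighbourhood consists of three twin classes, those of a vertex and of its two
neighbours on a pentagon, and each class is the set of common neighbours of a nonadjacent pair. -/
theorem structure_of_two (h : LocalData N 2 d b) :
    d = 3 * b ∧ (∀ v, (tw N v).card = b) ∧
      ∀ u v, u ∈ N v → N u ≠ N v → N u ∩ N v = tw N u ∪ tw N v := by
  have htw : ∀ v, (tw N v).card = b := by
    intro v
    obtain ⟨q, r, s, t, hP⟩ := h.exists_pent_at v
    rw [← hP.inter_eq_tw h, h.inter _ _ fun h1 => hP.tq (h.symm _ _ h1)]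
  have hne : ∀ {p q r s t : W}, Pent N 2 ∅ p q r s t → N p ≠ N q ∧ N p ≠ N r := by
    intro p q r s t hP
    refine ⟨fun h1 => hP.tq (h1 ▸ hP.tp), fun h1 => hP.pr (h1 ▸ h.refl _)⟩
  refine ⟨?_, htw, fun u v huv hne' => ?_⟩
  · obtain ⟨v⟩ : Nonempty W := Fintype.card_pos_iff.1 (lt_of_le_of_lt (Nat.zero_le _) h.lt)
    obtain ⟨q, r, s, t, hP⟩ := h.exists_pent_at v
    have h1 : N v = tw N v ∪ (tw N q ∪ tw N t) := by
      ext u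
      rw [hP.mem_iff h, Finset.mem_union, Finset.mem_union, mem_tw, mem_tw, mem_tw]
    have n1 := (hne hP).1
    have n2 := (hne hP.rotate.rotate.rotate.rotate).1
    have n3 := (hne hP.rotate.rotate.rotate.rotate).2
    rw [← h.card v, h1, Finset.card_union_of_disjoint, Finset.card_union_of_disjoint
      (tw_disjoint n3.symm), htw, htw, htw]
    · ring
    · exact Finset.disjoint_union_right.2 ⟨tw_disjoint n1, tw_disjoint n2.symm⟩
  · have main : ∀ {p q r s t : W}, Pent N 2 ∅ p q r s t → N p ∩ N q = tw N p ∪ tw N q := by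
      intro p q r s t hP
      ext u
      rw [Finset.mem_inter, Finset.mem_union, mem_tw, mem_tw, hP.mem_iff h,
        Pent.mem_iff h hP.rotate]
      have n1 := (hne hP.rotate).2
      have n2 := (hne hP.rotate.rotate).2
      have n3 := (hne hP.rotate.rotate.rotate.rotate).2
      constructor
      · rintro ⟨h5 | h5 | h5, h6 | h6 | h6⟩ <;> simp_all
      · rintro (h5 | h5) <;> simp [h5]
    obtain ⟨q, r, s, t, hP⟩ := h.exists_pent_at v
    rcases (hP.mem_iff h u).1 huv with h1 | h1 | h1
    · exact absurd h1 hne'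
    · rw [Finset.inter_comm, Finset.union_comm, tw, tw, h1]
      exact main hP
    · rw [tw, tw, h1]
      exact main hP.rotate.rotate.rotate.rotate

/-- The local graph is a clique extension of a pentagon or of a Moore graph of valency 3. -/
theorem structure_all (h : LocalData N n d b) :
    ((n = 2 ∧ d = 3 * b) ∨ (n = 4 ∧ d = 4 * b)) ∧ (∀ v, (tw N v).card = b) ∧
      ∀ u v, u ∈ N v → N u ≠ N v → N u ∩ N v = tw N u ∪ tw N v := by
  rcases h.two_le.eq_or_lt with h2 | h2
  · subst h2
    exact ⟨Or.inl ⟨rfl, h.structure_of_two.1⟩, h.structure_of_two.2⟩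
  · obtain ⟨h3, h4, h5⟩ := h.structure_of_three_le h2
    exact ⟨Or.inr ⟨h3, h4⟩, h5⟩

end LocalData
end KoolenPark

/-! ### Equality in the bound and its local consequences. -/

namespace KoolenPark

/-- Equality in the Bonferroni inequality for the closed neighbourhoods of a coclique. -/
theorem bonferroni_tight {W : Type*} [Fintype W] [DecidableEq W] {N : W → Finset W}
    (symm : ∀ u v, u ∈ N v → v ∈ N u) {d b : ℕ} (card : ∀ v, (N v).card = d) (S : Finset W)
    (hb : ∀ s ∈ S, ∀ t ∈ S, s ≠ t → (N s ∩ N t).card ≤ b)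
    (h : 2 * (Fintype.card W : ℤ) + S.card * (S.card - 1) * b = 2 * S.card * d) :
    (∀ v, (N v ∩ S).card = 1 ∨ (N v ∩ S).card = 2) ∧
      ∀ s ∈ S, ∀ t ∈ S, s ≠ t → (N s ∩ N t).card = b := by
  have comm : ∀ u v, u ∈ N v ↔ v ∈ N u := fun u v => ⟨symm u v, symm v u⟩
  have e1 : ∀ v, ((N v ∩ S).card : ℤ) = ∑ s ∈ S, if v ∈ N s then 1 else 0 := by
    intro v
    rw [← Finset.sum_filter, Finset.sum_const, nsmul_one, Nat.cast_inj]
    congr 1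
    ext s
    rw [Finset.mem_inter, Finset.mem_filter, comm]
    tauto
  have e2 : ∑ v, ((N v ∩ S).card : ℤ) = S.card * d := by
    simp_rw [e1]
    rw [Finset.sum_comm]
    simp [card]
  have e3 : ∑ v, ((N v ∩ S).card : ℤ) ^ 2 = ∑ s ∈ S, ∑ t ∈ S, ((N s ∩ N t).card : ℤ) := by
    simp_rw [e1, sq, Finset.sum_mul_sum]
    rw [Finset.sum_comm]
    refine Finset.sum_congr rfl fun s _ => ?_
    rw [Finset.sum_comm]
    refine Finset.sum_congr rfl fun t _ => ?_
    have : (N s ∩ N t) = Finset.univ.filter fun v => v ∈ N s ∧ v ∈ N t := by ext; simp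
    rw [this, Finset.card_filter]
    push_cast
    refine Finset.sum_congr rfl fun v _ => ?_
    by_cases h1 : v ∈ N s <;> by_cases h2 : v ∈ N t <;> simp [h1, h2]
  have e4 : ∑ s ∈ S, ∑ t ∈ S, ((N s ∩ N t).card : ℤ) =
      S.card * d + ∑ s ∈ S, ∑ t ∈ S.erase s, ((N s ∩ N t).card : ℤ) := by
    have : ∀ s ∈ S, ∑ t ∈ S, ((N s ∩ N t).card : ℤ) =
        d + ∑ t ∈ S.erase s, ((N s ∩ N t).card : ℤ) := by
      intro s hs
      rw [← Finset.add_sum_erase _ _ hs, Finset.inter_self, card]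
    rw [Finset.sum_congr rfl this, Finset.sum_add_distrib]
    simp
  have e5 : ∑ s ∈ S, ∑ t ∈ S.erase s, ((b : ℤ)) = S.card * (S.card - 1) * b := by
    have : ∀ s ∈ S, ∑ t ∈ S.erase s, ((b : ℤ)) = (S.card - 1) * b := by
      intro s hs
      rw [Finset.sum_const, Finset.card_erase_of_mem hs, nsmul_eq_mul,
        Nat.cast_sub (Finset.card_pos.2 ⟨s, hs⟩), Nat.cast_one]
    rw [Finset.sum_congr rfl this, Finset.sum_const, nsmul_eq_mul]
    ring
  -- The hypothesis `h` says exactly that these two sums, both with nonnegative terms, add up to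
  -- zero. So every term vanishes.
  have e6 : ∑ v, (((N v ∩ S).card : ℤ) - 1) * (((N v ∩ S).card : ℤ) - 2) +
      ∑ s ∈ S, ∑ t ∈ S.erase s, ((b : ℤ) - (N s ∩ N t).card) = 0 := by
    simp_rw [Finset.sum_sub_distrib]
    rw [e5]
    have : ∀ v, (((N v ∩ S).card : ℤ) - 1) * (((N v ∩ S).card : ℤ) - 2) =
        ((N v ∩ S).card : ℤ) ^ 2 - 3 * ((N v ∩ S).card : ℤ) + 2 := fun v => by ring
    simp_rw [this]
    rw [Finset.sum_add_distrib, Finset.sum_sub_distrib, ← Finset.mul_sum, e2, e3, e4]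
    simp only [Finset.sum_const, Finset.card_univ, nsmul_eq_mul]
    linarith
  have p1 : ∀ v ∈ Finset.univ, 0 ≤ (((N v ∩ S).card : ℤ) - 1) * (((N v ∩ S).card : ℤ) - 2) := by
    intro v _
    generalize (N v ∩ S).card = m
    rcases le_or_gt (m : ℤ) 1 with h1 | h1
    · exact mul_nonneg_of_nonpos_of_nonpos (by omega) (by omega)
    · exact mul_nonneg (by omega) (by omega)
  have p3 : ∀ s ∈ S, ∀ t ∈ S.erase s, 0 ≤ ((b : ℤ) - (N s ∩ N t).card) := by
    intro s hs t ht
    rw [Finset.mem_erase] at ht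
    have := hb s hs t ht.2 ht.1.symm
    omega
  have p2 : ∀ s ∈ S, 0 ≤ ∑ t ∈ S.erase s, ((b : ℤ) - (N s ∩ N t).card) :=
    fun s hs => Finset.sum_nonneg (p3 s hs)
  have q1 := Finset.sum_nonneg p1
  have q2 := Finset.sum_nonneg p2
  have r1 := (Finset.sum_eq_zero_iff_of_nonneg p1).1 (by linarith)
  have r2 := (Finset.sum_eq_zero_iff_of_nonneg p2).1 (by linarith)
  refine ⟨fun v => ?_, fun s hs t ht hst => ?_⟩
  · have := r1 v (Finset.mem_univ _)
    rw [mul_eq_zero] at this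
    omega
  · have := (Finset.sum_eq_zero_iff_of_nonneg (p3 s hs)).1 (r2 s hs) t
      (Finset.mem_erase.2 ⟨hst.symm, ht⟩)
    omega

variable {V : Type*} [Fintype V] [DecidableEq V] {G : SimpleGraph V} [DecidableRel G.Adj]

/-- The closed neighbourhoods of the local graph of `x`. -/
def locNbhd (G : SimpleGraph V) [DecidableRel G.Adj] (x : V) (y : {y // G.Adj x y}) :
    Finset {y // G.Adj x y} :=
  Finset.univ.filter fun z => z = y ∨ G.Adj y.1 z.1

/-- Common neighbours. -/
def cn (G : SimpleGraph V) [DecidableRel G.Adj] (x y : V) : Finset V :=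
  Finset.univ.filter fun z => G.Adj x z ∧ G.Adj y z

theorem mem_cn {x y z : V} : z ∈ cn G x y ↔ G.Adj x z ∧ G.Adj y z := by simp [cn]

theorem mem_locNbhd {x : V} {y z : {y // G.Adj x y}} :
    z ∈ locNbhd G x y ↔ z = y ∨ G.Adj y.1 z.1 := by simp [locNbhd]

theorem card_cn (x y : V) : (cn G x y).card = Fintype.card (G.commonNeighbors x y) := by
  rw [Fintype.card_of_subtype]
  intro z
  rw [mem_cn, SimpleGraph.mem_commonNeighbors]

theorem card_locNbhd {x : V} (y : {y // G.Adj x y}) :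
    (locNbhd G x y).card = (cn G x y.1).card + 1 := by
  have h1 : locNbhd G x y = insert y (Finset.univ.filter fun z => G.Adj y.1 z.1) := by
    ext z; simp [locNbhd]
  rw [h1, Finset.card_insert_of_notMem (by simp)]
  congr 1
  rw [← Finset.card_map (Function.Embedding.subtype _)]
  congr 1
  ext z
  simp [mem_cn, and_comm]

theorem dist_eq_two {x y z : V} (hy : G.Adj x y) (hz : G.Adj x z) (hyz : y ≠ z)
    (h : ¬ G.Adj y z) : G.dist y z = 2 := by
  have h1 : G.dist y z ≤ 2 := G.dist_le (.cons hy.symm (.cons hz .nil))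
  have h2 : G.Reachable y z := ⟨.cons hy.symm (.cons hz .nil)⟩
  have h3 : G.dist y z ≠ 0 := fun h3 => hyz (h2.dist_eq_zero_iff.1 h3)
  have h4 : G.dist y z ≠ 1 := fun h4 => h (SimpleGraph.dist_eq_one_iff_adj.1 h4)
  omega

theorem card_inter_locNbhd {x : V} {y z : {y // G.Adj x y}} (hyz : y ∉ locNbhd G x z) :
    (locNbhd G x y ∩ locNbhd G x z).card = ((cn G y.1 z.1).filter fun t => G.Adj x t).card := by
  rw [mem_locNbhd] at hyz
  push Not at hyz
  rw [← Finset.card_map (Function.Embedding.subtype _)]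
  congr 1
  ext t
  simp only [Finset.mem_map, Finset.mem_inter, mem_locNbhd, Function.Embedding.subtype_apply,
    Finset.mem_filter, mem_cn]
  constructor
  · rintro ⟨s, ⟨h1, h2⟩, rfl⟩
    rcases h1 with rfl | h1 <;> rcases h2 with rfl | h2
    · exact absurd rfl hyz.1
    · exact absurd h2 hyz.2
    · exact absurd h1.symm hyz.2
    · exact ⟨⟨h1, h2⟩, s.2⟩
  · rintro ⟨⟨h1, h2⟩, h3⟩
    exact ⟨⟨t, h3⟩, ⟨Or.inr h1, Or.inr h2⟩, rfl⟩

/-- The maximum is attained at some n ≤ c, and a coclique of size c through `y` and `z` can be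
shrunk to one of size n through `y` and `z`. -/
theorem AttainsMuBound.exists_coc {k lam mu : ℚ} (h : AttainsMuBound G k lam mu) :
    ∃ n, 2 ≤ n ∧ HasLocalCocliques G n ∧ 2 * k + n * (n - 1) * (mu - 1) = 2 * n * (lam + 1) ∧
      ∃ x y z, G.Adj x y ∧ G.Adj x z ∧ y ≠ z ∧ ¬ G.Adj y z := by
  obtain ⟨c, ⟨hc, hmax⟩, ⟨n, hn, hnc, heq⟩, -⟩ := h
  refine ⟨n, hn, ?_, ?_, ?_⟩
  · intro x y z hy hz hyz hna
    obtain ⟨S, hS, hSx, hyS, hzS⟩ := hc.2 x y z hy hz hyz hna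
    obtain ⟨T, h1, h2, h3⟩ := Finset.exists_subsuperset_card_eq (s := {y, z}) (t := S) (n := n)
      (by intro t ht; simp only [Finset.mem_insert, Finset.mem_singleton] at ht
          rcases ht with rfl | rfl <;> assumption)
      (by rw [Finset.card_pair hyz]; exact hn) (by rw [hS.card_eq]; exact hnc)
    refine ⟨T, ⟨hS.isIndepSet.mono (by exact_mod_cast h2), h3⟩, fun s hs => hSx s (h2 hs),
      h1 (by simp), h1 (by simp)⟩
  · rw [Nat.cast_choose_two] at heq
    have : (n : ℚ) * (n - 1) / 2 ≠ 0 := by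
      have : (2 : ℚ) ≤ n := by exact_mod_cast hn
      have h1 : (n : ℚ) ≠ 0 := by linarith
      have h2 : (n : ℚ) - 1 ≠ 0 := by linarith
      positivity
    rw [eq_div_iff this] at heq
    linarith
  -- Without two nonadjacent neighbours of some vertex the coclique condition would hold vacuously
  -- for all sizes, and no `c` would be maximal.
  · by_contra! hcon
    have : c + 1 ≤ c := hmax ⟨by have := hc.1; omega, fun x y z hy hz hyz hna =>
      absurd (hcon x y z hy hz hyz) hna⟩
    omega

/-- Two nonadjacent neighbours of `x` have μ - 1 common neighbours besides `x`, and equality in the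
bound makes all of them neighbours of `x`. Applied at each common neighbour in turn, this makes the
set of common neighbours a clique. -/
theorem localData {v k lam mu : ℕ} (hG : IsAmplyRegular G v k lam mu) (hmu : 1 < mu)
    (h : AttainsMuBound G k lam mu) :
    ∃ n, 2 * k + n * (n - 1) * (mu - 1) = 2 * n * (lam + 1) ∧
      (∀ x, LocalData (locNbhd G x) n (lam + 1) (mu - 1)) ∧
      ∀ x y z, G.Adj x y → G.Adj x z → y ≠ z → ¬ G.Adj y z → ∀ t, G.Adj y t → G.Adj z t →
        t = x ∨ G.Adj x t := by
  obtain ⟨n, hn, hloc, heq, x₀, y₀, z₀, hy₀, hz₀, hne₀, hna₀⟩ := h.exists_coc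
  obtain ⟨m, rfl⟩ : ∃ m, n = m + 1 := ⟨n - 1, by omega⟩
  obtain ⟨b, rfl⟩ : ∃ b, mu = b + 1 := ⟨mu - 1, by omega⟩
  have heq' : 2 * k + (m + 1) * m * b = 2 * (m + 1) * (lam + 1) := by
    have : (2 * k + (m + 1) * m * b : ℚ) = 2 * (m + 1) * (lam + 1) := by
      push_cast at heq
      linarith
    exact_mod_cast this
  have hcard : ∀ x, Fintype.card {y // G.Adj x y} = k := by
    intro x
    rw [← hG.regular x, ← G.card_neighborSet_eq_degree]
    exact Fintype.card_congr (Equiv.refl _)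
  have hN : ∀ x (y : {y // G.Adj x y}), (locNbhd G x y).card = lam + 1 := by
    intro x y
    rw [card_locNbhd, card_cn, hG.of_adj x y.1 y.2]
  have hsymm : ∀ x (u w : {y // G.Adj x y}), u ∈ locNbhd G x w → w ∈ locNbhd G x u := by
    intro x u w h1
    rw [mem_locNbhd] at *
    exact h1.imp Eq.symm SimpleGraph.Adj.symm
  have hsub : ∀ x (u w : {y // G.Adj x y}),
      (cn G u.1 w.1).filter (fun t => G.Adj x t) ⊆ (cn G u.1 w.1).erase x := by
    intro x u w t ht
    rw [Finset.mem_filter] at ht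
    exact Finset.mem_erase.2 ⟨ht.2.ne', ht.1⟩
  have hmuc : ∀ x (u w : {y // G.Adj x y}), u ∉ locNbhd G x w →
      ((cn G u.1 w.1).erase x).card = b := by
    intro x u w huw
    rw [mem_locNbhd] at huw
    push Not at huw
    rw [Finset.card_erase_of_mem (mem_cn.2 ⟨u.2.symm, w.2.symm⟩), card_cn,
      hG.of_dist_two _ _ (dist_eq_two u.2 w.2 (fun h1 => huw.1 (Subtype.ext h1))
        fun h1 => huw.2 h1.symm)]
    omega
  have htight : ∀ x (S : Finset {y // G.Adj x y}), S.card = m + 1 →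
      (∀ s ∈ S, ∀ t ∈ S, s ≠ t → s ∉ locNbhd G x t) →
      (∀ v, (locNbhd G x v ∩ S).card = 1 ∨ (locNbhd G x v ∩ S).card = 2) ∧
      ∀ s ∈ S, ∀ t ∈ S, s ≠ t → (locNbhd G x s ∩ locNbhd G x t).card = b := by
    intro x S hS hS2
    refine bonferroni_tight (hsymm x) (hN x) S (fun s hs t ht hst => ?_) ?_
    · rw [card_inter_locNbhd (hS2 s hs t ht hst), ← hmuc x s t (hS2 s hs t ht hst)]
      exact Finset.card_le_card (hsub x s t)
    · rw [hcard, hS]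
      push_cast
      have : (2 * k + (m + 1) * m * b : ℤ) = 2 * (m + 1) * (lam + 1) := by exact_mod_cast heq'
      linarith
  have hext : ∀ x (u w : {y // G.Adj x y}), u ∉ locNbhd G x w → ∃ S : Finset {y // G.Adj x y},
      S.card = m + 1 ∧ (∀ s ∈ S, ∀ t ∈ S, s ≠ t → s ∉ locNbhd G x t) ∧ u ∈ S ∧ w ∈ S := by
    intro x u w huw
    rw [mem_locNbhd] at huw
    push Not at huw
    obtain ⟨S, hS, hSx, hyS, hzS⟩ := hloc x u.1 w.1 u.2 w.2
      (fun h1 => huw.1 (Subtype.ext h1)) fun h1 => huw.2 h1.symm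
    refine ⟨S.subtype _, ?_, ?_, ?_, ?_⟩
    · rw [Finset.card_subtype, Finset.filter_true_of_mem hSx, hS.card_eq]
    · intro s hs t ht hst h1
      rw [Finset.mem_subtype] at hs ht
      rw [mem_locNbhd] at h1
      rcases h1 with h1 | h1
      · exact hst h1
      · exact hS.isIndepSet ht hs (fun h2 => hst (Subtype.ext h2.symm)) h1
    · simpa using hyS
    · simpa using hzS
  have hinter : ∀ x (u w : {y // G.Adj x y}), u ∉ locNbhd G x w →
      (locNbhd G x u ∩ locNbhd G x w).card = b := by
    intro x u w huw
    obtain ⟨S, h1, h2, h3, h4⟩ := hext x u w huw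
    refine (htight x S h1 h2).2 u h3 w h4 fun h5 => huw ?_
    rw [h5, mem_locNbhd]
    exact Or.inl rfl
  have hT : ∀ x y z, G.Adj x y → G.Adj x z → y ≠ z → ¬ G.Adj y z → ∀ t, G.Adj y t → G.Adj z t →
        t = x ∨ G.Adj x t := by
    intro x y z hy hz hyz hna t hyt hzt
    have h1 : (⟨y, hy⟩ : {y // G.Adj x y}) ∉ locNbhd G x ⟨z, hz⟩ := by
      rw [mem_locNbhd]
      rintro (h1 | h1)
      · exact hyz (congrArg Subtype.val h1)
      · exact hna h1.symm
    have h2 := hinter x _ _ h1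
    rw [card_inter_locNbhd h1] at h2
    have h3 := Finset.eq_of_subset_of_card_le (hsub x ⟨y, hy⟩ ⟨z, hz⟩) (by rw [hmuc x _ _ h1, h2])
    by_cases htx : t = x
    · exact Or.inl htx
    · right
      have h4 : t ∈ (cn G y z).erase x := Finset.mem_erase.2 ⟨htx, mem_cn.2 ⟨hyt, hzt⟩⟩
      rw [← h3, Finset.mem_filter] at h4
      exact h4.2
  refine ⟨m + 1, by simpa using heq', fun x => ?_, hT⟩
  refine ⟨fun v => by simp [mem_locNbhd], hsymm x, hN x, hinter x, ?_,
    fun S h1 h2 => (htight x S h1 h2).1, hext x, by omega, ?_, hn⟩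
  · intro u w s t huw hsu hsw htu htw
    rw [mem_locNbhd] at *
    push Not at huw
    have hs : G.Adj u.1 s.1 ∧ G.Adj w.1 s.1 := by
      rcases hsu with rfl | hsu <;> rcases hsw with rfl | hsw
      · exact absurd rfl huw.1
      · exact absurd hsw huw.2
      · exact absurd hsu.symm huw.2
      · exact ⟨hsu, hsw⟩
    have ht : G.Adj u.1 t.1 ∧ G.Adj w.1 t.1 := by
      rcases htu with rfl | hsu <;> rcases htw with rfl | hsw
      · exact absurd rfl huw.1
      · exact absurd hsw huw.2
      · exact absurd hsu.symm huw.2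
      · exact ⟨hsu, hsw⟩
    rcases hT t.1 u.1 w.1 ht.1.symm ht.2.symm (fun h1 => huw.1 (Subtype.ext h1))
      (fun h1 => huw.2 h1.symm) s.1 hs.1 hs.2 with h1 | h1
    · exact Or.inl (Subtype.ext h1)
    · exact Or.inr h1
  · rw [hcard, ← hcard x₀, ← hN x₀ ⟨y₀, hy₀⟩]
    refine Finset.card_lt_univ_of_notMem (x := ⟨z₀, hz₀⟩) fun h2 => ?_
    rw [mem_locNbhd] at h2
    rcases h2 with h2 | h2
    · exact hne₀ (congrArg Subtype.val h2).symm
    · exact hna₀ h2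

end KoolenPark

/-! ### Excluding twins: μ = 2. -/

namespace KoolenPark

variable {V : Type*} [Fintype V] [DecidableEq V] {G : SimpleGraph V} [DecidableRel G.Adj]

/-- A connected regular graph without 4-cliques in which two nonadjacent vertices with a common
neighbour have exactly two common neighbours, and these are adjacent. -/
structure LocallyMoore (G : SimpleGraph V) [DecidableRel G.Adj] (k lam : ℕ) : Prop where
  conn : G.Connected
  reg : ∀ x, (Finset.univ.filter fun y => G.Adj x y).card = k
  lam : ∀ x y, G.Adj x y → (cn G x y).card = lam
  noK4 : ∀ a b c d, G.Adj a b → G.Adj a c → G.Adj a d → G.Adj b c → G.Adj b d → G.Adj c d → False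
  adj_of : ∀ y z a b, y ≠ z → ¬ G.Adj y z → G.Adj a y → G.Adj a z → G.Adj b y → G.Adj b z →
    a = b ∨ G.Adj a b
  exists_of : ∀ x y z, G.Adj x y → G.Adj x z → y ≠ z → ¬ G.Adj y z →
    ∃ w, G.Adj x w ∧ G.Adj w y ∧ G.Adj w z

/-- `y` and `y'` are twins in the local graph of `x`. -/
def Twins (G : SimpleGraph V) (x y y' : V) : Prop :=
  ∀ t, G.Adj x t → ((t = y ∨ G.Adj y t) ↔ (t = y' ∨ G.Adj y' t))

theorem twins_iff {x : V} {y y' : {y // G.Adj x y}} :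
    Twins G x y.1 y'.1 ↔ locNbhd G x y = locNbhd G x y' := by
  constructor
  · intro h
    ext t
    rw [mem_locNbhd, mem_locNbhd, Subtype.ext_iff, Subtype.ext_iff]
    exact h t.1 t.2
  · intro h t ht
    have := congrArg (fun A => (⟨t, ht⟩ : {y // G.Adj x y}) ∈ A) h
    simp only [mem_locNbhd, Subtype.ext_iff, eq_iff_iff] at this
    exact this

/-- All common neighbours of twins in the local graph of `x` lie in the closed neighbourhood
of `x`. -/
theorem Twins.adj {lam : ℕ} (hlam : ∀ x y, G.Adj x y → (cn G x y).card = lam) {x y y' : V}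
    (h : Twins G x y y') (hy : G.Adj x y) (hy' : G.Adj x y') (hne : y ≠ y') {t : V}
    (h1 : G.Adj y t) (h2 : G.Adj y' t) : t = x ∨ G.Adj x t := by
  have hyy : G.Adj y y' := by
    rcases (h y' hy').2 (Or.inl rfl) with h3 | h3
    · exact absurd h3.symm hne
    · exact h3
  -- Both sides have λ elements, so this exhausts the common neighbours of `y` and `y'`.
  have hsub : insert x ((cn G x y).erase y') ⊆ cn G y y' := by
    intro s hs
    rw [Finset.mem_insert, Finset.mem_erase, mem_cn] at hs
    rw [mem_cn]
    rcases hs with rfl | ⟨h3, h4, h5⟩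
    · exact ⟨hy.symm, hy'.symm⟩
    · exact ⟨h5, ((h s h4).1 (Or.inr h5)).resolve_left h3⟩
  have hy'm : y' ∈ cn G x y := mem_cn.2 ⟨hy', hyy⟩
  have heq := Finset.eq_of_subset_of_card_le hsub (by
    rw [hlam _ _ hyy, Finset.card_insert_of_notMem (by simp [mem_cn]),
      Finset.card_erase_of_mem hy'm, hlam _ _ hy]
    omega)
  have : t ∈ cn G y y' := mem_cn.2 ⟨h1, h2⟩
  rw [← heq, Finset.mem_insert, Finset.mem_erase, mem_cn] at this
  tauto

/-- If b > 1, take `y`, `z` nonadjacent in the local graph of `x`, a common neighbour `u` of them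
there, and a twin `y'` of `y` in the local graph of `u`. Then `y'` is a neighbour of `x`, and it is
a twin of `u` or of `y` there. In the first case `z` becomes adjacent to `y`. In the second, a
neighbour `t` of `x` and `y` not adjacent to `u` is also adjacent to `y'`, against `Twins.adj`. For
b = 1 the equation for k gives k = 5 or k = 10. -/
theorem locallyMoore {v k lam mu : ℕ} (hc : G.Connected) (hG : IsAmplyRegular G v k lam mu)
    (hmu : 1 < mu) (h : AttainsMuBound G k lam mu) :
    mu = 2 ∧ (LocallyMoore G 5 2 ∨ LocallyMoore G 10 3) := by
  obtain ⟨n, heq, hloc, hT⟩ := localData hG hmu h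
  have hstr := fun x => (hloc x).structure_all
  have hlam : ∀ x y, G.Adj x y → (cn G x y).card = lam := fun x y hxy => by
    rw [card_cn, hG.of_adj x y hxy]
  obtain ⟨b, rfl⟩ : ∃ b, mu = b + 1 := ⟨mu - 1, by omega⟩
  simp only [Nat.add_sub_cancel] at *
  have hEx : ∀ x y z, G.Adj x y → G.Adj x z → y ≠ z → ¬ G.Adj y z →
      ∃ w, G.Adj x w ∧ G.Adj w y ∧ G.Adj w z := by
    intro x y z hy hz hyz hna
    have h1 : (⟨y, hy⟩ : {y // G.Adj x y}) ∉ locNbhd G x ⟨z, hz⟩ := by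
      rw [mem_locNbhd]
      rintro (h1 | h1)
      · exact hyz (congrArg Subtype.val h1)
      · exact hna h1.symm
    have h2 := (hloc x).inter _ _ h1
    have h3 : (locNbhd G x ⟨y, hy⟩ ∩ locNbhd G x ⟨z, hz⟩).Nonempty := by
      rw [← Finset.card_pos, h2]; exact (hloc x).pos
    obtain ⟨w, hw⟩ := h3
    simp only [Finset.mem_inter, mem_locNbhd, Subtype.ext_iff] at hw
    obtain ⟨h3 | h3, h4 | h4⟩ := hw
    · exact absurd (h3.symm.trans h4) hyz
    · exact absurd (h3 ▸ h4).symm hna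
    · exact absurd (h4 ▸ h3) hna
    · exact ⟨w.1, w.2, h3.symm, h4.symm⟩
  have hnb : ∀ x, ∃ y, G.Adj x y := by
    intro x
    obtain ⟨y⟩ : Nonempty {y // G.Adj x y} :=
      Fintype.card_pos_iff.1 (lt_of_le_of_lt (Nat.zero_le _) (hloc x).lt)
    exact ⟨y.1, y.2⟩
  have hnon : ∀ x y, G.Adj x y → ∃ z, G.Adj x z ∧ y ≠ z ∧ ¬ G.Adj y z := by
    intro x y hy
    obtain ⟨z, hz⟩ := (hloc x).exists_not_mem ⟨y, hy⟩
    simp only [mem_locNbhd, Subtype.ext_iff] at hz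
    exact ⟨z.1, z.2, by tauto, by tauto⟩
  have hb : b = 1 := by
    by_contra hb1
    have htw : ∀ x y, G.Adj x y → ∃ y', y' ≠ y ∧ G.Adj x y' ∧ Twins G x y y' := by
      intro x y hy
      have h1 := (hstr x).2.1 ⟨y, hy⟩
      have h2 := (hloc x).pos
      obtain ⟨y', hy', hne⟩ := Finset.exists_mem_ne
        (s := LocalData.tw (locNbhd G x) ⟨y, hy⟩) (by omega) ⟨y, hy⟩
      exact ⟨y'.1, fun h3 => hne (Subtype.ext h3), y'.2,
        (twins_iff (y := ⟨y, hy⟩)).2 (LocalData.mem_tw.1 hy').symm⟩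
    have hin : ∀ x u y t, G.Adj x u → G.Adj x y → G.Adj u y → ¬ Twins G x u y → G.Adj x t →
        (t = u ∨ G.Adj u t) → (t = y ∨ G.Adj y t) → Twins G x t u ∨ Twins G x t y := by
      intro x u y t hu hy huy hne ht h1 h2
      have h3 := (hstr x).2.2 ⟨u, hu⟩ ⟨y, hy⟩ (by rw [mem_locNbhd]; exact Or.inr huy.symm)
        (fun h4 => hne ((twins_iff (y := ⟨u, hu⟩) (y' := ⟨y, hy⟩)).2 h4))
      have h4 : (⟨t, ht⟩ : {y // G.Adj x y}) ∈ locNbhd G x ⟨u, hu⟩ ∩ locNbhd G x ⟨y, hy⟩ := by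
        simp only [Finset.mem_inter, mem_locNbhd, Subtype.ext_iff]
        exact ⟨h1, h2⟩
      rw [h3, Finset.mem_union, LocalData.mem_tw, LocalData.mem_tw] at h4
      exact h4.imp (fun h5 => (twins_iff (y := ⟨t, ht⟩) (y' := ⟨u, hu⟩)).2 h5)
        fun h5 => (twins_iff (y := ⟨t, ht⟩) (y' := ⟨y, hy⟩)).2 h5
    obtain ⟨x⟩ := hc.nonempty
    obtain ⟨y, hy⟩ := hnb x
    obtain ⟨z, hz, hyz, hna⟩ := hnon x y hy
    obtain ⟨u, hu, huy, huz⟩ := hEx x y z hy hz hyz hna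
    have hnt : ¬ Twins G x u y := by
      intro h1
      rcases (h1 z hz).1 (Or.inr huz) with h2 | h2
      exacts [hyz h2.symm, hna h2]
    obtain ⟨y', hne, huy', hty⟩ := htw u y huy
    have hyy' : G.Adj y y' := ((hty y' huy').2 (Or.inl rfl)).resolve_left hne
    have hsubt : ∀ {x u y : V}, G.Adj x u → G.Adj x y →
        (∀ t, G.Adj x t → (t = y ∨ G.Adj y t) → (t = u ∨ G.Adj u t)) → Twins G x u y := by
      intro x u y hu hy h1
      refine (twins_iff (y := ⟨u, hu⟩) (y' := ⟨y, hy⟩)).2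
        (Finset.eq_of_subset_of_card_le (fun t ht => ?_) ?_).symm
      · simp only [mem_locNbhd, Subtype.ext_iff] at ht ⊢
        exact h1 t.1 t.2 ht
      · rw [(hloc x).card, (hloc x).card]
    have hyx : y' ≠ x := by
      rintro rfl
      refine hnt (hsubt hu hy fun t ht h1 => ?_)
      rcases h1 with rfl | h1
      · exact Or.inr huy
      · exact hty.adj hlam huy huy' hne.symm h1 ht
    have hxy' : G.Adj x y' :=
      (((hty x hu.symm).1 (Or.inr hy.symm)).resolve_left hyx.symm).symm
    rcases hin x u y y' hu hy huy hnt hxy' (Or.inr huy') (Or.inr hyy') with h1 | h1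
    · rcases (h1 z hz).2 (Or.inr huz) with h2 | h2
      · exact hna (h2 ▸ hyy')
      · rcases (hty z huz).2 (Or.inr h2) with h3 | h3
        exacts [hyz h3.symm, hna h3]
    · have h2 : ∃ t, G.Adj x t ∧ (t = y ∨ G.Adj y t) ∧ ¬ (t = u ∨ G.Adj u t) := by
        by_contra! h2
        refine hnt (hsubt hu hy fun t ht h3 => ?_)
        by_cases h4 : t = u
        · exact Or.inl h4
        · exact Or.inr (by_contra fun h5 => h5 (by have := h2 t ht h3; tauto))
      obtain ⟨t, hxt, hyt, hut⟩ := h2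
      have hyt' : G.Adj y t := hyt.resolve_left (by rintro rfl; exact hut (Or.inr huy))
      have hy't : G.Adj y' t := ((h1 t hxt).2 hyt).resolve_left
        (by rintro rfl; exact hut (Or.inr huy'))
      exact hut (hty.adj hlam huy huy' hne.symm hyt' hy't)
  subst hb
  have hnoK4 : ∀ a b c d, G.Adj a b → G.Adj a c → G.Adj a d → G.Adj b c → G.Adj b d →
      G.Adj c d → False := by
    intro x p q r hp hq hr hpq hpr hqr
    have htw1 : ∀ {u v : {y // G.Adj x y}}, locNbhd G x u = locNbhd G x v → u = v := by
      intro u v huv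
      have h1 := (hstr x).2.1 v
      exact Finset.card_le_one.1 h1.le u (LocalData.mem_tw.2 huv) v (LocalData.mem_tw.2 rfl)
    have h1 := (hstr x).2.2 ⟨p, hp⟩ ⟨q, hq⟩ (mem_locNbhd.2 (Or.inr hpq.symm))
      (fun h2 => hpq.ne (congrArg Subtype.val (htw1 h2)))
    have h2 : (⟨r, hr⟩ : {y // G.Adj x y}) ∈ locNbhd G x ⟨p, hp⟩ ∩ locNbhd G x ⟨q, hq⟩ :=
      Finset.mem_inter.2 ⟨mem_locNbhd.2 (Or.inr hpr), mem_locNbhd.2 (Or.inr hqr)⟩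
    rw [h1, Finset.mem_union, LocalData.mem_tw, LocalData.mem_tw] at h2
    rcases h2 with h2 | h2
    · exact hpr.ne (congrArg Subtype.val (htw1 h2)).symm
    · exact hqr.ne (congrArg Subtype.val (htw1 h2)).symm
  have hadj : ∀ y z a b, y ≠ z → ¬ G.Adj y z → G.Adj a y → G.Adj a z → G.Adj b y → G.Adj b z →
      a = b ∨ G.Adj a b := by
    intro y z a b hyz hna h1 h2 h3 h4
    exact (hT a y z h1 h2 hyz hna b h3.symm h4.symm).imp Eq.symm id
  have hreg : ∀ x, (Finset.univ.filter fun y => G.Adj x y).card = k := by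
    intro x
    rw [← hG.regular x, ← SimpleGraph.card_neighborFinset_eq_degree]
    congr 1
    ext; simp
  refine ⟨rfl, ?_⟩
  obtain ⟨x⟩ := hc.nonempty
  rcases (hstr x).1 with ⟨rfl, h1⟩ | ⟨rfl, h1⟩
  · obtain rfl : lam = 2 := by omega
    obtain rfl : k = 5 := by omega
    exact Or.inl ⟨hc, hreg, hlam, hnoK4, hadj, hEx⟩
  · obtain rfl : lam = 3 := by omega
    obtain rfl : k = 10 := by omega
    exact Or.inr ⟨hc, hreg, hlam, hnoK4, hadj, hEx⟩

end KoolenPark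

/-! ### Homomorphisms from a model graph are isomorphisms. -/

namespace KoolenPark

variable {V : Type*} [Fintype V] [DecidableEq V] {G : SimpleGraph V} [DecidableRel G.Adj]
variable {U : Type*} [Fintype U] [DecidableEq U] {M : SimpleGraph U} [DecidableRel M.Adj]

/-- Conditions on a graph which imply that every homomorphism to a graph `G` with
`LocallyMoore G k lam` is an isomorphism. -/
structure Rigid (M : SimpleGraph U) [DecidableRel M.Adj] (k lam : ℕ) : Prop where
  reg : ∀ x, (Finset.univ.filter fun y => M.Adj x y).card = k
  lam : ∀ x y, M.Adj x y → (cn M x y).card = lam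
  loc : ∀ a m m', M.Adj a m → M.Adj a m' → m ≠ m' → ¬ M.Adj m m' →
    ∃ d e, M.Adj a d ∧ M.Adj a e ∧ M.Adj m d ∧ M.Adj d e ∧ M.Adj e m'
  diam : ∀ m m', ∃ a b c, (m = a ∨ M.Adj m a) ∧ (a = b ∨ M.Adj a b) ∧ (b = c ∨ M.Adj b c) ∧
    (c = m' ∨ M.Adj c m')

namespace Rigid

variable {k lam : ℕ} {f : U → V}

/-- If nonadjacent `m`, `m'` had the same image, the path `m, d, e, m'` in the local graph of `a`
would become a triangle, and together with `f a` a 4-clique. -/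
theorem local_inj (hM : Rigid M k lam) (hG : LocallyMoore G k lam)
    (hf : ∀ a b, M.Adj a b → G.Adj (f a) (f b)) {a m m' : U} (hm : M.Adj a m) (hm' : M.Adj a m')
    (h : f m = f m') : m = m' := by
  by_contra hne
  by_cases hadj : M.Adj m m'
  · exact (hf _ _ hadj).ne h
  · obtain ⟨d, e, h1, h2, h3, h4, h5⟩ := hM.loc a m m' hm hm' hne hadj
    exact hG.noK4 _ _ _ _ (hf _ _ hm) (hf _ _ h1) (hf _ _ h2) (hf _ _ h3)
      (h ▸ (hf _ _ h5).symm) (hf _ _ h4)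

theorem exists_lift (hM : Rigid M k lam) (hG : LocallyMoore G k lam)
    (hf : ∀ a b, M.Adj a b → G.Adj (f a) (f b)) {a : U} {v : V} (hv : G.Adj (f a) v) :
    ∃ m, M.Adj a m ∧ f m = v := by
  have h1 : (Finset.univ.filter fun y => M.Adj a y).image f =
      Finset.univ.filter fun y => G.Adj (f a) y := by
    refine Finset.eq_of_subset_of_card_le (fun w hw => ?_) ?_
    · rw [Finset.mem_image] at hw
      obtain ⟨m, hm, rfl⟩ := hw
      rw [Finset.mem_filter] at hm ⊢
      exact ⟨Finset.mem_univ _, hf _ _ hm.2⟩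
    · rw [hG.reg, Finset.card_image_of_injOn, hM.reg]
      intro m hm m' hm' hmm
      exact hM.local_inj hG hf (Finset.mem_filter.1 hm).2 (Finset.mem_filter.1 hm').2 hmm
  have h2 : v ∈ Finset.univ.filter fun y => G.Adj (f a) y := by simp [hv]
  rw [← h1, Finset.mem_image] at h2
  obtain ⟨m, hm, h3⟩ := h2
  exact ⟨m, (Finset.mem_filter.1 hm).2, h3⟩

/-- The common neighbours of `a` and `m` map injectively to those of their images, and both sets
have size `lam`; so every common neighbour of the images lifts. -/
theorem lift_adj (hM : Rigid M k lam) (hG : LocallyMoore G k lam)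
    (hf : ∀ a b, M.Adj a b → G.Adj (f a) (f b)) {a m m' : U} (hm : M.Adj a m) (hm' : M.Adj a m')
    (h : G.Adj (f m) (f m')) : M.Adj m m' := by
  have h1 : (cn M a m).image f = cn G (f a) (f m) := by
    refine Finset.eq_of_subset_of_card_le (fun w hw => ?_) ?_
    · rw [Finset.mem_image] at hw
      obtain ⟨t, ht, rfl⟩ := hw
      rw [mem_cn] at ht ⊢
      exact ⟨hf _ _ ht.1, hf _ _ ht.2⟩
    · rw [hG.lam _ _ (hf _ _ hm), Finset.card_image_of_injOn, hM.lam _ _ hm]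
      intro t ht t' ht' htt
      rw [Finset.mem_coe, mem_cn] at ht ht'
      exact hM.local_inj hG hf ht.1 ht'.1 htt
  have h2 : f m' ∈ cn G (f a) (f m) := mem_cn.2 ⟨hf _ _ hm', h⟩
  rw [← h1, Finset.mem_image] at h2
  obtain ⟨t, ht, h3⟩ := h2
  rw [mem_cn] at ht
  rw [← hM.local_inj hG hf ht.1 hm' h3]
  exact ht.2

/-- If the walk closes in `G`, then `f m` is adjacent to `f b`. This adjacency lifts, so `m` and
`m'` are both neighbours of `b`. -/
theorem inj_three (hM : Rigid M k lam) (hG : LocallyMoore G k lam)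
    (hf : ∀ a b, M.Adj a b → G.Adj (f a) (f b)) {m a b m' : U} (h1 : M.Adj m a) (h2 : M.Adj a b)
    (h3 : M.Adj b m') (h : f m = f m') : m = m' := by
  have h4 : M.Adj m b := hM.lift_adj hG hf h1.symm h2 (h ▸ (hf _ _ h3).symm)
  exact hM.local_inj hG hf h4.symm h3 h

/-- If `f a` and `f c` are distinct and nonadjacent, their common neighbours `f m` and `f b` are
equal or adjacent by `adj_of`, and lifting this shortens the walk. -/
theorem inj_four (hM : Rigid M k lam) (hG : LocallyMoore G k lam)
    (hf : ∀ a b, M.Adj a b → G.Adj (f a) (f b)) {m a b c m' : U} (h1 : M.Adj m a)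
    (h2 : M.Adj a b) (h3 : M.Adj b c) (h4 : M.Adj c m') (h : f m = f m') : m = m' := by
  by_cases hac : f a = f c
  · have := hM.local_inj hG hf h2.symm h3 hac
    subst this
    exact hM.local_inj hG hf h1.symm h4 h
  by_cases hadj : G.Adj (f a) (f c)
  · exact hM.inj_three hG hf h1 (hM.lift_adj hG hf h2.symm h3 hadj) h4 h
  rcases hG.adj_of _ _ (f m) (f b) hac hadj (hf _ _ h1) (h ▸ (hf _ _ h4).symm)
    (hf _ _ h2.symm) (hf _ _ h3) with h5 | h5
  · have := hM.local_inj hG hf h1.symm h2 h5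
    subst this
    exact hM.local_inj hG hf h3.symm h4 h
  · exact hM.inj_three hG hf (hM.lift_adj hG hf h1.symm h2 h5) h3 h4 h

theorem injective (hM : Rigid M k lam) (hG : LocallyMoore G k lam)
    (hf : ∀ a b, M.Adj a b → G.Adj (f a) (f b)) : Function.Injective f := by
  have one : ∀ {m m'}, M.Adj m m' → f m = f m' → m = m' := fun h1 h2 =>
    absurd h2 (hf _ _ h1).ne
  have two : ∀ {m a m'}, M.Adj m a → M.Adj a m' → f m = f m' → m = m' := fun h1 h2 =>
    hM.local_inj hG hf h1.symm h2
  intro m m' h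
  obtain ⟨a, b, c, h1, h2, h3, h4⟩ := hM.diam m m'
  -- Each of the four steps of the walk may stall, so all walks of length at most four occur.
  rcases h1 with rfl | h1 <;> rcases h2 with rfl | h2 <;> rcases h3 with rfl | h3 <;>
    rcases h4 with rfl | h4
  all_goals first
    | rfl
    | exact hM.inj_four hG hf (by assumption) h2 h3 h4 h
    | exact one (by assumption) h
    | exact two h1 h2 h
    | exact two h1 h3 h
    | exact two h1 h4 h
    | exact two h2 h3 h
    | exact two h2 h4 h
    | exact two h3 h4 h
    | exact hM.inj_three hG hf h1 h2 h3 h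
    | exact hM.inj_three hG hf h1 h2 h4 h
    | exact hM.inj_three hG hf h1 h3 h4 h
    | exact hM.inj_three hG hf h2 h3 h4 h

/-- Walks of the connected graph `G` lift step by step, which gives surjectivity; with injectivity,
lifting an edge also reflects adjacency. -/
theorem nonempty_iso [Nonempty U] (hM : Rigid M k lam) (hG : LocallyMoore G k lam)
    (hf : ∀ a b, M.Adj a b → G.Adj (f a) (f b)) : Nonempty (G ≃g M) := by
  have hinj := hM.injective hG hf
  have hsurj : Function.Surjective f := by
    obtain ⟨u⟩ := ‹Nonempty U›
    intro v
    obtain ⟨w⟩ := hG.conn.preconnected (f u) v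
    have : ∀ (x y : V), G.Walk x y → (∃ m, f m = x) → ∃ m, f m = y := by
      intro x y w
      induction w with
      | nil => exact id
      | cons h _ ih =>
        rintro ⟨m, rfl⟩
        obtain ⟨m', _, h2⟩ := hM.exists_lift hG hf h
        exact ih ⟨m', h2⟩
    exact this _ _ w ⟨u, rfl⟩
  have e : M ≃g G := by
    refine ⟨Equiv.ofBijective f ⟨hinj, hsurj⟩, fun {a b} => ?_⟩
    change G.Adj (f a) (f b) ↔ M.Adj a b
    refine ⟨fun h => ?_, hf a b⟩
    obtain ⟨m, h1, h2⟩ := hM.exists_lift hG hf h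
    rwa [← hinj h2]
  exact ⟨e.symm⟩

end Rigid

/-! ### Counting common neighbours. -/

namespace LocallyMoore

variable {k lam : ℕ}

/-- Uniqueness of the second common neighbour. -/
theorem unique (hG : LocallyMoore G k lam) {y z x w w' : V} (hyz : y ≠ z) (hna : ¬ G.Adj y z)
    (hxy : G.Adj x y) (hxz : G.Adj x z) (hwy : G.Adj w y) (hwz : G.Adj w z) (hw'y : G.Adj w' y)
    (hw'z : G.Adj w' z) (hwx : w ≠ x) (hw'x : w' ≠ x) : w = w' := by
  by_contra hne
  have h1 := (hG.adj_of y z x w hyz hna hxy hxz hwy hwz).resolve_left hwx.symm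
  have h2 := (hG.adj_of y z x w' hyz hna hxy hxz hw'y hw'z).resolve_left hw'x.symm
  have h3 := (hG.adj_of y z w w' hyz hna hwy hwz hw'y hw'z).resolve_left hne
  exact hG.noK4 _ _ _ _ h1 h2 hxy h3 hwy hw'y

theorem exists_adj (hG : LocallyMoore G k lam) (hk : k ≠ 0) (x : V) : ∃ y, G.Adj x y := by
  have h1 := hG.reg x
  have : (Finset.univ.filter fun y => G.Adj x y).Nonempty := by
    rw [← Finset.card_pos]; omega
  obtain ⟨y, hy⟩ := this
  exact ⟨y, (Finset.mem_filter.1 hy).2⟩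

theorem two_cn (hG : LocallyMoore G k 2) {x y : V} (h : G.Adj x y) :
    ∃ a b, a ≠ b ∧ G.Adj x a ∧ G.Adj y a ∧ G.Adj x b ∧ G.Adj y b ∧
      ∀ t, G.Adj x t → G.Adj y t → t = a ∨ t = b := by
  obtain ⟨a, b, hab, h1⟩ := Finset.card_eq_two.1 (hG.lam x y h)
  have h2 : ∀ t, t ∈ cn G x y ↔ t = a ∨ t = b := by simp [h1]
  simp only [mem_cn] at h2
  exact ⟨a, b, hab, ((h2 a).2 (Or.inl rfl)).1, ((h2 a).2 (Or.inl rfl)).2,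
    ((h2 b).2 (Or.inr rfl)).1, ((h2 b).2 (Or.inr rfl)).2, fun t h3 h4 => (h2 t).1 ⟨h3, h4⟩⟩

theorem three_cn (hG : LocallyMoore G k 3) {x y : V} (h : G.Adj x y) :
    ∃ a b c, a ≠ b ∧ a ≠ c ∧ b ≠ c ∧ G.Adj x a ∧ G.Adj y a ∧ G.Adj x b ∧ G.Adj y b ∧
      G.Adj x c ∧ G.Adj y c ∧ ∀ t, G.Adj x t → G.Adj y t → t = a ∨ t = b ∨ t = c := by
  obtain ⟨a, b, c, hab, hac, hbc, h1⟩ := Finset.card_eq_three.1 (hG.lam x y h)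
  have h2 : ∀ t, t ∈ cn G x y ↔ t = a ∨ t = b ∨ t = c := by simp [h1]
  simp only [mem_cn] at h2
  have ha := (h2 a).2 (by simp)
  have hb := (h2 b).2 (by simp)
  have hc := (h2 c).2 (by simp)
  exact ⟨a, b, c, hab, hac, hbc, ha.1, ha.2, hb.1, hb.2, hc.1, hc.2,
    fun t h3 h4 => (h2 t).1 ⟨h3, h4⟩⟩

/-- Given one common neighbour, there are exactly two others. -/
theorem two_others (hG : LocallyMoore G k 3) {x y a : V} (h : G.Adj x y) (hxa : G.Adj x a)
    (hya : G.Adj y a) : ∃ b c, b ≠ a ∧ c ≠ a ∧ b ≠ c ∧ G.Adj x b ∧ G.Adj y b ∧ G.Adj x c ∧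
      G.Adj y c ∧ ∀ t, G.Adj x t → G.Adj y t → t = a ∨ t = b ∨ t = c := by
  obtain ⟨p, q, r, h1, h2, h3, h4, h5, h6, h7, h8, h9, hall⟩ := hG.three_cn h
  rcases hall a hxa hya with rfl | rfl | rfl
  · exact ⟨q, r, h1.symm, h2.symm, h3, h6, h7, h8, h9, hall⟩
  · exact ⟨p, r, h1, h3.symm, h2, h4, h5, h8, h9, fun t ht ht' => by
      have := hall t ht ht'; tauto⟩
  · exact ⟨p, q, h2, h3, h1, h4, h5, h6, h7, fun t ht ht' => by
      have := hall t ht ht'; tauto⟩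

/-- Given two common neighbours, there is exactly one other. -/
theorem one_other (hG : LocallyMoore G k 3) {x y a b : V} (h : G.Adj x y) (hxa : G.Adj x a)
    (hya : G.Adj y a) (hxb : G.Adj x b) (hyb : G.Adj y b) (hab : a ≠ b) :
    ∃ c, c ≠ a ∧ c ≠ b ∧ G.Adj x c ∧ G.Adj y c ∧
      ∀ t, G.Adj x t → G.Adj y t → t = a ∨ t = b ∨ t = c := by
  obtain ⟨q, r, h1, h2, h3, h6, h7, h8, h9, hall⟩ := hG.two_others h hxa hya
  rcases hall b hxb hyb with h4 | rfl | rfl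
  · exact absurd h4.symm hab
  · exact ⟨r, h2, h3.symm, h8, h9, hall⟩
  · exact ⟨q, h1, h3, h6, h7, fun t ht ht' => by have := hall t ht ht'; tauto⟩

end LocallyMoore

end KoolenPark

/-! ### Locally Petersen graphs: vertices at distance two. -/

namespace KoolenPark
namespace LocallyMoore

variable {V : Type*} [Fintype V] [DecidableEq V] {G : SimpleGraph V} [DecidableRel G.Adj]
variable {k : ℕ} {x : V}

/-- Given three common neighbours, there is no other. -/
theorem eq_of_three (hG : LocallyMoore G k 3) {y z a b c t : V} (h : G.Adj y z)
    (ha : G.Adj y a) (ha' : G.Adj z a) (hb : G.Adj y b) (hb' : G.Adj z b) (hc : G.Adj y c)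
    (hc' : G.Adj z c) (hab : a ≠ b) (hac : a ≠ c) (hbc : b ≠ c) (ht : G.Adj y t)
    (ht' : G.Adj z t) : t = a ∨ t = b ∨ t = c := by
  obtain ⟨d, h1, h2, h3, h4, hall⟩ := hG.one_other h ha ha' hb hb' hab
  rcases hall c hc hc' with h5 | h5 | h5
  · exact absurd h5.symm hac
  · exact absurd h5.symm hbc
  · rw [h5]; exact hall t ht ht'

theorem no_triangle (hG : LocallyMoore G k 3) {a b c : V} (ha : G.Adj x a) (hb : G.Adj x b)
    (hc : G.Adj x c) (hab : G.Adj a b) (hbc : G.Adj b c) : ¬ G.Adj a c :=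
  fun h => hG.noK4 x a b c ha hb hc hab h hbc

/-- A path of length three in the local graph of `x`. -/
structure LPath (G : SimpleGraph V) (x a b c d : V) : Prop where
  xa : G.Adj x a
  xb : G.Adj x b
  xc : G.Adj x c
  xd : G.Adj x d
  ab : G.Adj a b
  bc : G.Adj b c
  cd : G.Adj c d
  ac : a ≠ c
  bd : b ≠ d

theorem LPath.not_ac (hG : LocallyMoore G k 3) {a b c d : V} (h : LPath G x a b c d) :
    ¬ G.Adj a c := hG.no_triangle h.xa h.xb h.xc h.ab h.bc

theorem LPath.not_bd (hG : LocallyMoore G k 3) {a b c d : V} (h : LPath G x a b c d) :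
    ¬ G.Adj b d := hG.no_triangle h.xb h.xc h.xd h.bc h.cd

theorem LPath.ne_ad (hG : LocallyMoore G k 3) {a b c d : V} (h : LPath G x a b c d) :
    a ≠ d := by
  rintro rfl
  exact h.not_bd hG h.ab.symm

theorem LPath.not_ad (hG : LocallyMoore G k 3) {a b c d : V} (h : LPath G x a b c d) :
    ¬ G.Adj a d := fun had =>
  h.ac (hG.unique h.bd (h.not_bd hG) h.xb h.xd h.ab had h.bc.symm h.cd h.xa.ne' h.xc.ne')

theorem LPath.close (hG : LocallyMoore G k 3) {a b c d : V} (h : LPath G x a b c d) :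
    ∃ e, G.Adj x e ∧ G.Adj d e ∧ G.Adj a e := by
  obtain ⟨e, h1, h2, h3⟩ := hG.exists_of x a d h.xa h.xd (h.ne_ad hG) (h.not_ad hG)
  exact ⟨e, h1, h3.symm, h2.symm⟩

/-- The vertex `d` has three neighbours in the local graph: `c`, the one closing the path to a
pentagon, and one more. -/
theorem LPath.open_unique (hG : LocallyMoore G k 3) {a b c d e e' : V} (h : LPath G x a b c d)
    (he : G.Adj x e) (hde : G.Adj d e) (hec : e ≠ c) (hae : ¬ G.Adj a e) (he' : G.Adj x e')
    (hde' : G.Adj d e') (hec' : e' ≠ c) (hae' : ¬ G.Adj a e') : e = e' := by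
  by_contra hne
  obtain ⟨v, h1, h2, h3⟩ := h.close hG
  rcases hG.eq_of_three h.xd h.xc h.cd.symm he hde he' hde' hec.symm hec'.symm hne h1 h2 with
    rfl | rfl | rfl
  exacts [h.not_ac hG h3, hae h3, hae' h3]

/-- `z` is a vertex at distance two from `x`, whose common neighbours with `x` are `p` and `q`. -/
structure Over (G : SimpleGraph V) (x p q z : V) : Prop where
  xp : G.Adj x p
  xq : G.Adj x q
  pq : G.Adj p q
  zp : G.Adj z p
  zq : G.Adj z q
  ne : z ≠ x

theorem Over.symm {p q z : V} (h : Over G x p q z) : Over G x q p z :=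
  ⟨h.xq, h.xp, h.pq.symm, h.zq, h.zp, h.ne⟩

theorem Over.not_adj (hG : LocallyMoore G k 3) {p q z : V} (h : Over G x p q z) : ¬ G.Adj x z :=
  fun h1 => hG.noK4 _ _ _ _ h.xp h.xq h1 h.pq h.zp.symm h.zq.symm

theorem Over.nbr (hG : LocallyMoore G k 3) {p q z r : V} (h : Over G x p q z) (hr : G.Adj x r)
    (hzr : G.Adj z r) : r = p ∨ r = q := by
  by_contra! h1
  exact h1.2 (hG.unique h.ne.symm (h.not_adj hG) h.xp.symm h.zp.symm hr.symm hzr.symm h.xq.symm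
    h.zq.symm h1.1 h.pq.ne')

theorem exists_over (hG : LocallyMoore G k 3) {p z : V} (hp : G.Adj x p) (hz : G.Adj p z)
    (hne : z ≠ x) (hna : ¬ G.Adj x z) : ∃ q, Over G x p q z := by
  obtain ⟨q, h1, h2, h3⟩ := hG.exists_of p x z hp.symm hz hne.symm hna
  exact ⟨q, hp, h2.symm, h1, hz.symm, h3.symm, hne⟩

theorem Over.not_adj_of_ne (hG : LocallyMoore G k 3) {p q r z : V} (h : Over G x p q z)
    (hr : G.Adj x r) (hp : r ≠ p) (hq : r ≠ q) : ¬ G.Adj z r := fun h1 => by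
  rcases h.nbr hG hr h1 with h2 | h2
  exacts [hp h2, hq h2]

/-- This is a step along the hexagon at `p`: in the local graph of `p`, the nonadjacent vertices `z`
and `r` have a common neighbour, which lies over `pr`. -/
theorem Over.step (hG : LocallyMoore G k 3) {p q r z : V} (h : Over G x p q z) (hr : G.Adj x r)
    (hpr : G.Adj p r) (hrq : r ≠ q) : ∃ w, Over G x p r w ∧ G.Adj z w := by
  have hzr : z ≠ r := fun h1 => h.not_adj hG (h1 ▸ hr)
  obtain ⟨w, h1, h2, h3⟩ := hG.exists_of p z r h.zp.symm hpr hzr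
    (h.not_adj_of_ne hG hr hpr.ne' hrq)
  refine ⟨w, ⟨h.xp, hr, hpr, h1.symm, h3, fun h4 => ?_⟩, h2.symm⟩
  exact h.not_adj hG (h4 ▸ h2)

theorem Over.step_unique (hG : LocallyMoore G k 3) {p q r z w w' : V} (h : Over G x p q z)
    (hrq : r ≠ q) (hw : Over G x p r w) (hzw : G.Adj z w) (hw' : Over G x p r w')
    (hzw' : G.Adj z w') : w = w' :=
  hG.unique (fun h1 : z = r => h.not_adj hG (h1 ▸ hw.xq))
    (h.not_adj_of_ne hG hw.xq hw.pq.ne' hrq) h.zp.symm hw.pq hzw.symm hw.zq hzw'.symm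
    hw'.zq hw.zp.ne hw'.zp.ne

theorem exists_pair (hG : LocallyMoore G k 3) {p q : V} (hp : G.Adj x p) (hq : G.Adj x q)
    (hpq : G.Adj p q) : ∃ z z', z ≠ z' ∧ Over G x p q z ∧ Over G x p q z' ∧
      ∀ t, Over G x p q t → t = z ∨ t = z' := by
  obtain ⟨z, z', h1, h2, h3, h4, h5, h6, h7, hall⟩ := hG.two_others hpq hp.symm hq.symm
  refine ⟨z, z', h3, ⟨hp, hq, hpq, h4.symm, h5.symm, h1⟩, ⟨hp, hq, hpq, h6.symm, h7.symm, h2⟩,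
    fun t ht => (hall t ht.zp.symm ht.zq.symm).resolve_left ht.ne⟩

theorem Over.not_adj_same (hG : LocallyMoore G k 3) {p q z z' : V} (h : Over G x p q z)
    (h' : Over G x p q z') : ¬ G.Adj z z' := fun h1 =>
  hG.noK4 _ _ _ _ h.pq h.zp.symm h'.zp.symm h.zq.symm h'.zq.symm h1

/-- Two adjacent vertices at distance two from `x` have a common neighbour adjacent to `x`. -/
theorem Over.meet (hG : LocallyMoore G k 3) {p q z p' q' w : V} (h : Over G x p q z)
    (h' : Over G x p' q' w) (hzw : G.Adj z w) : p' = p ∨ p' = q ∨ q' = p ∨ q' = q := by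
  by_contra! hcon
  obtain ⟨n1, n2, n3, n4⟩ := hcon
  have hwp : ¬ G.Adj w p := h'.not_adj_of_ne hG h.xp n1.symm n3.symm
  have hwq : ¬ G.Adj w q := h'.not_adj_of_ne hG h.xq n2.symm n4.symm
  have far : ∀ {r r'}, G.Adj x r → G.Adj x r' → G.Adj z r → ¬ G.Adj w r → G.Adj w r' →
      ¬ G.Adj z r' → ¬ G.Adj r r' := by
    intro r r' hr hr' hzr hwr hwr' hzr' hrr
    rcases hG.adj_of z r' r w (fun h1 => h.not_adj hG (h1 ▸ hr')) hzr' hzr.symm hrr hzw.symm hwr'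
      with h1 | h1
    · exact h'.not_adj hG (h1 ▸ hr)
    · exact hwr h1.symm
  have hzp' : ¬ G.Adj z p' := h.not_adj_of_ne hG h'.xp n1 n2
  have hzq' : ¬ G.Adj z q' := h.not_adj_of_ne hG h'.xq n3 n4
  have f1 := far h.xp h'.xp h.zp hwp h'.zp hzp'
  have f2 := far h.xp h'.xq h.zp hwp h'.zq hzq'
  have f3 := far h.xq h'.xp h.zq hwq h'.zp hzp'
  have f4 := far h.xq h'.xq h.zq hwq h'.zq hzq'
  -- The common neighbour `r` of `z`, `w`, `p` lies over an edge `p p1`. It will turn out that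
  -- neither `q` nor `p1` is adjacent to `p'` or `q'`, so both of these reach `p` through the third
  -- neighbour of `p`, and that makes a triangle.
  obtain ⟨r, h1, h2, h3⟩ := hG.exists_of z w p hzw h.zp (fun h1 => h'.not_adj hG (h1 ▸ h.xp)) hwp
  have hxr : ¬ G.Adj x r := fun h4 => by
    rcases h.nbr hG h4 h1 with rfl | rfl
    exacts [h3.ne rfl, hwq h2.symm]
  obtain ⟨p1, ho⟩ := hG.exists_over h.xp h3.symm (fun h4 => h.not_adj hG (h4 ▸ h1.symm)) hxr
  have g : ∀ {s}, G.Adj x s → G.Adj w s → ¬ G.Adj p s → ¬ G.Adj p1 s := by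
    intro s hs hws hps h4
    have hrs : ¬ G.Adj r s := ho.not_adj_of_ne hG hs
      (fun h5 => by subst h5; exact hwp hws) (fun h5 => by subst h5; exact hps ho.pq)
    rcases hG.adj_of r s p1 w (fun h5 => hxr (h5 ▸ hs)) hrs ho.zq.symm h4 h2.symm hws with h5 | h5
    · exact h'.not_adj hG (h5 ▸ ho.xq)
    · rcases h'.nbr hG ho.xq h5.symm with h6 | h6
      · exact f1 (h6 ▸ ho.pq)
      · exact f2 (h6 ▸ ho.pq)
  have g1 := g h'.xp h'.zp f1
  have g2 := g h'.xq h'.zq f2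
  have hp1q : p1 ≠ q := fun h4 => by
    subst h4
    exact hG.noK4 _ _ _ _ h.pq h3.symm h.zp.symm ho.zq.symm h.zq.symm h1.symm
  have mid : ∀ {s}, G.Adj x s → ¬ G.Adj p s → p ≠ s → ¬ G.Adj q s → ¬ G.Adj p1 s →
      ∃ c, G.Adj x c ∧ G.Adj p c ∧ G.Adj c s ∧ c ≠ q ∧ c ≠ p1 := by
    intro s hs h4 h5 h6 h7
    obtain ⟨c, h8, h9, h10⟩ := hG.exists_of x p s h.xp hs h5 h4
    exact ⟨c, h8, h9.symm, h10, fun h => h6 (h ▸ h10), fun h => h7 (h ▸ h10)⟩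
  obtain ⟨c, c1, c2, c3, c4, c5⟩ := mid h'.xp f1 n1.symm f3 g1
  obtain ⟨c', c1', c2', c3', c4', c5'⟩ := mid h'.xq f2 n3.symm f4 g2
  have : c' = c := by
    rcases hG.eq_of_three h.xp h.xq h.pq ho.xq ho.pq c1 c2 hp1q.symm c4.symm c5.symm c1' c2' with
      h4 | h4 | h4
    exacts [absurd h4 c4', absurd h4 c5', h4]
  subst this
  exact hG.no_triangle h'.xp h'.xq c1 h'.pq c3'.symm c3.symm

/-! ### Sides of the hexagons -/

theorem zmod_two_eq {a b : ZMod 2} (h : a ≠ b) : b = a + 1 := by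
  revert a b; decide

theorem zmod_two_ne (a : ZMod 2) : a + 1 ≠ a := by
  revert a; decide

/-- A 2-colouring, for every neighbour `p` of `x`, of the hexagon of neighbours of `p` at
distance two from `x`. -/
structure Side (G : SimpleGraph V) (x : V) (f : V → V → ZMod 2) : Prop where
  same : ∀ p q z z', Over G x p q z → Over G x p q z' → z ≠ z' → f p z' = f p z + 1
  adj : ∀ p q r z w, Over G x p q z → Over G x p r w → q ≠ r →
    (G.Adj z w ↔ f p w = f p z + 1)

theorem exists_side_at (hG : LocallyMoore G k 3) {p : V} (hp : G.Adj x p) : ∃ f : V → ZMod 2,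
    (∀ q z z', Over G x p q z → Over G x p q z' → z ≠ z' → f z' = f z + 1) ∧
    ∀ q r z w, Over G x p q z → Over G x p r w → q ≠ r → (G.Adj z w ↔ f w = f z + 1) := by
  obtain ⟨q₀, -, -, -, -, -, hq₀, hpq₀, -⟩ := hG.three_cn hp
  obtain ⟨z₀, z₁, h01, hz₀, hz₁, hall⟩ := hG.exists_pair hp hq₀ hpq₀
  -- The pair over `p q₀` gets the colours 0 and 1. Of the other four vertices of the hexagon, those
  -- adjacent to `z₀` get 1, and the remaining ones, which are adjacent to `z₁`, get 0.
  set f : V → ZMod 2 := fun z => if z = z₀ ∨ (¬ G.Adj z q₀ ∧ ¬ G.Adj z z₀) then 0 else 1 with hf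
  have fz₀ : f z₀ = 0 := by simp [hf]
  have fz₁ : f z₁ = 1 := by simp [hf, h01.symm, hz₁.zq]
  have far : ∀ {r z}, Over G x p r z → r ≠ q₀ → z ≠ z₀ ∧ ¬ G.Adj z q₀ := by
    intro r z h1 h2
    have : ¬ G.Adj z q₀ := h1.not_adj_of_ne hG hq₀ hpq₀.ne' h2.symm
    exact ⟨fun h3 => this (h3 ▸ hz₀.zq), this⟩
  have fadj : ∀ {r z}, Over G x p r z → r ≠ q₀ → G.Adj z z₀ → f z = 1 := by
    intro r z h1 h2 h3
    simp [hf, far h1 h2, h3]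
  have fnadj : ∀ {r z}, Over G x p r z → r ≠ q₀ → ¬ G.Adj z z₀ → f z = 0 := by
    intro r z h1 h2 h3
    simp [hf, far h1 h2, h3]
  have other : ∀ {r z}, Over G x p r z → r ≠ q₀ → ¬ G.Adj z z₀ → G.Adj z z₁ := by
    intro r z h1 h2 h3
    obtain ⟨w, h4, h5⟩ := h1.step hG hq₀ hpq₀ h2.symm
    rcases hall w h4 with rfl | rfl
    exacts [absurd h5 h3, h5]
  have same : ∀ q z z', Over G x p q z → Over G x p q z' → z ≠ z' → f z' = f z + 1 := by
    intro q z z' h1 h2 h3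
    by_cases hq : q = q₀
    · subst hq
      rcases hall z h1 with rfl | rfl <;> rcases hall z' h2 with rfl | rfl
      · exact absurd rfl h3
      · rw [fz₀, fz₁]; rfl
      · rw [fz₀, fz₁]; rfl
      · exact absurd rfl h3
    · by_cases h4 : G.Adj z z₀ <;> by_cases h5 : G.Adj z' z₀
      · exact absurd (hz₀.step_unique hG hq h1 h4.symm h2 h5.symm) h3
      · rw [fadj h1 hq h4, fnadj h2 hq h5]; rfl
      · rw [fadj h2 hq h5, fnadj h1 hq h4]; rfl
      · exact absurd (hz₁.step_unique hG hq h1 (other h1 hq h4).symm h2 (other h2 hq h5).symm) h3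
  have half : ∀ r z w, Over G x p q₀ z → Over G x p r w → r ≠ q₀ → G.Adj z w → f w = f z + 1 := by
    intro r z w h1 h2 h3 h4
    rcases hall z h1 with rfl | rfl
    · rw [fz₀, fadj h2 h3 h4.symm]; rfl
    · rw [fz₁, fnadj h2 h3 fun h5 => h01 (h2.step_unique hG h3.symm hz₀ h5 hz₁ h4.symm)]; rfl
  have fwd : ∀ q r z w, Over G x p q z → Over G x p r w → q ≠ r → G.Adj z w →
      f w = f z + 1 := by
    intro q r z w h1 h2 h3 h4
    by_cases hq : q = q₀
    · subst hq
      exact half _ _ _ h1 h2 h3.symm h4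
    by_cases hr : r = q₀
    · subst hr
      rw [half _ _ _ h2 h1 hq h4.symm, add_assoc, show (1 : ZMod 2) + 1 = 0 from rfl, add_zero]
    by_cases h5 : G.Adj z z₀ <;> by_cases h6 : G.Adj w z₀
    · exact (hG.noK4 _ _ _ _ hz₀.zp.symm h1.zp.symm h2.zp.symm h5.symm h6.symm h4).elim
    · rw [fadj h1 hq h5, fnadj h2 hr h6]; rfl
    · rw [fadj h2 hr h6, fnadj h1 hq h5]; rfl
    · exact (hG.noK4 _ _ _ _ hz₁.zp.symm h1.zp.symm h2.zp.symm (other h1 hq h5).symm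
        (other h2 hr h6).symm h4).elim
  refine ⟨f, same, fun q r z w h1 h2 h3 => ⟨fwd q r z w h1 h2 h3, fun h4 => ?_⟩⟩
  obtain ⟨w', h5, h6⟩ := h1.step hG h2.xq h2.pq h3.symm
  by_cases h7 : w' = w
  · rwa [← h7]
  · have h8 := same r w' w h5 h2 h7
    rw [fwd q r z w' h1 h5 h3 h6, h4] at h8
    exact absurd h8.symm (zmod_two_ne _)

theorem exists_side (hG : LocallyMoore G k 3) (x : V) : ∃ f, Side G x f := by
  choose f hf using fun p : {p // G.Adj x p} => hG.exists_side_at p.2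
  refine ⟨fun p => if h : G.Adj x p then f ⟨p, h⟩ else 0, ?_, ?_⟩
  · intro p q z z' h1
    rw [dif_pos h1.xp]
    exact (hf ⟨p, h1.xp⟩).1 q z z' h1
  · intro p q r z w h1
    rw [dif_pos h1.xp]
    exact (hf ⟨p, h1.xp⟩).2 q r z w h1

/-! ### Vertices at distance three -/

/-- `z` and `w` are adjacent vertices at distance two from `x`, over the edges `ab` and `bc`, and
`u` is a common neighbour of them other than `b`. -/
structure Seg (G : SimpleGraph V) (x a b c z w u : V) : Prop where
  oz : Over G x a b z
  ow : Over G x b c w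
  zw : G.Adj z w
  uz : G.Adj u z
  uw : G.Adj u w
  ub : u ≠ b

namespace Seg

variable {a b c d e g z w t u : V}

theorem symm (h : Seg G x a b c z w u) : Seg G x c b a w z u :=
  ⟨h.ow.symm, h.oz.symm, h.zw.symm, h.uw, h.uz, h.ub⟩

theorem ne (hG : LocallyMoore G k 3) (h : Seg G x a b c z w u) : a ≠ c := by
  rintro rfl
  exact h.oz.not_adj_same hG h.ow.symm h.zw

theorem not_b (hG : LocallyMoore G k 3) (h : Seg G x a b c z w u) : ¬ G.Adj u b := fun h1 =>
  hG.noK4 _ _ _ _ h1 h.uz h.uw h.oz.zq.symm h.ow.zp.symm h.zw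

theorem not_c (hG : LocallyMoore G k 3) (h : Seg G x a b c z w u) : ¬ G.Adj u c := fun h1 =>
  h.ub (hG.unique (y := z) (z := c) (x := w) (fun h2 => h.oz.not_adj hG (h2 ▸ h.ow.xq))
    (h.oz.not_adj_of_ne hG h.ow.xq (h.ne hG).symm h.ow.pq.ne') h.zw.symm h.ow.zq h.uz h1 h.oz.zq.symm
    h.ow.pq h.uw.ne h.ow.zp.ne')

theorem not_a (hG : LocallyMoore G k 3) (h : Seg G x a b c z w u) : ¬ G.Adj u a :=
  h.symm.not_c hG

theorem ne_x (hG : LocallyMoore G k 3) (h : Seg G x a b c z w u) : u ≠ x :=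
  fun h1 => h.oz.not_adj hG (h1 ▸ h.uz)

theorem not_x (hG : LocallyMoore G k 3) (h : Seg G x a b c z w u) : ¬ G.Adj x u := fun h1 => by
  rcases h.oz.nbr hG h1 h.uz.symm with rfl | rfl
  · exact h.ow.not_adj_of_ne hG h1 h.oz.pq.ne (h.ne hG) h.uw.symm
  · exact h.ub rfl

/-- A neighbour of `x` adjacent to `u` would put `u` over some edge, and by `Over.meet` that edge
contains `a` or `b`, neither of which is adjacent to `u`. So `u` is not within distance two of `x`.
-/
theorem not_nbr (hG : LocallyMoore G k 3) (h : Seg G x a b c z w u) {r : V} (hr : G.Adj x r) :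
    ¬ G.Adj u r := fun h1 => by
  obtain ⟨r', ho⟩ := hG.exists_over hr h1.symm (h.ne_x hG) (h.not_x hG)
  rcases h.oz.meet hG ho h.uz.symm with rfl | rfl | rfl | rfl
  exacts [h.not_a hG h1, h.not_b hG h1, h.not_a hG ho.zq, h.not_b hG ho.zq]

/-- In the local graph of `w`, the nonadjacent vertices `u` and `c` have a common neighbour `t`; it
lies over an edge `cd`. This is how one walks around `u`. -/
theorem step (hG : LocallyMoore G k 3) (h : Seg G x a b c z w u) :
    ∃ d t, Seg G x b c d w t u := by
  have huc : u ≠ c := fun h1 => h.not_x hG (h1 ▸ h.ow.xq)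
  obtain ⟨t, h1, h2, h3⟩ := hG.exists_of w u c h.uw.symm h.ow.zq huc (h.not_c hG)
  have hxt : ¬ G.Adj x t := fun h4 => h.not_nbr hG h4 h2.symm
  obtain ⟨d, hd⟩ := hG.exists_over h.ow.xq h3.symm (fun h4 => h.ow.not_adj hG (h4 ▸ h1.symm)) hxt
  exact ⟨d, t, h.ow, hd, h1, h.uw, h2.symm, huc⟩

theorem step_unique (hG : LocallyMoore G k 3) {d' t' : V} (h : Seg G x b c d w t u)
    (h' : Seg G x b c d' w t' u) : d = d' ∧ t = t' := by
  have h1 : t = t' := hG.unique (y := u) (z := c) (x := w) h.ub (h.not_b hG) h.uz.symm h.oz.zq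
    h.uw.symm h.ow.zp h'.uw.symm h'.ow.zp h.zw.ne' h'.zw.ne'
  subst h1
  refine ⟨?_, rfl⟩
  rcases h.ow.nbr hG h'.ow.xq h'.ow.zq with h2 | h2
  · exact absurd h2 h'.ow.pq.ne'
  · exact h2.symm

/-- The vertices `z` and `t` are distinct and nonadjacent, and `w` and `u` are their two common
neighbours. -/
theorem unique_u (hG : LocallyMoore G k 3) {u' : V} (h1 : Seg G x a b c z w u)
    (h2 : Seg G x b c d w t u) (h1' : Seg G x a b c z w u') (h2' : Seg G x b c d w t u') :
    u = u' := by
  have hp : LPath G x a b c d :=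
    ⟨h1.oz.xp, h1.oz.xq, h1.ow.xq, h2.ow.xq, h1.oz.pq, h1.ow.pq, h2.ow.pq, h1.ne hG, h2.ne hG⟩
  have hzt : ¬ G.Adj z t := fun h => by
    rcases h1.oz.meet hG h2.ow h with h3 | h3 | h3 | h3
    exacts [hp.ac h3.symm, h1.ow.pq.ne' h3, hp.ne_ad hG h3.symm, hp.bd h3.symm]
  refine hG.unique (y := z) (z := t) (x := w) ?_ hzt h1.zw.symm h2.zw h1.uz h2.uw h1'.uz h2'.uw
    h1.uw.ne h1'.uw.ne
  rintro rfl
  exact h2.ow.not_adj_of_ne hG h1.oz.xq h1.ow.pq.ne hp.bd h1.oz.zq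

end Seg

theorem exists_seg (hG : LocallyMoore G k 3) {a b c d z w t : V} (hz : Over G x a b z)
    (hw : Over G x b c w) (ht : Over G x c d t) (hzw : G.Adj z w) (hwt : G.Adj w t) :
    ∃ u, Seg G x a b c z w u ∧ Seg G x b c d w t u := by
  have hac : a ≠ c := by
    rintro rfl
    exact hz.not_adj_same hG hw.symm hzw
  have hbd : b ≠ d := by
    rintro rfl
    exact hw.not_adj_same hG ht.symm hwt
  have hp : LPath G x a b c d := ⟨hz.xp, hz.xq, hw.xq, ht.xq, hz.pq, hw.pq, ht.pq, hac, hbd⟩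
  have hzt : ¬ G.Adj z t := fun h => by
    rcases hz.meet hG ht h with h3 | h3 | h3 | h3
    exacts [hp.ac h3.symm, hw.pq.ne' h3, hp.ne_ad hG h3.symm, hp.bd h3.symm]
  have htb : ¬ G.Adj t b := ht.not_adj_of_ne hG hz.xq hw.pq.ne hbd
  have hzc : ¬ G.Adj z c := hz.not_adj_of_ne hG hw.xq hac.symm hw.pq.ne'
  obtain ⟨u, h1, h2, h3⟩ := hG.exists_of w z t hzw.symm hwt
    (fun h => htb (h ▸ hz.zq)) hzt
  exact ⟨u, ⟨hz, hw, hzw, h2, h1.symm, fun h => htb (h ▸ h3.symm)⟩,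
    ⟨hw, ht, hwt, h1.symm, h3, fun h => hzc (h ▸ h2.symm)⟩⟩

end LocallyMoore
end KoolenPark

/-! ### Walks around a vertex at distance three: pentagons or hexagons. -/

namespace KoolenPark
namespace LocallyMoore

variable {V : Type*} [Fintype V] [DecidableEq V] {G : SimpleGraph V} [DecidableRel G.Adj]
variable {k : ℕ} {x : V}

/-- Three consecutive segments with the same third vertex `u`. -/
structure Conf (G : SimpleGraph V) (x a b c d e z₀ z₁ z₂ z₃ u : V) : Prop where
  s₁ : Seg G x a b c z₀ z₁ u
  s₂ : Seg G x b c d z₁ z₂ u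
  s₃ : Seg G x c d e z₂ z₃ u

variable {a b c d e g z z' w t u z₀ z₁ z₂ z₃ z₄ : V}

theorem Seg.lpath (hG : LocallyMoore G k 3) (h : Seg G x a b c z w u) (h' : Seg G x b c d w t u) :
    LPath G x a b c d :=
  ⟨h.oz.xp, h.oz.xq, h.ow.xq, h'.ow.xq, h.oz.pq, h.ow.pq, h'.ow.pq, h.ne hG, h'.ne hG⟩

theorem Seg.not_adj_ends (hG : LocallyMoore G k 3) (h : Seg G x a b c z w u)
    (h' : Seg G x b c d w t u) : z ≠ t ∧ ¬ G.Adj z t := by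
  have hp := h.lpath hG h'
  refine ⟨?_, fun h1 => ?_⟩
  · rintro rfl
    exact h'.ow.not_adj_of_ne hG h.oz.xq h.ow.pq.ne hp.bd h.oz.zq
  · rcases h.oz.meet hG h'.ow h1 with h3 | h3 | h3 | h3
    exacts [hp.ac h3.symm, h.ow.pq.ne' h3, hp.ne_ad hG h3.symm, hp.bd h3.symm]

/-- The neighbours of `u` at distance two from `x` are determined by the edges below them. -/
theorem Over.eq_of_adj (hG : LocallyMoore G k 3) (h : Over G x a b z) (h' : Over G x a b z')
    (hz : G.Adj u z) (hz' : G.Adj u z') (hux : ¬ G.Adj x u) (hua : ¬ G.Adj u a) : z = z' := by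
  by_contra hne
  rcases hG.adj_of z z' u a hne (h.not_adj_same hG h') hz hz' h.zp.symm h'.zp.symm with rfl | h1
  exacts [hux h.xp, hua h1]

theorem Conf.symm (h : Conf G x a b c d e z₀ z₁ z₂ z₃ u) : Conf G x e d c b a z₃ z₂ z₁ z₀ u :=
  ⟨h.s₃.symm, h.s₂.symm, h.s₁.symm⟩

/-- Suppose the walk does not return to `a`. In the local graph of `u` the neighbours of `z₃` are
`z₂`, `z₄` and the vertex `y` closing `z₀ z₁ z₂ z₃` to a pentagon. The vertex `t` preceding `z₀` on
the walk is not adjacent to `z₃`, so it shares a neighbour with it, and each of the three choices is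
contradictory. -/
theorem Conf.next_eq (hG : LocallyMoore G k 3) (h : Conf G x a b c d e z₀ z₁ z₂ z₃ u)
    (h₄ : Seg G x d e g z₃ z₄ u) (hae : G.Adj a e) : g = a := by
  by_contra hga
  have p₁ := h.s₁.lpath hG h.s₂
  have p₂ := h.s₂.lpath hG h.s₃
  obtain ⟨w, t, hs⟩ := h.s₁.symm.step hG
  have hs := hs.symm
  have had : a ≠ d := p₁.ne_ad hG
  have had' : ¬ G.Adj a d := p₁.not_ad hG
  have hbe : b ≠ e := p₂.ne_ad hG
  have u03 : LPath G u z₀ z₁ z₂ z₃ := ⟨h.s₁.uz, h.s₁.uw, h.s₂.uw, h.s₃.uw, h.s₁.zw, h.s₂.zw,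
    h.s₃.zw, (h.s₁.not_adj_ends hG h.s₂).1, (h.s₂.not_adj_ends hG h.s₃).1⟩
  obtain ⟨y, y1, y2, y3⟩ := u03.close hG
  have h40 : ¬ G.Adj z₄ z₀ := fun h1 => by
    rcases h₄.ow.meet hG h.s₁.oz h1 with h2 | h2 | h2 | h2
    exacts [hae.ne h2, hga h2.symm, hbe h2, hG.no_triangle h.s₁.oz.xp h.s₁.oz.xq h₄.ow.xp
      h.s₁.oz.pq (h2 ▸ h₄.ow.pq.symm) hae]
  have hda : ¬ G.Adj d a := fun h1 => had' h1.symm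
  have htz3 : t ≠ z₃ := by
    rintro rfl
    rcases hs.oz.nbr hG h.s₃.ow.xp h.s₃.ow.zp with h2 | h2
    · exact hda (h2 ▸ hs.oz.pq)
    · exact had h2.symm
  have ht3 : ¬ G.Adj t z₃ := fun h1 => by
    rcases hs.oz.meet hG h.s₃.ow h1 with h2 | h2 | h2 | h2
    · exact hda (h2 ▸ hs.oz.pq)
    · exact had h2.symm
    · subst h2
      have h3 : Seg G x d e a z₃ t u := ⟨h.s₃.ow, hs.oz, h1.symm, h.s₃.uw, hs.uz, h₄.ub⟩
      exact hga (h₄.step_unique hG h3).1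
    · exact hae.ne h2.symm
  obtain ⟨s, q1, q2, q3⟩ := hG.exists_of u t z₃ hs.uz h.s₃.uw htz3 ht3
  have hz4y : z₄ ≠ y := fun h1 => h40 (h1 ▸ y3.symm)
  have hz2y : z₂ ≠ y := fun h1 => u03.not_ac hG (h1 ▸ y3)
  have hz24 := (h.s₃.not_adj_ends hG h₄).1
  rcases hG.eq_of_three h.s₃.uw h.s₃.uz h.s₃.zw.symm h₄.uw h₄.zw y1 y2 hz24 hz2y hz4y q1 q3.symm
    with rfl | rfl | rfl
  · have h1 : t = z₁ := hG.unique u03.ac (u03.not_ac hG) h.s₁.uz h.s₂.uw hs.zw q2.symm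
      h.s₁.zw.symm h.s₂.zw hs.uz.ne' h.s₁.uw.ne'
    subst h1
    exact h.s₂.oz.not_adj_of_ne hG hs.oz.xq h.s₁.oz.pq.ne p₁.ac hs.oz.zq
  · rcases hs.oz.meet hG h₄.ow q2.symm with h2 | h2 | h2 | h2
    · have h3 : u = e := hG.unique htz3 ht3 (x := s) q2 q3 hs.uz h.s₃.uw (h2 ▸ hs.oz.zp.symm)
        h.s₃.ow.zq.symm q1.ne h₄.ow.zp.ne'
      exact h₄.ub h3
    · exact hae.ne h2.symm
    · exact hG.no_triangle hs.oz.xq h₄.ow.xp h₄.ow.xq hae h₄.ow.pq (h2 ▸ hs.oz.pq.symm)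
    · exact hga h2
  · exact hG.noK4 _ _ _ _ hs.uz h.s₁.uz q1 hs.zw q2.symm y3

theorem Conf.adj_next_iff (hG : LocallyMoore G k 3) (h : Conf G x a b c d e z₀ z₁ z₂ z₃ u)
    (h₄ : Seg G x d e g z₃ z₄ u) : G.Adj a e ↔ G.Adj b g := by
  constructor
  · intro h1
    rw [h.next_eq hG h₄ h1]
    exact h.s₁.oz.pq.symm
  · intro h1
    have h2 : Conf G x g e d c b z₄ z₃ z₂ z₁ u := ⟨h₄.symm, h.s₃.symm, h.s₂.symm⟩
    rw [h2.next_eq hG h.s₁.symm h1.symm]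
    exact h₄.ow.pq.symm

/-- Closing up depends on `z₁` and `z₂` only, not on `u`. If `u ≠ u'`, then `a ≠ a'` and `e ≠ e'`,
so the neighbours of `d` are `c`, `e`, `e'`. The one adjacent to `a'` is neither `c` nor `e`,
because `e` and `b` would both be joined to `a` and `a'`. -/
theorem Conf.adj_imp (hG : LocallyMoore G k 3) {a' e' z₀' z₃' u' : V}
    (h : Conf G x a b c d e z₀ z₁ z₂ z₃ u)
    (h' : Conf G x a' b c d e' z₀' z₁ z₂ z₃' u') (hae : G.Adj a e) : G.Adj a' e' := by
  by_cases hu : u = u'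
  · subst hu
    rwa [← (h.s₁.symm.step_unique hG h'.s₁.symm).1, ← (h.s₃.step_unique hG h'.s₃).1]
  have ha : a ≠ a' := by
    rintro rfl
    have h1 : z₀ = z₀' := h.s₁.ow.step_unique hG (h.s₁.ne hG) h.s₁.oz.symm h.s₁.zw.symm
      h'.s₁.oz.symm h'.s₁.zw.symm
    subst h1
    exact hu (h.s₁.unique_u hG h.s₂ h'.s₁ h'.s₂)
  have he : e ≠ e' := by
    rintro rfl
    have h1 : z₃ = z₃' := h.s₃.oz.symm.step_unique hG (h.s₃.ne hG).symm h.s₃.ow h.s₃.zw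
      h'.s₃.ow h'.s₃.zw
    subst h1
    exact hu (h.s₃.symm.unique_u hG h.s₂.symm h'.s₃.symm h'.s₂.symm)
  have p₁ := h.s₁.lpath hG h.s₂
  have p₁' := h'.s₁.lpath hG h'.s₂
  have p₂ := h.s₂.lpath hG h.s₃
  have p₂' := h'.s₂.lpath hG h'.s₃
  obtain ⟨v, v1, v2, v3⟩ := p₁'.close hG
  rcases hG.eq_of_three p₁.xd p₁.xc p₁.cd.symm p₂.xd p₂.cd p₂'.xd p₂'.cd p₂.bd p₂'.bd he v1 v2
    with rfl | rfl | rfl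
  · exact absurd v3 (p₁'.not_ac hG)
  · exact absurd (hG.unique ha (hG.no_triangle p₁.xa p₁.xb p₁'.xa p₁.ab p₁'.ab.symm) p₁.xa p₁'.xa
      p₁.ab.symm p₁'.ab.symm hae.symm v3.symm p₁.xb.ne' v1.ne') (p₂.ne_ad hG)
  · exact v3

/-- The configurations around `z₁`, `z₂` close up to a pentagon. -/
def Closes (G : SimpleGraph V) (x b c d z₁ z₂ : V) : Prop :=
  ∃ a e z₀ z₃ u, Conf G x a b c d e z₀ z₁ z₂ z₃ u ∧ G.Adj a e

theorem Conf.closes_iff (hG : LocallyMoore G k 3) (h : Conf G x a b c d e z₀ z₁ z₂ z₃ u) :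
    Closes G x b c d z₁ z₂ ↔ G.Adj a e :=
  ⟨fun ⟨_, _, _, _, _, h1, h2⟩ => h1.adj_imp hG h h2, fun h1 => ⟨_, _, _, _, _, h, h1⟩⟩

theorem Closes.symm (h : Closes G x b c d z₁ z₂) : Closes G x d c b z₂ z₁ := by
  obtain ⟨a, e, z₀, z₃, u, h1, h2⟩ := h
  exact ⟨_, _, _, _, _, h1.symm, h2.symm⟩

/-- The three vertices `z₁`, `z₂`, `z₃` share a `u`; extending the walk around `u` at both ends
gives two overlapping configurations, compared by `Conf.adj_next_iff`. -/
theorem Closes.next (hG : LocallyMoore G k 3) (h : Closes G x b c d z₁ z₂) (h₁ : Over G x b c z₁)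
    (h₂ : Over G x c d z₂) (h₁₂ : G.Adj z₁ z₂) (h₃ : Over G x d e z₃) (h₂₃ : G.Adj z₂ z₃) :
    Closes G x c d e z₂ z₃ := by
  obtain ⟨u, s, s'⟩ := hG.exists_seg h₁ h₂ h₃ h₁₂ h₂₃
  obtain ⟨a, z₀, r⟩ := s.symm.step hG
  obtain ⟨g, z₄, r'⟩ := s'.step hG
  have hc : Conf G x a b c d e z₀ z₁ z₂ z₃ u := ⟨r.symm, s, s'⟩
  have hc' : Conf G x b c d e g z₁ z₂ z₃ z₄ u := ⟨s, s', r'⟩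
  rw [hc'.closes_iff hG, ← hc.adj_next_iff hG r', ← hc.closes_iff hG]
  exact h

theorem exists_nbr_ne (hG : LocallyMoore G k 3) (hb : G.Adj x b) (c : V) :
    ∃ a, G.Adj x a ∧ G.Adj b a ∧ a ≠ c := by
  obtain ⟨p, q, -, hpq, -, -, h1, h2, h3, h4, -⟩ := hG.three_cn hb
  by_cases h : p = c
  · exact ⟨q, h3, h4, fun h5 => hpq (h.trans h5.symm)⟩
  · exact ⟨p, h1, h2, h⟩

/-- Going one step back past `b` and then forward again allows a change of the branch taken at `c`.
-/
theorem Closes.turn (hG : LocallyMoore G k 3) (h : Closes G x b c d z₁ z₂) (h₁ : Over G x b c z₁)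
    (h₂ : Over G x c d z₂) (h₁₂ : G.Adj z₁ z₂) (h₃ : Over G x c e z₃) (h₂₃ : G.Adj z₁ z₃) :
    Closes G x b c e z₁ z₃ := by
  obtain ⟨a, ha, hba, hac⟩ := hG.exists_nbr_ne h₁.xp c
  obtain ⟨z₀, h4, h5⟩ := h₁.step hG ha hba hac
  have h6 := (h.symm.next hG h₂.symm h₁.symm h₁₂.symm h4 h5).symm
  exact h6.next hG h4.symm h₁ h5.symm h₃ h₂₃

/-- All configurations over a hexagon edge with end `z` close up. -/
def ClosesAt (G : SimpleGraph V) (x c z : V) : Prop :=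
  ∀ b d w, Over G x c b z → Over G x c d w → G.Adj z w → Closes G x b c d z w

theorem Closes.closesAt (hG : LocallyMoore G k 3) (h : Closes G x b c d z₁ z₂)
    (h₁ : Over G x b c z₁) (h₂ : Over G x c d z₂) (h₁₂ : G.Adj z₁ z₂) : ClosesAt G x c z₁ := by
  intro b' d' w hb hd hw
  have : b' = b := by
    rcases h₁.nbr hG hb.xq hb.zq with h2 | h2
    · exact h2
    · exact absurd h2.symm hb.pq.ne
  subst this
  exact h.turn hG h₁ h₂ h₁₂ hd hw

theorem ClosesAt.adj (hG : LocallyMoore G k 3) (h : ClosesAt G x c z) (hz : Over G x c b z)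
    (hw : Over G x c d w) (hzw : G.Adj z w) : ClosesAt G x c w :=
  (h b d w hz hw hzw).symm.closesAt hG hw.symm hz hzw.symm

theorem ClosesAt.hexagon_ne (hG : LocallyMoore G k 3) {f : V → V → ZMod 2} (hf : Side G x f)
    (h : ClosesAt G x c z) (hz : Over G x c b z) (hw : Over G x c d w) (hbd : b ≠ d) :
    ClosesAt G x c w := by
  by_cases hzw : G.Adj z w
  · exact h.adj hG hz hw hzw
  -- Nonadjacent `z` and `w` over different edges have the same colour, so the neighbour `v` of `z`
  -- over the third edge at `c` is adjacent to both.
  obtain ⟨r, hrb, hrd, hxr, hcr, -⟩ := hG.one_other hz.xp hz.xq hz.pq hw.xq hw.pq hbd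
  obtain ⟨v, hv, hzv⟩ := hz.step hG hxr hcr hrb
  refine (h.adj hG hz hv hzv).adj hG hv hw ((hf.adj _ _ _ _ _ hv hw hrd).2 ?_)
  have h1 := (hf.adj _ _ _ _ _ hz hv hrb.symm).1 hzv
  have h2 := (hf.adj _ _ _ _ _ hz hw hbd).not.1 hzw
  rw [h1, ← zmod_two_eq (Ne.symm h2)]

theorem ClosesAt.hexagon (hG : LocallyMoore G k 3) {f : V → V → ZMod 2} (hf : Side G x f)
    (h : ClosesAt G x c z) (hz : Over G x c b z) (hw : Over G x c d w) : ClosesAt G x c w := by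
  by_cases hbd : b = d
  · obtain ⟨r, hr, hcr, hrb⟩ := hG.exists_nbr_ne hz.xp b
    obtain ⟨v, hv, hzv⟩ := hz.step hG hr hcr hrb
    exact (h.adj hG hz hv hzv).hexagon_ne hG hf hv hw (hbd ▸ hrb)
  · exact h.hexagon_ne hG hf hz hw hbd

theorem ClosesAt.nbr (hG : LocallyMoore G k 3) {f : V → V → ZMod 2} (hf : Side G x f)
    (h : ClosesAt G x c z) (hz : Over G x c b z) (hd : G.Adj x d) (hcd : G.Adj c d)
    (hw : Over G x d e w) : ClosesAt G x d w := by
  obtain ⟨v, -, -, hv, -⟩ := hG.exists_pair hz.xp hd hcd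
  obtain ⟨r, hr, hcr, hrd⟩ := hG.exists_nbr_ne hz.xp d
  obtain ⟨s, hs, hds, hsc⟩ := hG.exists_nbr_ne hd c
  obtain ⟨v', hv', hvv'⟩ := hv.step hG hr hcr hrd
  obtain ⟨w', hw', hvw'⟩ := hv.symm.step hG hs hds hsc
  have h1 := (h.hexagon hG hf hz hv') r d v hv' hv hvv'.symm
  have h2 := h1.next hG hv'.symm hv hvv'.symm hw' hvw'
  exact (h2.closesAt hG hv hw' hvw').hexagon hG hf hv.symm hw

/-- Either all configurations at `x` close up to a pentagon, or none. -/
theorem conf_type (hG : LocallyMoore G k 3) {f : V → V → ZMod 2} (hf : Side G x f) :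
    (∀ a b c d e z₀ z₁ z₂ z₃ u, Conf G x a b c d e z₀ z₁ z₂ z₃ u → G.Adj a e) ∨
    (∀ a b c d e z₀ z₁ z₂ z₃ u, Conf G x a b c d e z₀ z₁ z₂ z₃ u → ¬ G.Adj a e) := by
  by_cases h : ∃ a b c d e z₀ z₁ z₂ z₃ u, Conf G x a b c d e z₀ z₁ z₂ z₃ u ∧ G.Adj a e
  · left
    obtain ⟨a, b, c, d, e, z₀, z₁, z₂, z₃, u, hc, hae⟩ := h
    have h1 : ClosesAt G x c z₁ :=
      ((hc.closes_iff hG).2 hae).closesAt hG hc.s₂.oz hc.s₂.ow hc.s₂.zw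
    intro a' b' c' d' e' z₀' z₁' z₂' z₃' u' hc'
    rw [← hc'.closes_iff hG]
    have ho := hc.s₂.oz.symm
    have ho' := hc'.s₂.oz.symm
    suffices ClosesAt G x c' z₁' from this _ _ _ ho' hc'.s₂.ow hc'.s₂.zw
    by_cases hcc : c = c'
    · subst hcc
      exact h1.hexagon hG hf ho ho'
    by_cases had : G.Adj c c'
    · exact h1.nbr hG hf ho ho'.xp had ho'
    · obtain ⟨m, hm, h2, h3⟩ := hG.exists_of x c c' ho.xp ho'.xp hcc had
      obtain ⟨v, -, -, hv, -⟩ := hG.exists_pair hm ho.xp h2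
      exact (h1.nbr hG hf ho hm h2.symm hv).nbr hG hf hv ho'.xp h3 ho'
  · right
    intro a b c d e z₀ z₁ z₂ z₃ u hc hae
    exact h ⟨_, _, _, _, _, _, _, _, _, _, hc, hae⟩

end LocallyMoore
end KoolenPark

/-! ### Normalising the hexagon colourings. -/

namespace KoolenPark
namespace LocallyMoore

variable {V : Type*} [Fintype V] [DecidableEq V] {G : SimpleGraph V} [DecidableRel G.Adj]
variable {k : ℕ} {x : V}
variable {a b c d e g z z' w t u z₀ z₁ z₂ z₃ z₄ : V}

/-- All configurations at `x` close up to a pentagon. -/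
def AllClose (G : SimpleGraph V) (x : V) : Prop :=
  ∀ a b c d e z₀ z₁ z₂ z₃ u, Conf G x a b c d e z₀ z₁ z₂ z₃ u → G.Adj a e

/-- No configuration at `x` closes up to a pentagon. -/
def NoneClose (G : SimpleGraph V) (x : V) : Prop :=
  ∀ a b c d e z₀ z₁ z₂ z₃ u, Conf G x a b c d e z₀ z₁ z₂ z₃ u → ¬ G.Adj a e

/-- A pentagon in the local graph of `x`. -/
structure Pent (G : SimpleGraph V) (x a b c d e : V) : Prop where
  path : LPath G x a b c d
  xe : G.Adj x e
  de : G.Adj d e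
  ea : G.Adj e a

theorem Pent.rot (hG : LocallyMoore G k 3) (h : Pent G x a b c d e) : Pent G x b c d e a := by
  refine ⟨⟨h.path.xb, h.path.xc, h.path.xd, h.xe, h.path.bc, h.path.cd, h.de, h.path.bd, ?_⟩,
    h.path.xa, h.ea, h.path.ab⟩
  rintro rfl
  exact h.path.not_ac hG h.ea.symm

theorem no_square (hG : LocallyMoore G k 3) (ha : G.Adj x a) (hb : G.Adj x b) (hc : G.Adj x c)
    (hd : G.Adj x d) (hab : G.Adj a b) (hbc : G.Adj b c) (had : G.Adj a d) (hdc : G.Adj d c)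
    (hac : a ≠ c) : b = d :=
  hG.unique hac (hG.no_triangle ha hb hc hab hbc) ha hc hab.symm hbc had.symm hdc hb.ne' hd.ne'

/-- If all configurations close up, the segment walk around a pentagon closes up. -/
theorem AllClose.walk (hG : LocallyMoore G k 3) (hx : AllClose G x) (hp : Pent G x a b c d e)
    (s₁ : Seg G x a b c z₀ z₁ u) (s₂ : Seg G x b c d z₁ z₂ u) :
    ∃ z₃ z₄, Seg G x c d e z₂ z₃ u ∧ Seg G x d e a z₃ z₄ u ∧ Seg G x e a b z₄ z₀ u := by
  obtain ⟨e', z₃, s₃⟩ := s₂.step hG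
  have h₁ : Conf G x a b c d e' z₀ z₁ z₂ z₃ u := ⟨s₁, s₂, s₃⟩
  have hae := hx _ _ _ _ _ _ _ _ _ _ h₁
  obtain rfl : e' = e := hG.no_square hp.path.xa s₃.ow.xq hp.path.xd hp.xe hae s₃.ow.pq.symm
    hp.ea.symm hp.de.symm (hp.path.ne_ad hG)
  obtain ⟨g, z₄, s₄⟩ := s₃.step hG
  obtain rfl := h₁.next_eq hG s₄ hae
  have h₂ : Conf G x b c d e' g z₁ z₂ z₃ z₄ u := ⟨s₂, s₃, s₄⟩
  obtain ⟨g', z₅, s₅⟩ := s₄.step hG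
  obtain rfl := h₂.next_eq hG s₅ hp.path.ab.symm
  -- After five steps the walk is again over `ab`, and `u` has only one neighbour there.
  obtain rfl := s₁.oz.eq_of_adj hG s₅.ow s₁.uz s₅.uw (s₁.not_x hG) (s₁.not_a hG)
  exact ⟨_, _, s₃, s₄, s₅⟩

/-- Evaluate `A` on the five vertices of a walk around `u` and regroup by vertices of the pentagon.
At each of them the two consecutive vertices of the walk have different colours, so the sum is 5 =
1. -/
theorem AllClose.sum (hG : LocallyMoore G k 3) {f : V → V → ZMod 2} (hf : Side G x f)
    {A : V → V → ZMod 2} (hA : ∀ p q z, Over G x p q z → A p q = f p z + f q z)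
    (hx : AllClose G x) (hp : Pent G x a b c d e) :
    A a b + A b c + A c d + A d e + A e a = 1 := by
  obtain ⟨z₀, -, -, hz₀, -⟩ := hG.exists_pair hp.path.xa hp.path.xb hp.path.ab
  obtain ⟨z₁, hz₁, h₀₁⟩ := hz₀.symm.step hG hp.path.xc hp.path.bc hp.path.ac.symm
  obtain ⟨z₂, hz₂, h₁₂⟩ := hz₁.symm.step hG hp.path.xd hp.path.cd hp.path.bd.symm
  obtain ⟨u, s₁, s₂⟩ := hG.exists_seg hz₀ hz₁ hz₂ h₀₁ h₁₂
  obtain ⟨z₃, z₄, s₃, s₄, s₅⟩ := hx.walk hG hp s₁ s₂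
  have key : ∀ {p q r z w}, Seg G x p q r z w u → f q w = f q z + 1 := fun h =>
    (hf.adj _ _ _ _ _ h.oz.symm h.ow (h.ne hG)).1 h.zw
  rw [hA _ _ _ s₁.oz, hA _ _ _ s₂.oz, hA _ _ _ s₃.oz, hA _ _ _ s₄.oz, hA _ _ _ s₅.oz, key s₁,
    key s₂, key s₃, key s₄, key s₅]
  have : ∀ a b c d e : ZMod 2, e + 1 + a + (a + 1 + b) + (b + 1 + c) + (c + 1 + d) +
      (d + 1 + e) = 1 := by
    decide
  exact this _ _ _ _ _

/-- Since the continuation is not adjacent to `a`, it is the unique neighbour of `d` described in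
`LPath.open_unique`. -/
theorem NoneClose.walk (hG : LocallyMoore G k 3) (hx : NoneClose G x) (h₁ : Seg G x a b c z₀ z₁ u)
    (h₂ : Seg G x b c d z₁ z₂ u) (he : G.Adj x e) (hde : G.Adj d e) (hec : e ≠ c)
    (hae : ¬ G.Adj a e) : ∃ z₃, Seg G x c d e z₂ z₃ u := by
  obtain ⟨e', z₃, h₃⟩ := h₂.step hG
  have h4 : ¬ G.Adj a e' := hx _ _ _ _ _ _ _ _ _ _ ⟨h₁, h₂, h₃⟩
  rw [(h₁.lpath hG h₂).open_unique hG he hde hec hae h₃.ow.xq h₃.ow.pq (h₃.ne hG).symm h4]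
  exact ⟨z₃, h₃⟩

/-- Let `p` be the third neighbour of `a`, `z₀` a vertex over `ap`, and `s₁`, `s₂` its neighbours
over `ab` and `ae`. A walk around `u` leads from `z₀` through `s₁` along `a b c d`, one around `t`
from `z₀` through `s₂` along `a e d c`. As `t` is the third common neighbour of `z₀` and `u`, it
sees the vertex `z₃` over `cd` too, so both walks end there. The colour changes once at each of `b,
c, d, e`; at `a` it does not change, because `s₁` and `s₂` both differ from `z₀`. The sum is 4 = 0.
-/
theorem NoneClose.sum (hG : LocallyMoore G k 3) {f : V → V → ZMod 2} (hf : Side G x f)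
    {A : V → V → ZMod 2} (hA : ∀ p q z, Over G x p q z → A p q = f p z + f q z)
    (hx : NoneClose G x) (hp : Pent G x a b c d e) :
    A a b + A b c + A c d + A d e + A e a = 0 := by
  have ha := hp.path.xa
  have hb := hp.path.xb
  have hc := hp.path.xc
  have hd := hp.path.xd
  have he := hp.xe
  have hab := hp.path.ab
  have hbc := hp.path.bc
  have hcd := hp.path.cd
  have hde := hp.de
  have hea := hp.ea
  have hac := hp.path.ac
  have hbd := hp.path.bd
  have had := hp.path.ne_ad hG
  have hbe : b ≠ e := (hp.rot hG).path.ne_ad hG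
  have hce : c ≠ e := ((hp.rot hG).rot hG).path.ac
  obtain ⟨p, hpb, hpe, hp0, hap, -⟩ := hG.one_other ha hb hab he hea.symm hbe
  have npd : ¬ G.Adj p d := fun h => hpe (hG.no_square ha hp0 hd he hap h hea.symm hde.symm had)
  have npc : ¬ G.Adj p c := fun h => hpb (hG.no_square ha hp0 hc hb hap h hab hbc hac)
  have hpd : p ≠ d := by
    rintro rfl
    exact hp.path.not_ad hG hap
  have hpc : p ≠ c := by
    rintro rfl
    exact hp.path.not_ac hG hap
  obtain ⟨p₁, hp₁, h1, h2⟩ := hG.exists_of x p d hp0 hd hpd npd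
  have hp₁a : p₁ ≠ a := by
    rintro rfl
    exact hp.path.not_ad hG h2
  have hp₁c : p₁ ≠ c := fun h => npc (h ▸ h1.symm)
  have hp₁e : p₁ ≠ e := fun h => hG.no_triangle hp0 ha he hap.symm hea.symm (h ▸ h1.symm)
  obtain ⟨z₀, -, -, hz₀, -⟩ := hG.exists_pair ha hp0 hap
  obtain ⟨s₁, hs₁, k1⟩ := hz₀.step hG hb hab hpb.symm
  obtain ⟨s₂, hs₂, k2⟩ := hz₀.step hG he hea.symm hpe.symm
  obtain ⟨r₁, hr₁, k3⟩ := hz₀.symm.step hG hp₁ h1.symm hp₁a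
  obtain ⟨u, g₁, g₂⟩ := hG.exists_seg hr₁.symm hz₀.symm hs₁ k3.symm k1
  obtain ⟨y, g₃⟩ := hx.walk hG g₁ g₂ hc hbc hac.symm
    (hG.no_triangle hp₁ hd hc h2 hcd.symm)
  obtain ⟨z₃, g₄⟩ := hx.walk hG g₂ g₃ hd hcd hbd.symm npd
  have hs₁₂ : s₁ ≠ s₂ := fun h => hs₂.not_adj_of_ne hG hb hab.ne' hbe (h ▸ hs₁.zq)
  have ns₁₂ : ¬ G.Adj s₁ s₂ := fun h => hG.noK4 _ _ _ _ hz₀.zp k1 k2 hs₁.zp.symm hs₂.zp.symm h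
  have hr₁s₁ : r₁ ≠ s₁ := (g₁.not_adj_ends hG g₂).1
  obtain ⟨t, ht₁, ht₂, hzt, hut, hall⟩ := hG.one_other g₁.uw.symm k3 g₁.uz k1 g₂.uw hr₁s₁
  have hus₂ : ¬ G.Adj u s₂ := fun h => by
    rcases hG.adj_of s₁ s₂ u a hs₁₂ ns₁₂ g₂.uw h hs₁.zp.symm hs₂.zp.symm with rfl | h3
    exacts [g₂.ub rfl, g₂.not_b hG h3]
  have hus₂' : s₂ ≠ u := fun h => g₂.not_b hG (h ▸ hs₂.zp)
  have hts₂ : G.Adj t s₂ := by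
    obtain ⟨v, v1, v2, v3⟩ := hG.exists_of z₀ s₂ u k2 g₁.uw.symm hus₂' fun h => hus₂ h.symm
    rcases hall v v1 v3.symm with rfl | rfl | rfl
    · rcases hr₁.meet hG hs₂ v2 with h3 | h3 | h3 | h3
      exacts [absurd h3 hap.ne, absurd h3 hp₁a.symm, absurd h3 hpe.symm, absurd h3 hp₁e.symm]
    · exact absurd v2 ns₁₂
    · exact v2
  have uz : LPath G u z₀ s₁ y z₃ := ⟨g₂.uz, g₂.uw, g₃.uw, g₄.uw, g₂.zw, g₃.zw, g₄.zw,
    (g₂.not_adj_ends hG g₃).1, (g₃.not_adj_ends hG g₄).1⟩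
  have htz₃ : G.Adj t z₃ := by
    obtain ⟨v, v1, v2, v3⟩ := uz.close hG
    rcases hall v v3 v1 with rfl | rfl | rfl
    · rcases hr₁.meet hG g₄.ow v2.symm with h3 | h3 | h3 | h3
      exacts [absurd h3 hpc.symm, absurd h3 hp₁c.symm, absurd h3 hpd.symm, absurd h3 h2.ne']
    · exact absurd v2.symm (uz.not_bd hG)
    · exact v2.symm
  have hta : t ≠ a := by
    rintro rfl
    exact g₂.not_b hG hut
  have f₁ : Seg G x p a e z₀ s₂ t := ⟨hz₀.symm, hs₂, k2, hzt.symm, hts₂, hta⟩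
  obtain ⟨w, r', f₀⟩ := f₁.symm.step hG
  have hwp₁ : w ≠ p₁ := by
    rintro rfl
    obtain rfl := hz₀.symm.step_unique hG hp₁a f₀.ow f₀.zw hr₁ k3
    exact hG.noK4 _ _ _ _ hzt g₁.uw.symm k3 hut.symm f₀.uw g₁.uz
  obtain ⟨q, f₂⟩ := hx.walk hG f₀.symm f₁ hd hde.symm had.symm
    fun h => hwp₁ (hG.no_square hp0 f₀.ow.xq hd hp₁ f₀.ow.pq h h1.symm h2 hpd)
  obtain ⟨z₃', f₃⟩ := hx.walk hG f₁ f₂ hc hcd.symm hce npc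
  obtain rfl := g₄.ow.symm.eq_of_adj hG f₃.ow htz₃ f₃.uw (f₃.not_x hG) (f₃.not_b hG)
  have key : ∀ {p q r z w u}, Seg G x p q r z w u → f q w = f q z + 1 := fun h =>
    (hf.adj _ _ _ _ _ h.oz.symm h.ow (h.ne hG)).1 h.zw
  rw [hA _ _ _ hs₁, hA _ _ _ g₃.ow, hA _ _ _ g₄.ow, hA _ _ _ f₂.ow.symm, hA _ _ _ hs₂.symm,
    key g₂, key g₃, key g₄, key f₁, key f₂, key f₃]
  have : ∀ a b c d e : ZMod 2, a + 1 + b + (b + 1 + c) + (c + 1 + (d + 1)) + (d + (e + 1)) +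
      (e + (a + 1)) = 0 := by
    decide
  exact this _ _ _ _ _

/-- A symmetric function on the edges of the local graph with zero sum around every pentagon is a
coboundary. -/
theorem exists_potential (hG : LocallyMoore G k 3) {A : V → V → ZMod 2}
    (hs : ∀ p q, A p q = A q p)
    (hA : ∀ a b c d e, Pent G x a b c d e → A a b + A b c + A c d + A d e + A e a = 0) :
    ∃ κ : V → ZMod 2, ∀ p q, G.Adj x p → G.Adj x q → G.Adj p q → A p q = κ p + κ q := by
  by_cases hx : ∃ o, G.Adj x o
  swap
  · exact ⟨0, fun p q hp => (hx ⟨p, hp⟩).elim⟩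
  obtain ⟨o, ho⟩ := hx
  have hmid : ∀ p, ∃ m, G.Adj x p → p ≠ o → ¬ G.Adj o p → G.Adj x m ∧ G.Adj o m ∧ G.Adj m p := by
    intro p
    by_cases h : G.Adj x p ∧ p ≠ o ∧ ¬ G.Adj o p
    · obtain ⟨m, h1, h2, h3⟩ := hG.exists_of x o p ho h.1 h.2.1.symm h.2.2
      exact ⟨m, fun _ _ _ => ⟨h1, h2.symm, h3⟩⟩
    · exact ⟨p, fun h1 h2 h3 => (h ⟨h1, h2, h3⟩).elim⟩
  choose m hm using hmid
  -- Integration of `A` from `o` along a breadth-first spanning tree. An edge between two vertices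
  -- at distance two from `o` completes tree paths to a pentagon, where the hypothesis applies.
  set κ : V → ZMod 2 := fun p =>
    if p = o then 0 else if G.Adj o p then A o p else A o (m p) + A (m p) p with hκ
  have ko : κ o = 0 := by simp [hκ]
  have ka : ∀ p, G.Adj o p → κ p = A o p := fun p h => by simp [hκ, h.ne', h]
  have kn : ∀ p, p ≠ o → ¬ G.Adj o p → κ p = A o (m p) + A (m p) p := fun p h h' => by
    simp [hκ, h, h']
  have two : ∀ a b : ZMod 2, a + (b + a) = b := by decide
  have five : ∀ a b c d e : ZMod 2, a + b + c + d + e = 0 → c = a + b + (e + d) := by decide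
  have near : ∀ p q, G.Adj x p → G.Adj x q → G.Adj p q → G.Adj o p → q ≠ o →
      A p q = κ p + κ q := by
    intro p q hp hq hpq hop hqo
    have h1 := hG.no_triangle ho hp hq hop hpq
    obtain ⟨h2, h3, h4⟩ := hm q hq hqo h1
    rw [ka p hop, kn q hqo h1, ← hG.no_square ho hp hq h2 hop hpq h3 h4 hqo.symm, ← add_assoc,
      CharTwo.add_self_eq_zero, zero_add]
  refine ⟨κ, fun p q hp hq hpq => ?_⟩
  by_cases hpo : p = o
  · subst hpo
    rw [ko, ka q hpq, zero_add]
  by_cases hqo : q = o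
  · subst hqo
    rw [ko, ka p hpq.symm, add_zero, hs]
  by_cases hop : G.Adj o p
  · exact near p q hp hq hpq hop hqo
  by_cases hoq : G.Adj o q
  · rw [hs, near q p hq hp hpq.symm hoq hpo, add_comm]
  obtain ⟨h1, h2, h3⟩ := hm p hp hpo hop
  obtain ⟨h4, h5, h6⟩ := hm q hq hqo hoq
  have h7 := hA o (m p) p q (m q) ⟨⟨ho, h1, hp, hq, h2, h3, hpq, Ne.symm hpo, fun h => hoq (h ▸ h2)⟩,
    h4, h6.symm, h5.symm⟩
  rw [kn p hpo hop, kn q hqo hoq, five _ _ _ _ _ h7, hs q, hs (m q) o]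

/-- Exchanging the two vertices over `pq` changes both colours, hence not their sum. -/
theorem exists_edgeSum {f : V → V → ZMod 2} (hf : Side G x f) :
    ∃ A : V → V → ZMod 2, (∀ p q, A p q = A q p) ∧ ∀ p q z, Over G x p q z →
      A p q = f p z + f q z := by
  classical
  have h : ∀ p q, ∃ c : ZMod 2, ∀ z, Over G x p q z ∨ Over G x q p z → c = f p z + f q z := by
    intro p q
    by_cases h : ∃ z, Over G x p q z
    · obtain ⟨z, hz⟩ := h
      refine ⟨f p z + f q z, fun z' h' => ?_⟩
      have h' : Over G x p q z' := h'.elim id Over.symm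
      by_cases hne : z = z'
      · rw [hne]
      · rw [hf.same _ _ _ _ hz h' hne, hf.same _ _ _ _ hz.symm h'.symm hne]
        have : ∀ a b : ZMod 2, a + b = a + 1 + (b + 1) := by decide
        exact this _ _
    · exact ⟨0, fun z' h' => (h ⟨z', h'.elim id Over.symm⟩).elim⟩
  choose A hA using h
  refine ⟨fun p q => if ∃ z, Over G x p q z then A p q else 0, fun p q => ?_, fun p q z hz => ?_⟩
  · beta_reduce
    by_cases h : ∃ z, Over G x p q z
    · obtain ⟨z, hz⟩ := h
      rw [if_pos ⟨z, hz⟩, if_pos ⟨z, hz.symm⟩, hA p q z (Or.inl hz), hA q p z (Or.inr hz), add_comm]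
    · rw [if_neg h, if_neg]
      rintro ⟨z, hz⟩
      exact h ⟨z, hz.symm⟩
  · beta_reduce
    rw [if_pos ⟨z, hz⟩]
    exact hA p q z (Or.inl hz)

theorem Side.gauge {f : V → V → ZMod 2} (hf : Side G x f) (κ : V → ZMod 2) :
    Side G x fun p z => f p z + κ p := by
  refine ⟨fun p q z z' h h' hne => ?_, fun p q r z w h h' hne => ?_⟩
  · simp only [hf.same p q z z' h h' hne]
    ring
  · rw [hf.adj p q r z w h h' hne, add_right_comm, add_left_inj]

/-- A pentagon has an odd number of edges, so adding the constant κ to `A` changes its pentagon sums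
by κ. Hence κ = 1 and κ = 0 make them vanish in the two cases, and the potential then recolours the
hexagons consistently. -/
theorem exists_gauge (hG : LocallyMoore G k 3) (x : V) : ∃ (κ : ZMod 2) (f : V → V → ZMod 2),
    Side G x f ∧ (∀ p q z, Over G x p q z → f q z = f p z + κ) ∧
      ((κ = 1 ∧ AllClose G x) ∨ (κ = 0 ∧ NoneClose G x)) := by
  obtain ⟨f, hf⟩ := hG.exists_side x
  obtain ⟨A, hs, hA⟩ := exists_edgeSum hf
  suffices ∃ κ : ZMod 2, (∀ a b c d e, Pent G x a b c d e →
      (A a b + κ) + (A b c + κ) + (A c d + κ) + (A d e + κ) + (A e a + κ) = 0) ∧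
      ((κ = 1 ∧ AllClose G x) ∨ (κ = 0 ∧ NoneClose G x)) by
    obtain ⟨κ, h1, h2⟩ := this
    obtain ⟨ψ, hψ⟩ := hG.exists_potential (A := fun p q => A p q + κ) (fun p q => by rw [hs]) h1
    refine ⟨κ, _, hf.gauge ψ, fun p q z hz => ?_, h2⟩
    have h3 := hψ p q hz.xp hz.xq hz.pq
    simp only [hA p q z hz] at h3
    have : ∀ a b c d e : ZMod 2, a + b + c = d + e → b + e = a + d + c := by decide
    exact this _ _ _ _ _ h3
  rcases hG.conf_type hf with h | h
  · refine ⟨1, fun a b c d e hp => ?_, Or.inl ⟨rfl, h⟩⟩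
    have h1 := AllClose.sum hG hf hA h hp
    have : ∀ a b c d e : ZMod 2, a + b + c + d + e = 1 →
      a + 1 + (b + 1) + (c + 1) + (d + 1) + (e + 1) = 0 := by decide
    exact this _ _ _ _ _ h1
  · refine ⟨0, fun a b c d e hp => ?_, Or.inr ⟨rfl, h⟩⟩
    simpa using NoneClose.sum hG hf hA h hp

end LocallyMoore
end KoolenPark

/-! ### Coordinates for the vertices at distances two and three. -/

namespace KoolenPark
namespace LocallyMoore

variable {V : Type*} [Fintype V] [DecidableEq V] {G : SimpleGraph V} [DecidableRel G.Adj]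
variable {k : ℕ} {x : V}
variable {a b c d e g z z' w t u z₀ z₁ z₂ z₃ z₄ p q r : V}

/-- Coordinates for the vertices at distance two and three from `x`: `Z p q i` for `i : Bool` are
the two vertices over the edge `pq` of the local graph of `x`, and `U a b c d i` is the vertex at
distance three whose neighbours include `Z a b i`, `Z c d i` and a vertex over `bc`. -/
structure Frame (G : SimpleGraph V) (x : V) (κ : Bool) (Z : V → V → Bool → V)
    (U : V → V → V → V → Bool → V) : Prop where
  isOver : ∀ {p q}, G.Adj x p → G.Adj x q → G.Adj p q → ∀ i, Over G x p q (Z p q i)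
  swap : ∀ {p q}, G.Adj x p → G.Adj x q → G.Adj p q → ∀ i, Z q p (i ^^ κ) = Z p q i
  adj : ∀ {p q r}, G.Adj x p → G.Adj x q → G.Adj x r → G.Adj p q → G.Adj p r → q ≠ r →
    ∀ i, G.Adj (Z p q i) (Z p r !i)
  eq : ∀ {p q r w}, G.Adj x p → G.Adj x q → G.Adj p q → Over G x p r w → q ≠ r →
    ∀ i, G.Adj (Z p q i) w → w = Z p r !i
  seg : ∀ {a b c d}, LPath G x a b c d → ∀ i,
    Seg G x a b c (Z a b i) (Z b c (i ^^ !κ)) (U a b c d i) ∧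
    Seg G x b c d (Z b c (i ^^ !κ)) (Z c d i) (U a b c d i)
  kind : (κ = true ∧ AllClose G x) ∨ (κ = false ∧ NoneClose G x)

theorem exists_frame (hG : LocallyMoore G k 3) (x : V) : ∃ κ Z U, Frame G x κ Z U := by
  obtain ⟨κ, f, hf, hκ, ht⟩ := hG.exists_gauge x
  let β : Bool → ZMod 2 := fun i => bif i then 1 else 0
  obtain ⟨k', hk'⟩ : ∃ k', β k' = κ := by
    rcases ht with h | h
    · exact ⟨true, h.1.symm⟩
    · exact ⟨false, h.1.symm⟩
  have βx : ∀ i j, β (i ^^ j) = β i + β j := by decide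
  have βn : ∀ i, β (!i) = β i + 1 := by decide
  have hZ : ∀ p q i, ∃ z, G.Adj x p → G.Adj x q → G.Adj p q → Over G x p q z ∧ f p z = β i := by
    intro p q i
    by_cases h : G.Adj x p ∧ G.Adj x q ∧ G.Adj p q
    · obtain ⟨z, z', hne, hz, hz', -⟩ := hG.exists_pair h.1 h.2.1 h.2.2
      by_cases h1 : f p z = β i
      · exact ⟨z, fun _ _ _ => ⟨hz, h1⟩⟩
      · exact ⟨z', fun _ _ _ => ⟨hz', by rw [hf.same _ _ _ _ hz hz' hne, ← zmod_two_eq h1]⟩⟩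
    · exact ⟨p, fun h1 h2 h3 => (h ⟨h1, h2, h3⟩).elim⟩
  choose Z hZ using hZ
  have heq : ∀ p q i z, Over G x p q z → f p z = β i → z = Z p q i := by
    intro p q i z hz h1
    have h2 := hZ p q i hz.xp hz.xq hz.pq
    by_contra hne
    have h3 := hf.same _ _ _ _ hz h2.1 hne
    rw [h1, h2.2] at h3
    exact zmod_two_ne _ h3.symm
  have hsw : ∀ p q, G.Adj x p → G.Adj x q → G.Adj p q → ∀ i, Z q p (i ^^ k') = Z p q i := by
    intro p q hp hq hpq i
    obtain ⟨h1, h2⟩ := hZ p q i hp hq hpq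
    refine (heq _ _ _ _ h1.symm ?_).symm
    rw [hκ _ _ _ h1, h2, βx, hk']
  have hadj : ∀ p q r, G.Adj x p → G.Adj x q → G.Adj x r → G.Adj p q → G.Adj p r → q ≠ r →
      ∀ i, G.Adj (Z p q i) (Z p r !i) := by
    intro p q r hp hq hr hpq hpr hqr i
    obtain ⟨h1, h2⟩ := hZ p q i hp hq hpq
    obtain ⟨h3, h4⟩ := hZ p r (!i) hp hr hpr
    rw [hf.adj _ _ _ _ _ h1 h3 hqr, h2, h4, βn]
  have hU : ∀ a b c d i, ∃ u, LPath G x a b c d →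
      Seg G x a b c (Z a b i) (Z b c (i ^^ !k')) u ∧
      Seg G x b c d (Z b c (i ^^ !k')) (Z c d i) u := by
    intro a b c d i
    by_cases h : LPath G x a b c d
    · have h1 : G.Adj (Z a b i) (Z b c (i ^^ !k')) := by
        rw [← hsw a b h.xa h.xb h.ab, Bool.xor_not]
        exact hadj b a c h.xb h.xa h.xc h.ab.symm h.bc h.ac _
      have h2 : G.Adj (Z b c (i ^^ !k')) (Z c d i) := by
        have h3 := hadj c b d h.xc h.xb h.xd h.bc.symm h.cd h.bd !i
        rw [← hsw b c h.xb h.xc h.bc, Bool.xor_assoc, show ((!k') ^^ k') = true by simp,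
          Bool.xor_true]
        rwa [Bool.not_not] at h3
      obtain ⟨u, h3⟩ := hG.exists_seg (hZ _ _ _ h.xa h.xb h.ab).1 (hZ _ _ _ h.xb h.xc h.bc).1
        (hZ _ _ _ h.xc h.xd h.cd).1 h1 h2
      exact ⟨u, fun _ => h3⟩
    · exact ⟨a, fun h' => (h h').elim⟩
  choose U hU using hU
  refine ⟨k', Z, U, fun hp hq hpq i => (hZ _ _ i hp hq hpq).1, fun hp hq hpq => hsw _ _ hp hq hpq,
    fun hp hq hr hpq hpr hqr => hadj _ _ _ hp hq hr hpq hpr hqr, ?_, fun h i => hU _ _ _ _ i h, ?_⟩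
  · intro p q r w hp hq hpq hw hqr i h
    obtain ⟨h1, h2⟩ := hZ p q i hp hq hpq
    refine heq _ _ _ _ hw ?_
    rw [(hf.adj _ _ _ _ _ h1 hw hqr).1 h, h2, βn]
  · have : ∀ i, (β i = 1 → i = true) ∧ (β i = 0 → i = false) := by decide
    rcases ht with h | h
    · exact Or.inl ⟨(this _).1 (hk'.trans h.1), h.2⟩
    · exact Or.inr ⟨(this _).2 (hk'.trans h.1), h.2⟩

namespace Frame

variable {κ : Bool} {Z : V → V → Bool → V} {U : V → V → V → V → Bool → V} {i : Bool}
  {a' d' : V}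

/-- Reversing the edge from `ab` to `ba` adds κ to the bit, and the step along the hexagon at `b`
negates it. -/
theorem next_eq (hG : LocallyMoore G k 3) (F : Frame G x κ Z U) (h : Seg G x a b c (Z a b i) w u) :
    w = Z b c (i ^^ !κ) := by
  have h1 := h.zw
  rw [← F.swap h.oz.xp h.oz.xq h.oz.pq] at h1
  rw [F.eq h.oz.xq h.oz.xp h.oz.pq.symm h.ow (h.ne hG) _ h1, Bool.xor_not]

theorem eq_U (hG : LocallyMoore G k 3) (F : Frame G x κ Z U) (h : Seg G x a b c (Z a b i) w u)
    (h' : Seg G x b c d w t u) : u = U a b c d i := by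
  obtain rfl := F.next_eq hG h
  obtain rfl := F.next_eq hG h'
  obtain ⟨h1, h2⟩ := F.seg (h.lpath hG h') i
  rw [Bool.xor_assoc, Bool.xor_self, Bool.xor_false] at h'
  exact h.unique_u hG h' h1 h2

/-- Moving one step along the walk around the same vertex gives another name for it; this and the
next two lemmas give the coincidences among the names `U`. -/
theorem rot_of_pent (hG : LocallyMoore G k 3) (F : Frame G x κ Z U) (hκ : κ = true)
    (h : Pent G x a b c d e) : U a b c d i = U b c d e (i ^^ !κ) := by
  obtain ⟨h1, h2⟩ := F.seg h.path i
  have hx : AllClose G x := by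
    rcases F.kind with h3 | h3
    · exact h3.2
    · rw [h3.1] at hκ
      exact absurd hκ (by decide)
  obtain ⟨z₃, z₄, h3, -⟩ := hx.walk hG h h1 h2
  exact F.eq_U hG h2 h3

theorem rot_of_not_adj (hG : LocallyMoore G k 3) (F : Frame G x κ Z U) (hκ : κ = false)
    (h : LPath G x a b c d) (he : G.Adj x e) (hde : G.Adj d e) (hec : e ≠ c)
    (hae : ¬ G.Adj a e) : U a b c d i = U b c d e (i ^^ !κ) := by
  obtain ⟨h1, h2⟩ := F.seg h i
  have hx : NoneClose G x := by
    rcases F.kind with h3 | h3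
    · rw [h3.1] at hκ
      exact absurd hκ (by decide)
    · exact h3.2
  obtain ⟨z₃, h3⟩ := hx.walk hG h1 h2 he hde hec hae
  exact F.eq_U hG h2 h3

theorem reverse (hG : LocallyMoore G k 3) (F : Frame G x κ Z U) (h : LPath G x a b c d) :
    U a b c d i = U d c b a (i ^^ κ) := by
  obtain ⟨h1, h2⟩ := F.seg h i
  rw [← F.swap h.xc h.xd h.cd] at h2
  exact F.eq_U hG h2.symm h1.symm

theorem adj_U (hG : LocallyMoore G k 3) (F : Frame G x κ Z U) (h : LPath G x a b c d)
    (h' : LPath G x a' b c d') (ha : a ≠ a') (hd : d ≠ d') :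
    G.Adj (U a b c d i) (U a' b c d' i) := by
  obtain ⟨h1, h2⟩ := F.seg h i
  obtain ⟨h1', h2'⟩ := F.seg h' i
  set u := U a b c d i
  -- The third common neighbour `w` of `u` and the middle vertex turns out to be adjacent to `Z a' b
  -- i` and `Z c d' i`, so it is the other vertex `U a' b c d' i`.
  obtain ⟨w, hwr, hws, hzw, huw, hall⟩ := hG.one_other h1.uw.symm h1.zw.symm h1.uz h2.zw h2.uw
    (h1.not_adj_ends hG h2).1
  have hub := h1.ub
  have hnb := h1.not_b hG
  have hnc := h1.not_c hG
  have huc : u ≠ c := h2.ub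
  have hr : G.Adj w (Z a' b i) := by
    have hne : Z a b i ≠ Z a' b i := fun h3 => h1.oz.not_adj_of_ne hG h1'.oz.xp ha.symm
      h1'.oz.pq.ne (h3 ▸ h1'.oz.zp)
    have hna : ¬ G.Adj (Z a b i) (Z a' b i) := fun h3 => hG.noK4 _ _ _ _ h1.ow.zp
      h1.zw.symm h1'.zw.symm h1.oz.zq.symm h1'.oz.zq.symm h3
    have hua : ¬ G.Adj (Z a' b i) u := fun h3 => by
      rcases hG.adj_of _ _ u b hne hna h1.uz h3.symm h1.oz.zq.symm h1'.oz.zq.symm with h4 | h4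
      exacts [hub h4, hnb h4]
    have hne' : Z a' b i ≠ u := fun h3 => hnb (h3 ▸ h1'.oz.zq)
    obtain ⟨v, v1, v2, v3⟩ := hG.exists_of _ _ _ h1'.zw.symm h1.uw.symm hne' hua
    rcases hall v v1 v3.symm with rfl | rfl | rfl
    · exact absurd v2 hna
    · rcases h2.ow.meet hG h1'.oz v2 with h4 | h4 | h4 | h4
      exacts [absurd h4 h'.ac, absurd h4 fun h5 => hG.no_triangle h.xb h.xc h.xd h.bc h.cd
        (h5 ▸ h'.ab.symm), absurd h4 h.bc.ne, absurd h4 h.bd]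
    · exact v2
  have hs : G.Adj w (Z c d' i) := by
    have hne : Z c d i ≠ Z c d' i := fun h3 => h2.ow.not_adj_of_ne hG h2'.ow.xq
      h2'.ow.pq.ne' hd.symm (h3 ▸ h2'.ow.zq)
    have hna : ¬ G.Adj (Z c d i) (Z c d' i) := fun h3 => hG.noK4 _ _ _ _ h2.oz.zq
      h2.zw h2'.zw h2.ow.zp.symm h2'.ow.zp.symm h3
    have hua : ¬ G.Adj (Z c d' i) u := fun h3 => by
      rcases hG.adj_of _ _ u c hne hna h2.uw h3.symm h2.ow.zp.symm h2'.ow.zp.symm with h4 | h4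
      exacts [huc h4, hnc h4]
    have hne' : Z c d' i ≠ u := fun h3 => hnc (h3 ▸ h2'.ow.zp)
    obtain ⟨v, v1, v2, v3⟩ := hG.exists_of _ _ _ h2'.zw h1.uw.symm hne' hua
    rcases hall v v1 v3.symm with rfl | rfl | rfl
    · rcases h2'.ow.meet hG h1.oz v2.symm with h4 | h4 | h4 | h4
      exacts [absurd h4 h.ac, absurd h4 fun h5 => hG.no_triangle h.xb h.xc h2'.ow.xq h.bc h'.cd
        (h5 ▸ h.ab.symm), absurd h4 h.bc.ne, absurd h4 h'.bd]
    · exact absurd v2 hna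
    · exact v2
  have hwb : w ≠ b := fun h3 => hnb (h3 ▸ huw)
  have hwc : w ≠ c := fun h3 => hnc (h3 ▸ huw)
  have h3 := F.eq_U hG (i := i) (u := w) ⟨h1'.oz, h1'.ow, h1'.zw, hr, hzw.symm, hwb⟩
    ⟨h2'.oz, h2'.ow, h2'.zw, hzw.symm, hs, hwc⟩
  rwa [← h3]

end Frame

/-- In the local graph of `u`, with `t`, `t'` adjacent to opposite vertices of a hexagon. -/
theorem hexagon_center (hG : LocallyMoore G k 3) {w₁ w₂ w₄ w₅ t t' y : V} (h₁ : G.Adj x w₁)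
    (h₂ : G.Adj x w₂) (h₄ : G.Adj x w₄) (h₅ : G.Adj x w₅) (h₁₂ : G.Adj w₁ w₂)
    (h₄₅ : G.Adj w₄ w₅) (ht : G.Adj x t) (ht' : G.Adj x t') (t₁ : G.Adj t w₁) (t₄ : G.Adj t w₄)
    (t₂ : G.Adj t' w₂) (t₅ : G.Adj t' w₅) (hw : w₁ ≠ w₄)
    (htw₂ : t ≠ w₂) (htw₁ : t' ≠ w₁) (hy : G.Adj x y) (hty : G.Adj t y)
    (y₁ : y ≠ w₁) (y₄ : y ≠ w₄) : G.Adj t' y ∧ y ≠ w₂ ∧ y ≠ w₅ := by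
  have tw₂ := hG.no_triangle ht h₁ h₂ t₁ h₁₂
  have tw₅ := hG.no_triangle ht h₄ h₅ t₄ h₄₅
  have tw₁ := hG.no_triangle ht' h₂ h₁ t₂ h₁₂.symm
  have tw₄ := hG.no_triangle ht' h₅ h₄ t₅ h₄₅.symm
  have htt' : t ≠ t' := by
    rintro rfl
    exact tw₁ t₁
  have nadj : ¬ G.Adj t t' := fun h =>
    htw₁ (hG.no_square ht h₁ h₂ ht' t₁ h₁₂ h t₂ htw₂).symm
  obtain ⟨v, v1, v2, v3⟩ := hG.exists_of x t t' ht ht' htt' nadj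
  refine ⟨?_, fun h => tw₂ (h ▸ hty), fun h => tw₅ (h ▸ hty)⟩
  rcases hG.eq_of_three ht h₁ t₁ h₄ t₄ hy hty hw y₁.symm y₄.symm v1 v2.symm with rfl | rfl | rfl
  exacts [absurd v3.symm tw₁, absurd v3.symm tw₄, v3.symm]

end LocallyMoore
end KoolenPark

namespace KoolenPark

/-! ### The Petersen graph on `0, …, 9` -/

/-- The bit `10 * i + j` of this number says whether `i` and `j` are adjacent. -/
def petersenMask : ℕ := 128929866157091644767854445582

/-- Adjacency in the Petersen graph. -/
def pet (i j : ℕ) : Bool := petersenMask.testBit (10 * i + j) && Nat.blt j 10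

/-- `i, j, k, l` is a path in the Petersen graph. -/
def petPath (i j k l : ℕ) : Bool := pet i j && pet j k && pet k l && i != k && j != l

/-- Checks a condition on all paths of length three. -/
def allPaths (P : ℕ → ℕ → ℕ → ℕ → Bool) : Bool :=
  (List.range 10).all fun i => (List.range 10).all fun j => !pet i j ||
    (List.range 10).all fun k => !(pet j k && i != k) ||
      (List.range 10).all fun l => !(pet k l && j != l) || P i j k l

theorem pet_lt {i j : ℕ} (h : pet i j = true) : i < 10 ∧ j < 10 := by
  simp only [pet, Bool.and_eq_true, Nat.blt_eq] at h
  refine ⟨?_, h.2⟩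
  by_contra hi
  have h1 : petersenMask < 2 ^ (10 * i + j) :=
    lt_of_lt_of_le (b := 2 ^ 100) (by decide) (Nat.pow_le_pow_right (by decide) (by omega))
  rw [Nat.testBit_lt_two_pow h1] at h
  exact absurd h.1 (by decide)

theorem pet_symm_all : ((List.range 10).all fun i => (List.range 10).all fun j =>
    pet i j == pet j i) = true := by decide +kernel

theorem pet_symm {i j : ℕ} (h : pet i j = true) : pet j i = true := by
  have h1 := pet_symm_all
  simp only [List.all_eq_true, List.mem_range] at h1
  have h2 := h1 i (pet_lt h).1 j (pet_lt h).2
  rw [beq_iff_eq] at h2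
  rw [← h2, h]

theorem petPath_iff {i j k l : ℕ} : petPath i j k l = true ↔
    pet i j = true ∧ pet j k = true ∧ pet k l = true ∧ i ≠ k ∧ j ≠ l := by
  simp [petPath, and_assoc]

theorem of_allPaths {P : ℕ → ℕ → ℕ → ℕ → Bool} (h : allPaths P = true) {i j k l : ℕ}
    (hp : petPath i j k l = true) : P i j k l = true := by
  obtain ⟨h1, h2, h3, h4, h5⟩ := petPath_iff.1 hp
  simp only [allPaths, List.all_eq_true, List.mem_range, Bool.or_eq_true, Bool.not_eq_true',
    Bool.and_eq_false_iff, bne_eq_false_iff_eq] at h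
  have hh := h i (pet_lt h1).1 j (pet_lt h1).2
  simp only [h1, Bool.true_eq_false, false_or] at hh
  have hh := hh k (pet_lt h2).2
  simp only [h2, Bool.true_eq_false, false_or, h4] at hh
  have hh := hh l (pet_lt h3).2
  simpa only [h3, Bool.true_eq_false, false_or, h5] using hh

theorem pet_walk_all : ((List.range 10).all fun i => (List.range 10).all fun j =>
    i == j || pet i j || (((List.range 10).any fun a => pet i a && pet a j) &&
      ((List.range 10).any fun a => (List.range 10).any fun b =>
        pet i a && pet a b && pet b j))) = true := by
  decide +kernel

theorem pet_walk {i j : ℕ} (hi : i < 10) (hj : j < 10) (hne : i ≠ j) (h : pet i j ≠ true) :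
    (∃ a, pet i a = true ∧ pet a j = true) ∧
      ∃ a b, pet i a = true ∧ pet a b = true ∧ pet b j = true := by
  have h1 := pet_walk_all
  simp only [List.all_eq_true, List.mem_range, Bool.or_eq_true, Bool.and_eq_true,
    List.any_eq_true, beq_iff_eq] at h1
  rcases h1 i hi j hj with (h2 | h2) | ⟨⟨a, -, h2⟩, ⟨b, -, c, -, h3⟩⟩
  · exact absurd h2 hne
  · exact absurd h2 h
  · exact ⟨⟨a, h2⟩, b, c, h3.1.1, h3.1.2, h3.2⟩

/-- The third neighbour of `j`. -/
def petThird (i j k : ℕ) : ℕ :=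
  ((List.range 10).find? fun m => pet j m && m != i && m != k).getD 0

/-- The continuation of a path of length three in the walk around a pentagon or a hexagon. -/
def petNext (κ : Bool) (i k l : ℕ) : ℕ :=
  ((List.range 10).find? fun m => pet l m && m != k && (pet i m == κ)).getD 0

/-- A path of length three with a bit. -/
abbrev Hex : Type := ℕ × ℕ × ℕ × ℕ × Bool

namespace Hex

/-- The path is a path in the Petersen graph. -/
def ok (h : Hex) : Bool := petPath h.1 h.2.1 h.2.2.1 h.2.2.2.1

/-- The next path on the pentagon or hexagon. -/
def rot (κ : Bool) (h : Hex) : Hex :=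
  (h.2.1, h.2.2.1, h.2.2.2.1, petNext κ h.1 h.2.2.1 h.2.2.2.1, h.2.2.2.2 ^^ !κ)

/-- The reverse path. -/
def rev (κ : Bool) (h : Hex) : Hex :=
  (h.2.2.2.1, h.2.2.1, h.2.1, h.1, h.2.2.2.2 ^^ κ)

/-- The path with the same middle edge and different ends. -/
def opp (h : Hex) : Hex :=
  (petThird h.1 h.2.1 h.2.2.1, h.2.1, h.2.2.1, petThird h.2.1 h.2.2.1 h.2.2.2.1, h.2.2.2.2)

/-- The first edge of the path is `ij`, with bit `b`. -/
def start (κ : Bool) (h : Hex) (i j : ℕ) (b : Bool) : Bool :=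
  (h.1 == i && h.2.1 == j && h.2.2.2.2 == b) || (h.1 == j && h.2.1 == i && h.2.2.2.2 == (b ^^ κ))

/-- The paths have the same middle edge, the same bit, and different ends. -/
def crosses (h g : Hex) : Bool :=
  h.2.1 == g.2.1 && h.2.2.1 == g.2.2.1 && h.2.2.2.2 == g.2.2.2.2 && h.1 != g.1 &&
    h.2.2.2.1 != g.2.2.2.1

/-- Hexagons which span, by passing to opposite ones, a class of ten. -/
def cls (b : Bool) : List Hex :=
  let h : Hex := (0, 1, 4, 6, b)
  let ts := [opp h, opp (rot false h), opp (rot false (rot false h))]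
  h :: (ts ++ ts.flatMap fun t => [opp (rot false t), opp (rot false (rot false t))])

theorem rot_all (κ : Bool) : allPaths (fun i j k l => (List.all [false, true] fun b =>
    ok (rot κ (i, j, k, l, b))) && pet i (petNext κ i k l) == κ) = true := by
  cases κ <;> decide +kernel

theorem opp_all : allPaths (fun i j k l => (List.all [false, true] fun b =>
    ok (opp (i, j, k, l, b)) && opp (opp (i, j, k, l, b)) == (i, j, k, l, b)) &&
      petThird i j k != i && petThird j k l != l) = true := by
  decide +kernel

theorem opp_rot_all : allPaths (fun i j k l => List.all [false, true] fun b =>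
    let h := rot false (rot false (rot false (i, j, k, l, b)))
    let g := rot false (rot false (rot false (opp (i, j, k, l, b))))
    h.2.1 == g.2.2.1 && h.2.2.1 == g.2.1 && h.2.2.2.2 == g.2.2.2.2 &&
      j != h.2.1 && j != h.2.2.1) = true := by
  decide +kernel

theorem rot_ok {h : Hex} (κ : Bool) (hh : h.ok = true) : (rot κ h).ok = true := by
  obtain ⟨i, j, k, l, b⟩ := h
  have := of_allPaths (rot_all κ) hh
  simp only [Bool.and_eq_true, List.all_eq_true] at this
  exact this.1 b (by cases b <;> simp)

theorem pet_next {i j k l : ℕ} (κ : Bool) (hh : petPath i j k l = true) :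
    pet i (petNext κ i k l) = κ := by
  have := of_allPaths (rot_all κ) hh
  simp only [Bool.and_eq_true, beq_iff_eq] at this
  exact this.2

theorem rev_ok {h : Hex} (κ : Bool) (hh : h.ok = true) : (rev κ h).ok = true := by
  obtain ⟨h1, h2, h3, h4, h5⟩ := petPath_iff.1 hh
  exact petPath_iff.2 ⟨pet_symm h3, pet_symm h2, pet_symm h1, h5.symm, h4.symm⟩

theorem opp_ok {h : Hex} (hh : h.ok = true) : h.opp.ok = true ∧ h.opp.opp = h ∧
    h.opp.1 ≠ h.1 ∧ h.opp.2.2.2.1 ≠ h.2.2.2.1 := by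
  obtain ⟨i, j, k, l, b⟩ := h
  have := of_allPaths opp_all hh
  simp only [Bool.and_eq_true, List.all_eq_true, beq_iff_eq, bne_iff_ne] at this
  obtain ⟨⟨h1, h2⟩, h3⟩ := this
  have h1 := h1 b (by cases b <;> simp)
  exact ⟨h1.1, h1.2, h2, h3⟩

theorem opp_rot {h : Hex} (hh : h.ok = true) :
    let g := rot false (rot false (rot false h))
    let g' := rot false (rot false (rot false (opp h)))
    g.2.1 = g'.2.2.1 ∧ g.2.2.1 = g'.2.1 ∧ g.2.2.2.2 = g'.2.2.2.2 ∧ h.2.1 ≠ g.2.1 ∧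
      h.2.1 ≠ g.2.2.1 := by
  obtain ⟨i, j, k, l, b⟩ := h
  have := of_allPaths opp_rot_all hh
  simp only [List.all_eq_true] at this
  have := this b (by cases b <;> simp)
  simp only [Bool.and_eq_true, beq_iff_eq, bne_iff_ne] at this
  exact ⟨this.1.1.1.1, this.1.1.1.2, this.1.1.2, this.1.2, this.2⟩

end Hex

/-! ### Labelling the local graph by the Petersen graph. -/

namespace LocallyMoore

variable {V : Type*} [Fintype V] [DecidableEq V] {G : SimpleGraph V} [DecidableRel G.Adj]
variable {k : ℕ} {x : V} {e : ℕ → V}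

/-- The local graph of `x` is labelled as the Petersen graph. -/
structure Labelling (G : SimpleGraph V) (x : V) (e : ℕ → V) : Prop where
  xe : ∀ i < 10, G.Adj x (e i)
  adj : ∀ {i j}, pet i j = true → G.Adj (e i) (e j)

namespace Labelling

theorem left (L : Labelling G x e) {i j : ℕ} (h : pet i j = true) : G.Adj x (e i) :=
  L.xe i (pet_lt h).1

theorem right (L : Labelling G x e) {i j : ℕ} (h : pet i j = true) : G.Adj x (e j) :=
  L.xe j (pet_lt h).2

/-- Distinct nonadjacent vertices of the Petersen graph are joined by a walk of length three;
identifying its ends would give a triangle in the local graph. -/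
theorem inj (hG : LocallyMoore G k 3) (L : Labelling G x e) {i j : ℕ} (hi : i < 10) (hj : j < 10)
    (hne : i ≠ j) : e i ≠ e j := fun h => by
  by_cases hp : pet i j = true
  · exact (L.adj hp).ne h
  · obtain ⟨-, a, b, h1, h2, h3⟩ := pet_walk hi hj hne hp
    exact hG.no_triangle (L.left h1) (L.right h1) (L.right h2) (L.adj h1) (L.adj h2)
      (h ▸ (L.adj h3).symm)

theorem adj_iff (hG : LocallyMoore G k 3) (L : Labelling G x e) {i j : ℕ} (hi : i < 10)
    (hj : j < 10) : G.Adj (e i) (e j) ↔ pet i j = true := by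
  refine ⟨fun h => ?_, L.adj⟩
  by_contra hp
  obtain ⟨⟨a, h1, h2⟩, -⟩ := pet_walk hi hj (fun h1 => h.ne (h1 ▸ rfl)) hp
  exact hG.no_triangle (L.left h1) (L.right h1) (L.right h2) (L.adj h1) (L.adj h2) h

theorem path (hG : LocallyMoore G k 3) (L : Labelling G x e) {i j m l : ℕ}
    (h : petPath i j m l = true) : LPath G x (e i) (e j) (e m) (e l) := by
  obtain ⟨h1, h2, h3, h4, h5⟩ := petPath_iff.1 h
  exact ⟨L.left h1, L.left h2, L.left h3, L.right h3, L.adj h1, L.adj h2, L.adj h3,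
    L.inj hG (pet_lt h1).1 (pet_lt h2).2 h4, L.inj hG (pet_lt h1).2 (pet_lt h3).2 h5⟩

end Labelling

/-- The local graph has valency 3, no triangles, and a unique common neighbour for each nonadjacent
pair. Around `p` with neighbours `q₁, q₂, q₃` the six remaining vertices form the hexagon `a c h b d
i`, with opposite vertices attached to the same `q`. -/
theorem exists_labelling (hG : LocallyMoore G 10 3) (x : V) : ∃ e, Labelling G x e := by
  obtain ⟨p, hp⟩ := hG.exists_adj (by decide) x
  obtain ⟨q₁, q₂, q₃, n₁₂, n₁₃, n₂₃, x₁, p₁, x₂, p₂, x₃, p₃, -⟩ := hG.three_cn hp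
  have key : ∀ {q q' r : V}, G.Adj x q → G.Adj p q → G.Adj x q' → G.Adj p q' → q ≠ q' →
      G.Adj x r → G.Adj q r → r ≠ p → ∃ s, G.Adj x s ∧ G.Adj q' s ∧ s ≠ p ∧ G.Adj r s := by
    intro q q' r hq hpq hq' hpq' hqq hr hqr hrp
    have hrq : r ≠ q' := by
      rintro rfl
      exact hG.no_triangle hp hq hr hpq hqr hpq'
    have hna : ¬ G.Adj r q' := fun h =>
      hrp (hG.no_square hq hr hq' hp hqr h hpq.symm hpq' hqq)
    obtain ⟨s, h1, h2, h3⟩ := hG.exists_of x r q' hr hq' hrq hna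
    refine ⟨s, h1, h3.symm, ?_, h2.symm⟩
    rintro rfl
    exact hG.no_triangle hp hq hr hpq hqr h2
  obtain ⟨a, b, hap, hbp, hab, xa, qa, xb, qb, hA⟩ := hG.two_others x₁ hp p₁.symm
  obtain ⟨c, xc, qc, hcp, ac⟩ := key x₁ p₁ x₂ p₂ n₁₂ xa qa hap
  obtain ⟨d, xd, qd, hdp, bd⟩ := key x₁ p₁ x₂ p₂ n₁₂ xb qb hbp
  obtain ⟨f, xf, qf, hfp, af⟩ := key x₁ p₁ x₃ p₃ n₁₃ xa qa hap
  obtain ⟨g, xg, qg, hgp, bg⟩ := key x₁ p₁ x₃ p₃ n₁₃ xb qb hbp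
  obtain ⟨h, xh, qh, hhp, ch⟩ := key x₂ p₂ x₃ p₃ n₂₃ xc qc hcp
  obtain ⟨i, xi, qi, hip, di⟩ := key x₂ p₂ x₃ p₃ n₂₃ xd qd hdp
  have hfg : f ≠ g := by
    rintro rfl
    have h1 := hG.no_square xa xf xb x₁ af bg.symm qa.symm qb hab
    exact hG.no_triangle hp x₃ x₁ p₃ (h1 ▸ qf) p₁
  have hcd : c ≠ d := by
    rintro rfl
    have h1 := hG.no_square xa xc xb x₁ ac bd.symm qa.symm qb hab
    exact hG.no_triangle hp x₂ x₁ p₂ (h1 ▸ qc) p₁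
  have hQ : ∀ t, G.Adj x t → G.Adj q₃ t → t ≠ p → t = f ∨ t = g := by
    intro t h1 h2 h3
    obtain ⟨v, -, -, -, -, hv⟩ := hG.one_other x₃ hp p₃.symm xf qf hfp.symm
    rcases hv t h1 h2 with h4 | h4 | h4
    · exact absurd h4 h3
    · exact Or.inl h4
    · rcases hv g xg qg with h5 | h5 | h5
      · exact absurd h5 hgp
      · exact absurd h5.symm hfg
      · exact Or.inr (h4.trans h5.symm)
  obtain rfl : h = g := by
    rcases hQ h xh qh hhp with rfl | h1
    · exact (hG.no_triangle xa xc xh ac ch af).elim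
    · exact h1
  obtain rfl : i = f := by
    rcases hQ i xi qi hip with h1 | rfl
    · exact h1
    · exact (hG.no_triangle xb xd xi bd di bg).elim
  refine ⟨fun n => [p, q₁, q₂, q₃, a, b, c, d, i, h].getD n p, ?_, ?_⟩
  · intro n hn
    interval_cases n <;> assumption
  · intro n m hnm
    obtain ⟨h1, h2⟩ := pet_lt hnm
    interval_cases n <;> interval_cases m <;>
      first
      | exact absurd hnm (by decide)
      | assumption
      | (apply SimpleGraph.Adj.symm; assumption)

end LocallyMoore
end KoolenPark

/-! ### Naming the vertices of a locally Petersen graph. -/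

namespace KoolenPark

/-- Names for the vertices of a graph that is locally the Petersen graph. -/
inductive Code : Type
  | root : Code
  | pt (i : ℕ) : Code
  | arc (i j : ℕ) (b : Bool) : Code
  | hex (h : Hex) : Code
  | top (b : Bool) : Code

namespace Code

/-- A sufficient condition for the adjacency of named vertices. -/
def adj (κ : Bool) : Code → Code → Bool
  | root, pt i => Nat.blt i 10
  | pt i, pt j => pet i j
  | pt m, arc i j _ => pet i j && (m == i || m == j)
  | arc i j b, arc m l c => pet i j && pet m l &&
      ((i == m && j != l && c == !b) || (i == l && j != m && (c ^^ κ) == !b) ||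
        (j == m && i != l && c == !(b ^^ κ)) || (j == l && i != m && (c ^^ κ) == !(b ^^ κ)))
  | hex h, arc i j b => h.ok && (List.range 6).any fun r => ((Hex.rot κ)^[r] h).start κ i j b
  | hex h, hex g => h.ok && g.ok && (List.range 6).any fun r => (List.range 6).any fun s =>
      ((Hex.rot κ)^[r] h).crosses ((Hex.rot κ)^[s] g) ||
        ((Hex.rot κ)^[r] h).crosses ((Hex.rot κ)^[s] (g.rev κ))
  | top b, hex h => !κ && (Hex.cls b).contains h
  | _, _ => false

end Code

namespace LocallyMoore

variable {V : Type*} [Fintype V] [DecidableEq V] {G : SimpleGraph V} [DecidableRel G.Adj]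
variable {k : ℕ} {x y : V} {e : ℕ → V} {κ : Bool} {Z : V → V → Bool → V}
  {U : V → V → V → V → Bool → V} {h g : Hex}

/-- The vertex at distance three named by a path. -/
def hexVertex (U : V → V → V → V → Bool → V) (e : ℕ → V) (h : Hex) : V :=
  U (e h.1) (e h.2.1) (e h.2.2.1) (e h.2.2.2.1) h.2.2.2.2

/-- The vertex over the middle edge of a path, which is adjacent to `hexVertex U e h`. -/
def midVertex (κ : Bool) (Z : V → V → Bool → V) (e : ℕ → V) (h : Hex) : V :=
  Z (e h.2.1) (e h.2.2.1) (h.2.2.2.2 ^^ !κ)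

namespace Frame

theorem hexVertex_rot (hG : LocallyMoore G k 3) (F : Frame G x κ Z U) (L : Labelling G x e)
    (hh : h.ok = true) : hexVertex U e (h.rot κ) = hexVertex U e h := by
  obtain ⟨i, j, m, l, b⟩ := h
  have hp := L.path hG hh
  obtain ⟨-, -, h3, -, h4⟩ := petPath_iff.1 (Hex.rot_ok κ hh)
  have hx := L.right h3
  have hadj := L.adj h3
  have hne := (L.inj hG (pet_lt h3).2 (pet_lt (petPath_iff.1 hh).2.2.1).1 (Ne.symm h4))
  have hnext := Hex.pet_next κ hh
  have hi := (pet_lt (petPath_iff.1 hh).1).1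
  cases κ
  · exact (F.rot_of_not_adj hG rfl hp hx hadj hne fun h5 => by
      rw [L.adj_iff hG hi (pet_lt h3).2] at h5
      exact absurd (h5.symm.trans hnext) (by decide)).symm
  · exact (F.rot_of_pent hG rfl ⟨hp, hx, hadj, (L.adj hnext).symm⟩).symm

theorem iterate_rot (hG : LocallyMoore G k 3) (F : Frame G x κ Z U) (L : Labelling G x e)
    (r : ℕ) (hh : h.ok = true) : ((Hex.rot κ)^[r] h).ok = true ∧
      hexVertex U e ((Hex.rot κ)^[r] h) = hexVertex U e h := by
  induction r with
  | zero => exact ⟨hh, rfl⟩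
  | succ r ih =>
    rw [Function.iterate_succ_apply']
    exact ⟨Hex.rot_ok κ ih.1, (F.hexVertex_rot hG L ih.1).trans ih.2⟩

theorem hexVertex_rev (hG : LocallyMoore G k 3) (F : Frame G x κ Z U) (L : Labelling G x e)
    (hh : h.ok = true) : hexVertex U e (h.rev κ) = hexVertex U e h :=
  (F.reverse hG (L.path hG hh)).symm

theorem hexVertex_adj_start (hG : LocallyMoore G k 3) (F : Frame G x κ Z U) (L : Labelling G x e)
    (hh : h.ok = true) {i j : ℕ} {b : Bool} (hs : h.start κ i j b = true) :
    G.Adj (hexVertex U e h) (Z (e i) (e j) b) := by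
  obtain ⟨i', j', m, l, b'⟩ := h
  have hp := L.path hG hh
  simp only [Hex.start, Bool.or_eq_true, Bool.and_eq_true, beq_iff_eq] at hs
  rcases hs with ⟨⟨rfl, rfl⟩, rfl⟩ | ⟨⟨rfl, rfl⟩, rfl⟩
  · exact (F.seg hp _).1.uz
  · rw [← F.swap hp.xb hp.xa hp.ab.symm]
    exact (F.seg hp _).1.uz

theorem hexVertex_adj_of_crosses (hG : LocallyMoore G k 3) (F : Frame G x κ Z U)
    (L : Labelling G x e) (hh : h.ok = true) (hg : g.ok = true) (hc : h.crosses g = true) :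
    G.Adj (hexVertex U e h) (hexVertex U e g) := by
  obtain ⟨i, j, m, l, b⟩ := h
  obtain ⟨i', j', m', l', b'⟩ := g
  simp only [Hex.crosses, Bool.and_eq_true, beq_iff_eq, bne_iff_ne] at hc
  obtain ⟨⟨⟨⟨rfl, rfl⟩, rfl⟩, h1⟩, h2⟩ := hc
  exact F.adj_U hG (L.path hG hh) (L.path hG hg)
    (L.inj hG (pet_lt (petPath_iff.1 hh).1).1 (pet_lt (petPath_iff.1 hg).1).1 h1)
    (L.inj hG (pet_lt (petPath_iff.1 hh).2.2.1).2 (pet_lt (petPath_iff.1 hg).2.2.1).2 h2)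

theorem hexVertex_adj_opp (hG : LocallyMoore G k 3) (F : Frame G x κ Z U) (L : Labelling G x e)
    (hh : h.ok = true) : G.Adj (hexVertex U e h) (hexVertex U e h.opp) := by
  obtain ⟨h1, -, h2, h3⟩ := Hex.opp_ok hh
  refine F.hexVertex_adj_of_crosses hG L hh h1 ?_
  simp only [Hex.crosses, Bool.and_eq_true, beq_iff_eq, bne_iff_ne]
  exact ⟨⟨⟨⟨rfl, rfl⟩, rfl⟩, h2.symm⟩, h3.symm⟩

theorem hexVertex_adj_mid (hG : LocallyMoore G k 3) (F : Frame G x κ Z U) (L : Labelling G x e)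
    (hh : h.ok = true) : G.Adj (hexVertex U e h) (midVertex κ Z e h) :=
  (F.seg (L.path hG hh) _).1.uw

theorem mid_adj_mid (hG : LocallyMoore G k 3) (F : Frame G x κ Z U) (L : Labelling G x e)
    (hh : h.ok = true) : G.Adj (midVertex κ Z e h) (midVertex κ Z e (h.rot κ)) := by
  have h1 := (F.seg (L.path hG hh) h.2.2.2.2).2.zw
  have h2 : midVertex κ Z e (h.rot κ) = Z (e h.2.2.1) (e h.2.2.2.1) h.2.2.2.2 := by
    simp only [midVertex, Hex.rot, Bool.xor_assoc, Bool.xor_self, Bool.xor_false]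
  rw [h2]
  exact h1

theorem hexVertex_ne_mid (hG : LocallyMoore G k 3) (F : Frame G x κ Z U) (L : Labelling G x e)
    (hh : h.ok = true) (hg : g.ok = true) : hexVertex U e h ≠ midVertex κ Z e g := fun h1 => by
  have h2 := (F.seg (L.path hG hh) h.2.2.2.2).1
  have h3 := (F.seg (L.path hG hg) g.2.2.2.2).1
  refine h2.not_nbr hG h3.ow.xp ?_
  change G.Adj (hexVertex U e h) _
  rw [h1]
  exact h3.ow.zp

/-- `y` is adjacent to `h` and its opposite, and is not over an edge of `h`. -/
structure Top (G : SimpleGraph V) (e : ℕ → V) (Z : V → V → Bool → V)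
    (U : V → V → V → V → Bool → V) (y : V) (h : Hex) : Prop where
  ok : h.ok = true
  adj : G.Adj (hexVertex U e h) y
  adj_opp : G.Adj (hexVertex U e h.opp) y
  ne : y ≠ midVertex false Z e h
  ne' : y ≠ midVertex false Z e ((Hex.rot false)^[3] h)

/-- Three steps further, a hexagon and its opposite again have the same middle edge, with opposite
orientations and equal bits. For κ = false reversal preserves the bit. -/
theorem mid_opp_rot (F : Frame G x false Z U) (L : Labelling G x e) (hh : h.ok = true) :
    midVertex false Z e ((Hex.rot false)^[3] h.opp) =
      midVertex false Z e ((Hex.rot false)^[3] h) := by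
  obtain ⟨h1, h2, h3, -⟩ := Hex.opp_rot hh
  have h4 : ((Hex.rot false)^[3] h).ok = true :=
    Hex.rot_ok false (Hex.rot_ok false (Hex.rot_ok false hh))
  obtain ⟨-, h5, -⟩ := petPath_iff.1 h4
  have h6 := F.swap (L.left h5) (L.right h5) (L.adj h5) (((Hex.rot false)^[3] h).2.2.2.2 ^^ !false)
  rw [Bool.xor_false] at h6
  have h7 := congrArg e h1
  have h8 := congrArg e h2
  change e ((Hex.rot false)^[3] h).2.1 = e ((Hex.rot false)^[3] h.opp).2.2.1 at h7
  change e ((Hex.rot false)^[3] h).2.2.1 = e ((Hex.rot false)^[3] h.opp).2.1 at h8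
  change ((Hex.rot false)^[3] h).2.2.2.2 = ((Hex.rot false)^[3] h.opp).2.2.2.2 at h3
  unfold midVertex
  rw [← h7, ← h8, ← h3, h6]

theorem hexVertex_opp_adj (hG : LocallyMoore G k 3) (F : Frame G x false Z U)
    (L : Labelling G x e) (hh : h.ok = true) :
    G.Adj (hexVertex U e h.opp) (midVertex false Z e h) ∧
    G.Adj (hexVertex U e h.opp) (midVertex false Z e ((Hex.rot false)^[3] h)) := by
  obtain ⟨h1, -⟩ := Hex.opp_ok hh
  refine ⟨F.hexVertex_adj_mid hG L h1, ?_⟩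
  obtain ⟨h2, h3⟩ := F.iterate_rot hG L 3 h1
  rw [← F.mid_opp_rot L hh, ← h3]
  exact F.hexVertex_adj_mid hG L h2

theorem mid_ne_mid (hG : LocallyMoore G k 3) (F : Frame G x false Z U)
    (L : Labelling G x e) (hh : h.ok = true) :
    midVertex false Z e h ≠ midVertex false Z e ((Hex.rot false)^[3] h) := fun h1 => by
  obtain ⟨-, -, -, h4, h5⟩ := Hex.opp_rot hh
  have h2 := (F.seg (L.path hG hh) h.2.2.2.2).1.ow
  have h3 := (F.seg (L.path hG (F.iterate_rot hG L 3 hh).1) ((Hex.rot false)^[3] h).2.2.2.2).1.ow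
  have h6 := (pet_lt (petPath_iff.1 hh).2.1).1
  have h7 := pet_lt (petPath_iff.1 (F.iterate_rot hG L 3 hh).1).2.1
  refine h3.not_adj_of_ne hG h2.xp (L.inj hG h6 h7.1 h4) (L.inj hG h6 h7.2 h5) ?_
  change G.Adj (midVertex false Z e ((Hex.rot false)^[3] h)) _
  rw [← h1]
  exact h2.zp

/-- In the local graph of `hexVertex U e h`, the opposites of `h` and of its rotation are each
adjacent to two antipodal vertices of the hexagon of mid vertices. By `hexagon_center` they have the
same third neighbour. -/
theorem Top.rot (hG : LocallyMoore G k 3) (F : Frame G x false Z U) (L : Labelling G x e)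
    (ht : Top G e Z U y h) : Top G e Z U y (h.rot false) := by
  have hh := ht.ok
  have hr := Hex.rot_ok false hh
  obtain ⟨h3, v3⟩ := F.iterate_rot hG L 3 hh
  obtain ⟨h4, v4⟩ := F.iterate_rot hG L 3 hr
  have v1 := F.hexVertex_rot hG L hh
  obtain ⟨t₁, t₄⟩ := F.hexVertex_opp_adj hG L hh
  obtain ⟨t₂, t₅⟩ := F.hexVertex_opp_adj hG L hr
  have h45 := F.mid_adj_mid hG L h3
  rw [← Function.iterate_succ_apply' (Hex.rot false), Function.iterate_succ_apply] at h45
  obtain ⟨c1, c2, c3⟩ := hG.hexagon_center (x := hexVertex U e h) (F.hexVertex_adj_mid hG L hh)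
    (v1 ▸ F.hexVertex_adj_mid hG L hr) (v3 ▸ F.hexVertex_adj_mid hG L h3)
    (v1 ▸ v4 ▸ F.hexVertex_adj_mid hG L h4) (F.mid_adj_mid hG L hh) h45
    (F.hexVertex_adj_opp hG L hh) (v1 ▸ F.hexVertex_adj_opp hG L hr) t₁ t₄ t₂ t₅
    (F.mid_ne_mid hG L hh) (F.hexVertex_ne_mid hG L (Hex.opp_ok hh).1 hr)
    (F.hexVertex_ne_mid hG L (Hex.opp_ok hr).1 hh) ht.adj ht.adj_opp ht.ne ht.ne'
  exact ⟨hr, v1 ▸ ht.adj, c1, c2, c3⟩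

theorem Top.opp (F : Frame G x false Z U) (L : Labelling G x e)
    (ht : Top G e Z U y h) : Top G e Z U y h.opp := by
  obtain ⟨h1, h2, -⟩ := Hex.opp_ok ht.ok
  exact ⟨h1, ht.adj_opp, h2.symm ▸ ht.adj, ht.ne, F.mid_opp_rot L ht.ok ▸ ht.ne'⟩

/-- A vertex and its opposite are adjacent and share the two mid vertices at opposite places of the
hexagon, so they have exactly one further common neighbour. -/
theorem exists_top (hG : LocallyMoore G k 3) (F : Frame G x false Z U) (L : Labelling G x e)
    (hh : h.ok = true) : ∃ y, Top G e Z U y h := by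
  obtain ⟨t₁, t₄⟩ := F.hexVertex_opp_adj hG L hh
  obtain ⟨h3, v3⟩ := F.iterate_rot hG L 3 hh
  obtain ⟨y, h4, h5, h6, h7, -⟩ := hG.one_other (F.hexVertex_adj_opp hG L hh)
    (F.hexVertex_adj_mid hG L hh) t₁ (v3 ▸ F.hexVertex_adj_mid hG L h3) t₄ (F.mid_ne_mid hG L hh)
  exact ⟨y, hh, h6, h7, h4, h5⟩

theorem exists_tops (hG : LocallyMoore G k 3) (F : Frame G x false Z U) (L : Labelling G x e) :
    ∃ y : Bool → V, ∀ b, ∀ h ∈ Hex.cls b, G.Adj (y b) (hexVertex U e h) := by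
  -- One starting hexagon for each bit suffices, as rotation and passage to the opposite preserve
  -- `Top` and generate the whole list.
  have h0 : ∀ b : Bool, Hex.ok (0, 1, 4, 6, b) = true := fun b => by cases b <;> decide
  choose y hy using fun b => F.exists_top hG L (h0 b)
  refine ⟨y, fun b => ?_⟩
  suffices ∀ h ∈ Hex.cls b, Top G e Z U (y b) h from fun h hh => (this h hh).adj.symm
  have key : ∀ {h}, Top G e Z U (y b) h → Top G e Z U (y b) (h.rot false) := fun h =>
    h.rot hG F L
  have key' : ∀ {h}, Top G e Z U (y b) h → Top G e Z U (y b) h.opp := fun h => h.opp F L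
  have h1 := hy b
  intro h hh
  simp only [Hex.cls, List.mem_cons, List.mem_append, List.mem_flatMap, List.not_mem_nil,
    or_false, false_or, List.cons_append] at hh
  rcases hh with rfl | rfl | rfl | rfl | ⟨t, rfl | rfl | rfl, rfl | rfl⟩
  exacts [h1, key' h1, key' (key h1), key' (key (key h1)), key' (key (key' h1)),
    key' (key (key (key' h1))), key' (key (key' (key h1))), key' (key (key (key' (key h1)))),
    key' (key (key' (key (key h1)))), key' (key (key (key' (key (key h1)))))]

end Frame

/-- The vertex with a given name. -/
def codeVertex (x : V) (e : ℕ → V) (Z : V → V → Bool → V) (U : V → V → V → V → Bool → V)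
    (y : Bool → V) : Code → V
  | .root => x
  | .pt i => e i
  | .arc i j b => Z (e i) (e j) b
  | .hex h => hexVertex U e h
  | .top b => y b

/-- All vertices can be named. -/
theorem exists_code (hG : LocallyMoore G 10 3) : ∃ κ, ∃ φ : Code → V,
    ∀ c d : Code, c.adj κ d = true → G.Adj (φ c) (φ d) := by
  obtain ⟨x⟩ := hG.conn.nonempty
  obtain ⟨e, L⟩ := hG.exists_labelling x
  obtain ⟨κ, Z, U, F⟩ := hG.exists_frame x
  have hy : ∃ y : Bool → V, κ = false → ∀ b, ∀ h ∈ Hex.cls b, G.Adj (y b) (hexVertex U e h) := by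
    by_cases hκ : κ = false
    · subst hκ
      obtain ⟨y, hy⟩ := F.exists_tops hG L
      exact ⟨y, fun _ => hy⟩
    · exact ⟨fun _ => x, fun h => absurd h hκ⟩
  obtain ⟨y, hy⟩ := hy
  refine ⟨κ, codeVertex x e Z U y, fun c d hcd => ?_⟩
  have hov : ∀ {i j}, pet i j = true → ∀ b, Over G x (e i) (e j) (Z (e i) (e j) b) :=
    fun h b => F.isOver (L.left h) (L.right h) (L.adj h) b
  have hsw : ∀ {i j}, pet i j = true → ∀ b, Z (e j) (e i) (b ^^ κ) = Z (e i) (e j) b :=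
    fun h b => F.swap (L.left h) (L.right h) (L.adj h) b
  have hZ : ∀ {i j l}, pet i j = true → pet i l = true → j ≠ l → ∀ b,
      G.Adj (Z (e i) (e j) b) (Z (e i) (e l) !b) := fun h h' hne b =>
    F.adj (L.left h) (L.right h) (L.right h') (L.adj h) (L.adj h')
      (L.inj hG (pet_lt h).2 (pet_lt h').2 hne) b
  cases c <;> cases d <;> simp only [Code.adj, Bool.false_eq_true] at hcd
  · exact L.xe _ (by rwa [Nat.blt_eq] at hcd)
  · exact L.adj hcd
  · simp only [Bool.and_eq_true, Bool.or_eq_true, beq_iff_eq] at hcd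
    obtain ⟨h, rfl | rfl⟩ := hcd
    · exact (hov h _).zp.symm
    · exact (hov h _).zq.symm
  · rename_i i j b m l c
    simp only [Bool.and_eq_true, Bool.or_eq_true, beq_iff_eq, bne_iff_ne] at hcd
    change G.Adj (Z (e i) (e j) b) (Z (e m) (e l) c)
    obtain ⟨⟨h, h'⟩, ((⟨⟨rfl, h1⟩, h2⟩ | ⟨⟨rfl, h1⟩, h2⟩) | ⟨⟨rfl, h1⟩, h2⟩) | ⟨⟨rfl, h1⟩, h2⟩⟩ := hcd
    · rw [h2]
      exact hZ h h' h1 b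
    · rw [← hsw h', h2]
      exact hZ h (pet_symm h') h1 b
    · rw [← hsw h, h2]
      exact hZ (pet_symm h) h' h1 _
    · rw [← hsw h, ← hsw h', h2]
      exact hZ (pet_symm h) (pet_symm h') h1 _
  · simp only [Bool.and_eq_true, List.any_eq_true] at hcd
    obtain ⟨h, r, -, h1⟩ := hcd
    obtain ⟨h2, h3⟩ := F.iterate_rot hG L r h
    change G.Adj (hexVertex U e _) _
    rw [← h3]
    exact F.hexVertex_adj_start hG L h2 h1
  · simp only [Bool.and_eq_true, List.any_eq_true, Bool.or_eq_true] at hcd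
    obtain ⟨⟨h, h'⟩, r, -, s, -, h1⟩ := hcd
    obtain ⟨h2, h3⟩ := F.iterate_rot hG L r h
    change G.Adj (hexVertex U e _) (hexVertex U e _)
    rcases h1 with h1 | h1
    · obtain ⟨h4, h5⟩ := F.iterate_rot hG L s h'
      rw [← h3, ← h5]
      exact F.hexVertex_adj_of_crosses hG L h2 h4 h1
    · obtain ⟨h4, h5⟩ := F.iterate_rot hG L s (Hex.rev_ok κ h')
      rw [← h3, ← F.hexVertex_rev hG L h', ← h5]
      exact F.hexVertex_adj_of_crosses hG L h2 h4 h1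
  · simp only [Bool.and_eq_true, Bool.not_eq_true', List.contains_iff_mem] at hcd
    exact hy hcd.1 _ _ hcd.2

end LocallyMoore
end KoolenPark

namespace KoolenPark

/-! ### Graphs given by a bit matrix -/

/-- The entry at `i`, `j` of a bit matrix with `n` columns. -/
def bitAdj (n T i j : ℕ) : Bool :=
  Nat.beq (Nat.land (Nat.shiftRight T (Nat.add (Nat.mul n i) j)) 1) 1

/-- The closed neighbourhood of `i` as a bit mask. -/
def bitNbhd (n T i : ℕ) : ℕ :=
  Nat.lor (Nat.mod (Nat.shiftRight T (Nat.mul n i)) (Nat.pow 2 n)) (Nat.shiftLeft 1 i)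

theorem bitAdj_eq (n T i j : ℕ) : bitAdj n T i j = T.testBit (n * i + j) := by
  have h : bitAdj n T i j = ((T >>> (n * i + j) &&& 1) == 1) := by
    rw [Bool.eq_iff_iff, beq_iff_eq, ← Nat.beq_eq]
    rfl
  rw [h, Nat.testBit_eq_decide_div_mod_eq, Nat.and_one_is_mod, Nat.shiftRight_eq_div_pow,
    Bool.eq_iff_iff, beq_iff_eq, decide_eq_true_iff]

theorem testBit_bitNbhd {n T i b : ℕ} (h : (bitNbhd n T i).testBit b = true) :
    b < n ∧ bitAdj n T i b = true ∨ b = i := by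
  have h1 : bitNbhd n T i = (T >>> (n * i)) % 2 ^ n ||| 1 <<< i := rfl
  rw [h1, Nat.testBit_or, Bool.or_eq_true, Nat.testBit_mod_two_pow, Nat.testBit_shiftRight,
    Bool.and_eq_true, decide_eq_true_iff, ← bitAdj_eq, Nat.one_shiftLeft,
    Nat.testBit_two_pow, decide_eq_true_iff] at h
  exact h.imp_right Eq.symm

/-- The graph with a given bit matrix. -/
def bitGraph (n T : ℕ) : SimpleGraph (Fin n) :=
  SimpleGraph.fromRel fun i j => bitAdj n T i j = true

/-- A check that the bit matrix `T` belongs to a graph with neighbour lists `N` for which every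
homomorphism to a graph `G` with `LocallyMoore G k lam` is an isomorphism. -/
def rigidCheck (n T : ℕ) (N : List (List ℕ)) (k lam : ℕ) : Bool :=
  ((List.range n).map fun i => (List.range n).filter fun j => bitAdj n T i j) == N &&
  ((List.range n).all fun i => !bitAdj n T i i) &&
  ((List.range n).all fun i => (List.range n).all fun j => bitAdj n T i j == bitAdj n T j i) &&
  (N.all fun L => Nat.beq L.length k) &&
  (N.all fun L => L.all fun m => Nat.beq (L.countP fun t => bitAdj n T m t) lam) &&
  (N.all fun L => L.all fun m => L.all fun m' => Nat.beq m m' || bitAdj n T m m' ||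
    L.any fun d => bitAdj n T m d && L.any fun e => bitAdj n T d e && bitAdj n T e m') &&
  (N.zipIdx.all fun P => N.zipIdx.all fun Q => (P.2 :: P.1).any fun a => (Q.2 :: Q.1).any fun c =>
    !Nat.beq (Nat.land (bitNbhd n T a) (bitNbhd n T c)) 0)

theorem card_filter_fin (n : ℕ) (p : ℕ → Bool) (q : Fin n → Prop) [DecidablePred q]
    (h : ∀ i : Fin n, q i ↔ p i = true) :
    (Finset.univ.filter q).card = (List.range n).countP p := by
  have h1 : (Finset.univ.filter q).map Fin.valEmbedding =
      (Finset.range n).filter fun i => p i = true := by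
    ext i
    simp only [Finset.mem_map, Finset.mem_filter, Finset.mem_univ, true_and, Finset.mem_range, h]
    exact ⟨fun ⟨a, h1, h2⟩ => h2 ▸ ⟨a.2, h1⟩, fun ⟨h1, h2⟩ => ⟨⟨i, h1⟩, h2, rfl⟩⟩
  rw [← Finset.card_map Fin.valEmbedding, h1, List.countP_eq_length_filter]
  simp [Finset.card, Finset.filter, Finset.range, Multiset.range]

section rigidCheck

variable {n T k lam : ℕ} {N : List (List ℕ)}

theorem rigidCheck_adj (h : rigidCheck n T N k lam = true) (i j : Fin n) :
    (bitGraph n T).Adj i j ↔ bitAdj n T i j = true := by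
  simp only [rigidCheck, Bool.and_eq_true, List.all_eq_true, List.mem_range, Bool.not_eq_true',
    beq_iff_eq] at h
  obtain ⟨⟨⟨⟨⟨⟨-, h1⟩, h2⟩, -⟩, -⟩, -⟩, -⟩ := h
  simp only [bitGraph, SimpleGraph.fromRel_adj]
  constructor
  · rintro ⟨-, h3 | h3⟩
    · exact h3
    · rwa [h2 i i.2 j j.2]
  · refine fun h3 => ⟨?_, Or.inl h3⟩
    rintro rfl
    rw [h1 i i.2] at h3
    exact absurd h3 (by decide)

/-- For the diameter, the check finds `a` and `c` in the closed neighbourhoods of `m` and `m'` whose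
bit masks share a bit `b`; this gives the walk `m, a, b, c, m'`. -/
theorem rigid_of_check [DecidableRel (bitGraph n T).Adj] (h : rigidCheck n T N k lam = true) :
    Rigid (bitGraph n T) k lam := by
  have hadj := rigidCheck_adj h
  simp only [rigidCheck, Bool.and_eq_true, List.all_eq_true, beq_iff_eq, Nat.beq_eq] at h
  obtain ⟨⟨⟨⟨⟨⟨rfl, -⟩, h2⟩, h3⟩, h4⟩, h5⟩, h6⟩ := h
  have hN : ∀ i : Fin n, (List.range n).filter (fun j => bitAdj n T i j) ∈
      (List.range n).map fun i => (List.range n).filter fun j => bitAdj n T i j := fun i =>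
    List.mem_map_of_mem (List.mem_range.2 i.2)
  have hmem : ∀ i j : Fin n, (j : ℕ) ∈ (List.range n).filter (fun j => bitAdj n T i j) ↔
      (bitGraph n T).Adj i j := fun i j => by
    rw [List.mem_filter, List.mem_range, hadj]
    exact and_iff_right j.2
  refine ⟨fun i => ?_, fun i j hij => ?_, fun a m m' hm hm' hne hna => ?_, fun m m' => ?_⟩
  · rw [card_filter_fin n (fun j => bitAdj n T i j) _ fun j => hadj i j, ← h3 _ (hN i),
      List.countP_eq_length_filter]
  · have h7 := h4 _ (hN i) j ((hmem i j).2 hij)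
    rw [List.countP_filter] at h7
    rw [← h7, cn, card_filter_fin n (fun t => bitAdj n T j t && bitAdj n T i t)]
    intro t
    rw [hadj, hadj, Bool.and_eq_true, and_comm]
  · have h7 := h5 _ (hN a) m ((hmem a m).2 hm) m' ((hmem a m').2 hm')
    rw [Bool.or_eq_true, Bool.or_eq_true, Nat.beq_eq, ← hadj] at h7
    have h7 := (h7.resolve_left (by
      rintro (h8 | h8)
      exacts [hne (Fin.ext h8), hna h8]))
    simp only [List.any_eq_true, Bool.and_eq_true] at h7
    obtain ⟨d, h8, h9, e, h10, h11, h12⟩ := h7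
    have hd := List.mem_range.1 (List.mem_filter.1 h8).1
    have he := List.mem_range.1 (List.mem_filter.1 h10).1
    exact ⟨⟨d, hd⟩, ⟨e, he⟩, (hmem a ⟨d, hd⟩).1 h8, (hmem a ⟨e, he⟩).1 h10, (hadj _ _).2 h9,
      (hadj _ _).2 h11, (hadj _ _).2 h12⟩
  · have hz : ∀ i : Fin n, ((List.range n).filter (fun j => bitAdj n T i j), (i : ℕ)) ∈
        ((List.range n).map fun i => (List.range n).filter fun j => bitAdj n T i j).zipIdx := by
      intro i
      rw [List.mk_mem_zipIdx_iff_getElem?]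
      simp
    have h7 := h6 _ (hz m) _ (hz m')
    simp only [List.any_eq_true, Bool.not_eq_true'] at h7
    obtain ⟨a, ha, c, hc, hac⟩ := h7
    have h8 : bitNbhd n T a &&& bitNbhd n T c ≠ 0 := fun h9 => by
      have : Nat.beq (Nat.land (bitNbhd n T a) (bitNbhd n T c)) 0 = true := by
        rw [Nat.beq_eq]; exact h9
      rw [this] at hac
      exact absurd hac (by decide)
    obtain ⟨b, hb⟩ := Nat.exists_testBit_of_ne_zero h8
    rw [Nat.testBit_and, Bool.and_eq_true] at hb
    have key : ∀ (m : Fin n) (a : ℕ),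
        a ∈ (m : ℕ) :: (List.range n).filter (fun j => bitAdj n T m j) →
        ∃ a' : Fin n, (a' : ℕ) = a ∧ (m = a' ∨ (bitGraph n T).Adj m a') := by
      intro m a ha
      rcases List.mem_cons.1 ha with rfl | ha
      · exact ⟨m, rfl, Or.inl rfl⟩
      · exact ⟨⟨a, List.mem_range.1 (List.mem_filter.1 ha).1⟩, rfl, Or.inr ((hmem m ⟨a, _⟩).1 ha)⟩
    obtain ⟨a, rfl, ha'⟩ := key m a ha
    obtain ⟨c, rfl, hc'⟩ := key m' c hc
    have key' : ∀ (a : Fin n), (bitNbhd n T a).testBit b = true → b < n ∧ ∀ hb : b < n,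
        (a = ⟨b, hb⟩ ∨ (bitGraph n T).Adj a ⟨b, hb⟩) := by
      intro a h9
      rcases testBit_bitNbhd h9 with h10 | rfl
      · exact ⟨h10.1, fun h => Or.inr ((hadj a ⟨b, h⟩).2 h10.2)⟩
      · exact ⟨a.2, fun _ => Or.inl rfl⟩
    obtain ⟨hbn, h10⟩ := key' a hb.1
    obtain ⟨-, h11⟩ := key' c hb.2
    exact ⟨a, ⟨b, hbn⟩, c, ha', h10 hbn, (h11 hbn).imp Eq.symm SimpleGraph.Adj.symm,
      hc'.imp Eq.symm SimpleGraph.Adj.symm⟩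

end rigidCheck

/-- A check that a naming of the vertices is compatible with a bit matrix. -/
def codeCheck (κ : Bool) (n T : ℕ) (C : List Code) : Bool :=
  (List.range n).all fun i => (List.range n).all fun j => !bitAdj n T i j ||
    (C.getD i .root).adj κ (C.getD j .root) || (C.getD j .root).adj κ (C.getD i .root)

/-- Only edges of the model need certified names: the naming is then a homomorphism to `G`, and
rigidity supplies injectivity, surjectivity and reflection of edges. -/
theorem LocallyMoore.iso_bitGraph {V : Type*} [Fintype V] [DecidableEq V] {G : SimpleGraph V}
    [DecidableRel G.Adj] {κ : Bool} {n T : ℕ} {N : List (List ℕ)} {C : List Code}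
    (hG : LocallyMoore G 10 3) (hn : n ≠ 0) (hT : rigidCheck n T N 10 3 = true)
    (hC : codeCheck κ n T C = true) {φ : Code → V}
    (hφ : ∀ c d : Code, c.adj κ d = true → G.Adj (φ c) (φ d)) :
    Nonempty (G ≃g bitGraph n T) := by
  classical
  have : Nonempty (Fin n) := ⟨⟨0, Nat.pos_of_ne_zero hn⟩⟩
  refine (rigid_of_check hT).nonempty_iso hG (f := fun i => φ (C.getD i .root)) fun i j hij => ?_
  rw [rigidCheck_adj hT] at hij
  simp only [codeCheck, List.all_eq_true, List.mem_range, Bool.or_eq_true] at hC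
  rcases hC i i.2 j j.2 with (h | h) | h
  · rw [hij] at h
    exact absurd h (by decide)
  · exact hφ _ _ h
  · exact (hφ _ _ h).symm

/-- A check that the numbers in `L` satisfying `p` are the numbers below `q` satisfying `p`, and
that `r` describes the bit matrix. -/
def vecCheck (n T : ℕ) (L : List ℕ) (q : ℕ) (p : ℕ → Bool) (r : ℕ → ℕ → Bool) : Bool :=
  Nat.beq L.length n && L.all p && L.all (fun c => Nat.blt c q) &&
  ((List.range q).all fun c => !p c || L.any fun d => Nat.beq d c) &&
  ((List.range n).all fun i => (List.range n).all fun j =>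
    Nat.beq i j || !Nat.beq (L.getD i 0) (L.getD j 0)) &&
  ((List.range n).all fun i => (List.range n).all fun j =>
    bitAdj n T i j == r (L.getD i 0) (L.getD j 0))

/-- The list `L` enumerates, without repetition, all codes below `q` that represent vertices of `H`,
so position in `L` is a numbering of these vertices. -/
theorem iso_of_vecCheck {W : Type*} {H : SimpleGraph W} {n T q : ℕ} {N : List (List ℕ)}
    {L : List ℕ} {p : ℕ → Bool} {r : ℕ → ℕ → Bool} {k lam : ℕ}
    (hT : rigidCheck n T N k lam = true)
    (h : vecCheck n T L q p r = true) (w : ∀ c, p c = true → W)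
    (hw : ∀ c d hc hd, w c hc = w d hd → c < q → d < q → c = d)
    (hw' : ∀ x, ∃ c hc, c < q ∧ w c hc = x)
    (hr : ∀ c d hc hd, r c d = true ↔ H.Adj (w c hc) (w d hd)) :
    Nonempty (bitGraph n T ≃g H) := by
  simp only [vecCheck, Bool.and_eq_true, List.all_eq_true, Bool.or_eq_true, List.any_eq_true,
    List.mem_range, beq_iff_eq, Nat.beq_eq, Nat.blt_eq, Bool.not_eq_true'] at h
  obtain ⟨⟨⟨⟨⟨h1, h2⟩, h3⟩, h4⟩, h5⟩, h6⟩ := h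
  have hL : ∀ i : Fin n, L.getD i 0 ∈ L := fun i => by
    rw [List.getD_eq_getElem _ _ (h1.symm ▸ i.2)]
    exact List.getElem_mem _
  let f : Fin n → W := fun i => w (L.getD i 0) (h2 _ (hL i))
  have hf : Function.Bijective f := by
    constructor
    · intro i j hij
      have h7 := hw _ _ _ _ hij (h3 _ (hL i)) (h3 _ (hL j))
      rcases h5 i i.2 j j.2 with h8 | h8
      · exact Fin.ext h8
      · rw [← Nat.beq_eq] at h7
        rw [h7] at h8
        exact absurd h8 (by decide)
    · intro x
      obtain ⟨c, hc, hq, rfl⟩ := hw' x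
      rcases h4 c hq with h7 | ⟨d, hd, rfl⟩
      · rw [hc] at h7
        exact absurd h7 (by decide)
      · obtain ⟨i, hi, rfl⟩ := List.getElem_of_mem hd
        refine ⟨⟨i, h1 ▸ hi⟩, ?_⟩
        simp only [f, List.getD_eq_getElem _ _ hi]
  refine ⟨⟨Equiv.ofBijective f hf, fun {i j} => ?_⟩⟩
  rw [rigidCheck_adj hT, h6 i i.2 j j.2, hr _ _ (h2 _ (hL i)) (h2 _ (hL j))]
  rfl

end KoolenPark

namespace KoolenPark

/-! ### The Doro graph as a bit matrix -/

/-- The adjacency matrix of the Doro graph. -/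
def doroMask : ℕ :=
  11502409959409689603754066353231044264308941388955294655203533697733775626002415080624213017177075693604319218225542153684061221111567978384484943556396849924190550179492339549048832836537401395132348989775746961019941577352832021356568398813179856119265031496787601875063291783477811250702740314523152873106107042606264320664080841057498537178084967208424576995348871390868347123920639733304189521370507943724753846300661408764281976044244613393416437699486412118245544827892033802288384224835196897908224556541842947561241770882143300558013427396489650806402615966909780935309464588760814493663584710890343612797992447386417655359660756726714385268887109507541266912552203417496985312804459392219304373093767392916434751449996895875986739501043753670563488389693592565621968627639581769535530737775949345136741924422918775789792759130851201575808975106934373088054575065575198225658413426259807305229641915495030663371405986010386996796613495310485287091348160772447405037015669238557475827331433498578849672581357542120211457925641150061330327059983065780376527770417847844319250882083627355841239807429674341003074178626090114992526367436465493564483906134018911872043309163887952861605695393577961568656285727098841037579555480634197626205761187396404325900108171262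

/-- The neighbour lists of the Doro graph. -/
def doroNbrs : List (List ℕ) :=
  [[1, 2, 3, 4, 5, 6, 7, 8, 9, 10], [0, 2, 3, 4, 11, 12, 13, 14, 17, 20], [0, 1, 5, 6, 11, 14, 15,
    16, 23, 26], [0, 1, 7, 8, 12, 17, 18, 19, 29, 32], [0, 1, 9, 10, 13, 20, 21, 22, 35, 38], [0,
    2, 7, 9, 15, 23, 24, 25, 30, 36], [0, 2, 8, 10, 16, 26, 27, 28, 33, 39], [0, 3, 5, 10, 18, 24,
    29, 30, 31, 40], [0, 3, 6, 9, 19, 27, 32, 33, 34, 37], [0, 4, 5, 8, 21, 25, 34, 35, 36, 37],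
    [0, 4, 6, 7, 22, 28, 31, 38, 39, 40], [1, 2, 15, 16, 17, 20, 41, 42, 43, 44], [1, 3, 14, 18,
    19, 20, 45, 46, 47, 48], [1, 4, 14, 17, 21, 22, 49, 50, 51, 52], [1, 2, 12, 13, 23, 26, 45,
    47, 49, 51], [2, 5, 11, 24, 25, 26, 41, 42, 53, 54], [2, 6, 11, 23, 27, 28, 43, 44, 55, 56],
    [1, 3, 11, 13, 29, 32, 41, 43, 50, 52], [3, 7, 12, 30, 31, 32, 45, 46, 57, 58], [3, 8, 12, 29,
    33, 34, 47, 48, 59, 60], [1, 4, 11, 12, 35, 38, 42, 44, 46, 48], [4, 9, 13, 36, 37, 38, 49,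
    50, 61, 62], [4, 10, 13, 35, 39, 40, 51, 52, 63, 64], [2, 5, 14, 16, 30, 36, 45, 49, 55, 56],
    [5, 7, 15, 29, 31, 36, 41, 53, 60, 61], [5, 9, 15, 30, 35, 37, 42, 54, 57, 64], [2, 6, 14, 15,
    33, 39, 47, 51, 53, 54], [6, 8, 16, 32, 34, 39, 43, 55, 58, 63], [6, 10, 16, 33, 38, 40, 44,
    56, 59, 62], [3, 7, 17, 19, 24, 40, 41, 52, 59, 60], [5, 7, 18, 23, 25, 40, 45, 56, 57, 64],
    [7, 10, 18, 24, 38, 39, 46, 53, 58, 61], [3, 8, 17, 18, 27, 37, 43, 50, 57, 58], [6, 8, 19,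
    26, 28, 37, 47, 54, 59, 62], [8, 9, 19, 27, 35, 36, 48, 55, 60, 63], [4, 9, 20, 22, 25, 34,
    42, 48, 63, 64], [5, 9, 21, 23, 24, 34, 49, 55, 60, 61], [8, 9, 21, 25, 32, 33, 50, 54, 57,
    62], [4, 10, 20, 21, 28, 31, 44, 46, 61, 62], [6, 10, 22, 26, 27, 31, 51, 53, 58, 63], [7, 10,
    22, 28, 29, 30, 52, 56, 59, 64], [11, 15, 17, 24, 29, 44, 50, 54, 59, 61], [11, 15, 20, 25,
    35, 43, 46, 53, 57, 63], [11, 16, 17, 27, 32, 42, 52, 56, 57, 63], [11, 16, 20, 28, 38, 41,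
    48, 55, 59, 61], [12, 14, 18, 23, 30, 48, 51, 55, 58, 64], [12, 18, 20, 31, 38, 42, 47, 53,
    57, 62], [12, 14, 19, 26, 33, 46, 49, 53, 60, 62], [12, 19, 20, 34, 35, 44, 45, 55, 59, 64],
    [13, 14, 21, 23, 36, 47, 52, 56, 60, 62], [13, 17, 21, 32, 37, 41, 51, 54, 58, 61], [13, 14,
    22, 26, 39, 45, 50, 54, 58, 64], [13, 17, 22, 29, 40, 43, 49, 56, 60, 63], [15, 24, 26, 31,
    39, 42, 46, 47, 60, 63], [15, 25, 26, 33, 37, 41, 50, 51, 59, 64], [16, 23, 27, 34, 36, 44,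
    45, 48, 58, 61], [16, 23, 28, 30, 40, 43, 49, 52, 57, 62], [18, 25, 30, 32, 37, 42, 43, 46,
    56, 62], [18, 27, 31, 32, 39, 45, 50, 51, 55, 61], [19, 28, 29, 33, 40, 41, 44, 48, 54, 64],
    [19, 24, 29, 34, 36, 47, 49, 52, 53, 63], [21, 24, 31, 36, 38, 41, 44, 50, 55, 58], [21, 28,
    33, 37, 38, 46, 47, 49, 56, 57], [22, 27, 34, 35, 39, 42, 43, 52, 53, 60], [22, 25, 30, 35,
    40, 45, 48, 51, 54, 59]]

/-- Names for the vertices of the Doro graph. -/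
def doroCodes : List Code :=
  [.root, .pt 0, .pt 1, .pt 2, .pt 3, .pt 4, .pt 5, .pt 6, .pt 7, .pt 8, .pt 9, .arc 0 1 false,
    .arc 0 2 false, .arc 0 3 false, .arc 1 0 false, .arc 1 4 false, .arc 1 5 false, .arc 2 0
    false, .arc 2 6 false, .arc 2 7 false, .arc 3 0 false, .arc 3 8 false, .arc 3 9 false, .arc 4
    1 false, .arc 4 6 false, .arc 4 8 false, .arc 5 1 false, .arc 5 7 false, .arc 5 9 false, .arc
    6 2 false, .arc 6 4 false, .arc 6 9 false, .arc 7 2 false, .arc 7 5 false, .arc 7 8 false,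
    .arc 8 3 false, .arc 8 4 false, .arc 8 7 false, .arc 9 3 false, .arc 9 5 false, .arc 9 6
    false, .hex (0, 1, 4, 6, false), .hex (0, 1, 4, 8, false), .hex (0, 1, 5, 7, false), .hex (0,
    1, 5, 9, false), .hex (0, 2, 6, 4, false), .hex (0, 2, 6, 9, false), .hex (0, 2, 7, 5, false),
    .hex (0, 2, 7, 8, false), .hex (0, 3, 8, 4, false), .hex (0, 3, 8, 7, false), .hex (0, 3, 9,
    5, false), .hex (0, 3, 9, 6, false), .hex (1, 4, 6, 9, false), .hex (1, 4, 8, 7, false), .hex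
    (1, 5, 7, 8, false), .hex (1, 5, 9, 6, false), .hex (2, 6, 4, 8, false), .hex (2, 6, 9, 5,
    false), .hex (2, 7, 5, 9, false), .hex (2, 7, 8, 4, false), .hex (3, 8, 4, 6, false), .hex (3,
    8, 7, 5, false), .hex (3, 9, 5, 7, false), .hex (3, 9, 6, 4, false)]

/-- The vertices of the Doro graph as vectors, coded by numbers. -/
def doroVecs : List ℕ :=
  [25, 5, 1, 127, 502, 135, 510, 387, 392, 267, 262, 175, 452, 302, 550, 435, 335, 427, 586, 591,
    327, 191, 186, 460, 557, 222, 310, 572, 207, 561, 582, 71, 566, 597, 56, 216, 197, 81, 211,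
    182, 96, 537, 242, 542, 237, 612, 41, 617, 36, 167, 111, 162, 116, 47, 107, 32, 122, 406, 496,
    421, 481, 371, 281, 356, 296]

theorem doro_rigid : rigidCheck 65 doroMask doroNbrs 10 3 = true := by decide +kernel

theorem doro_code : codeCheck true 65 doroMask doroCodes = true := by decide +kernel

/-- The elliptic form on vectors coded by numbers in base 5. -/
def doroForm (c d : ℕ) : ℕ :=
  (c % 5) * (d % 5) + (c / 5 % 5) * (d / 5 % 5) + (c / 25 % 5) * (d / 25 % 5) +
    2 * ((c / 125 % 5) * (d / 125 % 5))

/-- The vector coded by a number represents a vertex of the Doro graph. -/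
def doroPoint (c : ℕ) : Bool :=
  Nat.beq (doroForm c c % 5) 1 &&
  (Nat.beq (c % 5) 1 || Nat.beq (c % 5) 2 || Nat.beq (c % 5) 0 &&
    (Nat.beq (c / 5 % 5) 1 || Nat.beq (c / 5 % 5) 2 || Nat.beq (c / 5 % 5) 0 &&
      (Nat.beq (c / 25 % 5) 1 || Nat.beq (c / 25 % 5) 2 || Nat.beq (c / 25 % 5) 0 &&
        (Nat.beq (c / 125 % 5) 1 || Nat.beq (c / 125 % 5) 2))))

theorem doro_vec : vecCheck 65 doroMask doroVecs 625 doroPoint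
    (fun c d => Nat.beq (doroForm c d % 5) 0) = true := by decide +kernel

/-- The vector over `𝔽₅` coded by a number. -/
def vecOfNat (c : ℕ) : Fin 4 → ZMod 5 :=
  ![((c % 5 : ℕ) : ZMod 5), ((c / 5 % 5 : ℕ) : ZMod 5), ((c / 25 % 5 : ℕ) : ZMod 5),
    ((c / 125 % 5 : ℕ) : ZMod 5)]

theorem ellipticForm_vecOfNat (c d : ℕ) :
    ellipticForm (vecOfNat c) (vecOfNat d) = (doroForm c d : ℕ) := by
  simp only [ellipticForm, vecOfNat, doroForm, Nat.cast_add, Nat.cast_mul, Nat.cast_ofNat]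
  rfl

theorem zmod_five_cast_eq {a b : ℕ} (hb : b < 5) : (a : ZMod 5) = b ↔ a % 5 = b := by
  rw [ZMod.natCast_eq_natCast_iff', Nat.mod_eq_of_lt hb]

theorem exists_leading_iff (x : Fin 4 → ZMod 5) :
    (∃ i, (∀ j < i, x j = 0) ∧ (x i = 1 ∨ x i = 2)) ↔
      (x 0 = 1 ∨ x 0 = 2) ∨ x 0 = 0 ∧ ((x 1 = 1 ∨ x 1 = 2) ∨ x 1 = 0 ∧
        ((x 2 = 1 ∨ x 2 = 2) ∨ x 2 = 0 ∧ (x 3 = 1 ∨ x 3 = 2))) := by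
  constructor
  · rintro ⟨i, h1, h2⟩
    fin_cases i
    · exact Or.inl h2
    · exact Or.inr ⟨h1 0 (by decide), Or.inl h2⟩
    · exact Or.inr ⟨h1 0 (by decide), Or.inr ⟨h1 1 (by decide), Or.inl h2⟩⟩
    · exact Or.inr ⟨h1 0 (by decide), Or.inr ⟨h1 1 (by decide), Or.inr ⟨h1 2 (by decide), h2⟩⟩⟩
  · rintro (h | ⟨h0, h | ⟨h1, h | ⟨h2, h⟩⟩⟩)
    · exact ⟨0, fun j hj => absurd hj (Fin.not_lt_zero j), h⟩
    · refine ⟨1, fun j hj => ?_, h⟩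
      fin_cases j <;> first | assumption | exact absurd hj (by decide)
    · refine ⟨2, fun j hj => ?_, h⟩
      fin_cases j <;> first | assumption | exact absurd hj (by decide)
    · refine ⟨3, fun j hj => ?_, h⟩
      fin_cases j <;> first | assumption | exact absurd hj (by decide)

theorem doroPoint_iff (c : ℕ) : doroPoint c = true ↔ ellipticForm (vecOfNat c) (vecOfNat c) = 1 ∧
    ∃ i, (∀ j < i, vecOfNat c j = 0) ∧ (vecOfNat c i = 1 ∨ vecOfNat c i = 2) := by
  have h : ∀ a : ℕ, ((a % 5 : ℕ) : ZMod 5) = 0 ↔ a % 5 = 0 := fun a => by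
    have := zmod_five_cast_eq (a := a % 5) (b := 0) (by decide)
    simpa using this
  have h' : ∀ a : ℕ, ((a % 5 : ℕ) : ZMod 5) = 1 ↔ a % 5 = 1 := fun a => by
    have := zmod_five_cast_eq (a := a % 5) (b := 1) (by decide)
    simpa using this
  have h'' : ∀ a : ℕ, ((a % 5 : ℕ) : ZMod 5) = 2 ↔ a % 5 = 2 := fun a => by
    have := zmod_five_cast_eq (a := a % 5) (b := 2) (by decide)
    simpa using this
  have v0 : vecOfNat c 0 = ((c % 5 : ℕ) : ZMod 5) := rfl
  have v1 : vecOfNat c 1 = ((c / 5 % 5 : ℕ) : ZMod 5) := rfl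
  have v2 : vecOfNat c 2 = ((c / 25 % 5 : ℕ) : ZMod 5) := rfl
  have v3 : vecOfNat c 3 = ((c / 125 % 5 : ℕ) : ZMod 5) := rfl
  have hf : ((doroForm c c : ℕ) : ZMod 5) = 1 ↔ doroForm c c % 5 = 1 := by
    simpa using zmod_five_cast_eq (a := doroForm c c) (b := 1) (by decide)
  rw [exists_leading_iff, ellipticForm_vecOfNat, hf, v0, v1, v2, v3]
  simp only [h, h', h'', doroPoint, Bool.and_eq_true, Bool.or_eq_true, Nat.beq_eq]

theorem exists_vecOfNat (x : Fin 4 → ZMod 5) : ∃ c < 625, vecOfNat c = x := by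
  have hx : ∀ i, (x i).val < 5 := fun i => ZMod.val_lt _
  have h0 := hx 0
  have h1 := hx 1
  have h2 := hx 2
  have h3 := hx 3
  refine ⟨(x 0).val + 5 * (x 1).val + 25 * (x 2).val + 125 * (x 3).val, by omega, ?_⟩
  have key : ∀ (i : Fin 4) (a : ℕ), a = (x i).val → (a : ZMod 5) = x i := fun i a h => by
    rw [h, ZMod.natCast_zmod_val]
  funext i
  fin_cases i
  · exact key 0 _ (by omega)
  · exact key 1 _ (by omega)
  · exact key 2 _ (by omega)
  · exact key 3 _ (by omega)

theorem vecOfNat_inj {c d : ℕ} (hc : c < 625) (hd : d < 625) (h : vecOfNat c = vecOfNat d) :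
    c = d := by
  have key : ∀ a b : ℕ, ((a % 5 : ℕ) : ZMod 5) = ((b % 5 : ℕ) : ZMod 5) → a % 5 = b % 5 := by
    intro a b h
    rw [zmod_five_cast_eq (Nat.mod_lt _ (by decide)), Nat.mod_mod] at h
    exact h
  have h0 := key _ _ (congrFun h 0)
  have h1 := key _ _ (congrFun h 1)
  have h2 := key _ _ (congrFun h 2)
  have h3 := key _ _ (congrFun h 3)
  omega

theorem doro_iso : Nonempty (bitGraph 65 doroMask ≃g doroGraph) := by
  refine iso_of_vecCheck doro_rigid doro_vec (fun c hc => ⟨vecOfNat c, (doroPoint_iff c).1 hc⟩)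
    ?_ ?_ ?_
  · intro c d hc hd h hc' hd'
    exact vecOfNat_inj hc' hd' (Subtype.ext_iff.1 h)
  · intro x
    obtain ⟨c, hc, h⟩ := exists_vecOfNat x.1
    exact ⟨c, (doroPoint_iff c).2 (h.symm ▸ x.2), hc, Subtype.ext h⟩
  · intro c d hc hd
    change _ ↔ ellipticForm (vecOfNat c) (vecOfNat d) = 0
    rw [ellipticForm_vecOfNat, Nat.beq_eq]
    simpa using (zmod_five_cast_eq (a := doroForm c d) (b := 0) (by decide)).symm

end KoolenPark

namespace KoolenPark

/-! ### The Conway-Smith graph as a bit matrix -/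

/-- The adjacency matrix of the Conway-Smith graph. -/
def conwaySmithMask : ℕ :=
  1533092913154922361407468588263251812374882655479004814714490442815811798303082274969553035100562019791182855542456395124294066222613090251989160796823207408751323570439936730695717139040721641423138555031052367368434341262074063980207391706691606093968087822019398702293582862073218043161447927861415135813003841551414220531763933130349160549592461837545688548504376488761685845018671409518034735904611006545458145983407454409460998159757086718719787305010035517353053491773112910061159449231501561014302134459784709574966699156150977079843158783376251505166479193230026409787745197926134410789598144104337086720079515506221217996257088248838100351822106440214232290178582096465128911213223093782779120865112172662447794319587884296905528472640221699192701807351377293198502470393048318760313103889350094813559054274362415628080472298264339928752254313116411667461197402928709856342605543013931370150629693654943371886655053817710734901021247588522300620263031902169038284635700545407873639721833898465408484835034670050088368738711803523321706715895575639868565500714366537439157515978046633145728698407822795374462083985456620677927974547339200701241959553471136559248721220196959063738681342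

/-- The neighbour lists of the Conway-Smith graph. -/
def conwaySmithNbrs : List (List ℕ) :=
  [[1, 2, 3, 4, 5, 6, 7, 8, 9, 10], [0, 2, 3, 4, 11, 12, 13, 14, 15, 16], [0, 1, 5, 6, 11, 12, 17,
    18, 19, 20], [0, 1, 7, 8, 13, 14, 21, 22, 23, 24], [0, 1, 9, 10, 15, 16, 25, 26, 27, 28], [0,
    2, 7, 9, 17, 18, 29, 30, 31, 32], [0, 2, 8, 10, 19, 20, 33, 34, 35, 36], [0, 3, 5, 10, 21, 22,
    29, 30, 37, 38], [0, 3, 6, 9, 23, 24, 33, 34, 39, 40], [0, 4, 5, 8, 25, 26, 31, 32, 39, 40],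
    [0, 4, 6, 7, 27, 28, 35, 36, 37, 38], [1, 2, 14, 16, 18, 20, 41, 44, 56, 58], [1, 2, 13, 15,
    17, 19, 46, 48, 51, 54], [1, 3, 12, 16, 22, 24, 43, 48, 54, 59], [1, 3, 11, 15, 21, 23, 44,
    49, 53, 58], [1, 4, 12, 14, 26, 28, 46, 49, 51, 53], [1, 4, 11, 13, 25, 27, 41, 43, 56, 59],
    [2, 5, 12, 20, 30, 32, 48, 50, 51, 52], [2, 5, 11, 19, 29, 31, 41, 42, 58, 60], [2, 6, 12, 18,
    34, 36, 42, 46, 54, 60], [2, 6, 11, 17, 33, 35, 44, 50, 52, 56], [3, 7, 14, 24, 30, 38, 44,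
    50, 53, 57], [3, 7, 13, 23, 29, 37, 43, 47, 54, 60], [3, 8, 14, 22, 34, 40, 47, 49, 58, 60],
    [3, 8, 13, 21, 33, 39, 48, 50, 57, 59], [4, 9, 16, 28, 32, 40, 43, 47, 52, 56], [4, 9, 15, 27,
    31, 39, 42, 46, 53, 57], [4, 10, 16, 26, 36, 38, 41, 42, 57, 59], [4, 10, 15, 25, 35, 37, 47,
    49, 51, 52], [5, 7, 18, 22, 32, 38, 41, 43, 55, 60], [5, 7, 17, 21, 31, 37, 45, 50, 51, 53],
    [5, 9, 18, 26, 30, 40, 42, 45, 53, 58], [5, 9, 17, 25, 29, 39, 43, 48, 52, 55], [6, 8, 20, 24,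
    36, 40, 45, 50, 56, 59], [6, 8, 19, 23, 35, 39, 46, 49, 55, 60], [6, 10, 20, 28, 34, 38, 44,
    49, 52, 55], [6, 10, 19, 27, 33, 37, 42, 45, 54, 59], [7, 10, 22, 28, 30, 36, 45, 47, 51, 54],
    [7, 10, 21, 27, 29, 35, 41, 44, 55, 57], [8, 9, 24, 26, 32, 34, 46, 48, 55, 57], [8, 9, 23,
    25, 31, 33, 45, 47, 56, 58], [11, 16, 18, 27, 29, 38, 42, 43, 44, 61], [18, 19, 26, 27, 31,
    36, 41, 45, 46, 61], [13, 16, 22, 25, 29, 32, 41, 47, 48, 61], [11, 14, 20, 21, 35, 38, 41,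
    49, 50, 61], [30, 31, 33, 36, 37, 40, 42, 47, 50, 61], [12, 15, 19, 26, 34, 39, 42, 48, 49,
    61], [22, 23, 25, 28, 37, 40, 43, 45, 49, 61], [12, 13, 17, 24, 32, 39, 43, 46, 50, 61], [14,
    15, 23, 28, 34, 35, 44, 46, 47, 61], [17, 20, 21, 24, 30, 33, 44, 45, 48, 61], [12, 15, 17,
    28, 30, 37, 52, 53, 54, 62], [17, 20, 25, 28, 32, 35, 51, 55, 56, 62], [14, 15, 21, 26, 30,
    31, 51, 57, 58, 62], [12, 13, 19, 22, 36, 37, 51, 59, 60, 62], [29, 32, 34, 35, 38, 39, 52,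
    57, 60, 62], [11, 16, 20, 25, 33, 40, 52, 58, 59, 62], [21, 24, 26, 27, 38, 39, 53, 55, 59,
    62], [11, 14, 18, 23, 31, 40, 53, 56, 60, 62], [13, 16, 24, 27, 33, 36, 54, 56, 57, 62], [18,
    19, 22, 23, 29, 34, 54, 55, 58, 62], [41, 42, 43, 44, 45, 46, 47, 48, 49, 50], [51, 52, 53,
    54, 55, 56, 57, 58, 59, 60]]

/-- Names for the vertices of the Conway-Smith graph. -/
def conwaySmithCodes : List Code :=
  [.root, .pt 0, .pt 1, .pt 2, .pt 3, .pt 4, .pt 5, .pt 6, .pt 7, .pt 8, .pt 9, .arc 0 1 false,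
    .arc 0 1 true, .arc 0 2 false, .arc 0 2 true, .arc 0 3 false, .arc 0 3 true, .arc 1 4 false,
    .arc 1 4 true, .arc 1 5 false, .arc 1 5 true, .arc 2 6 false, .arc 2 6 true, .arc 2 7 false,
    .arc 2 7 true, .arc 3 8 false, .arc 3 8 true, .arc 3 9 false, .arc 3 9 true, .arc 4 6 false,
    .arc 4 6 true, .arc 4 8 false, .arc 4 8 true, .arc 5 7 false, .arc 5 7 true, .arc 5 9 false,
    .arc 5 9 true, .arc 6 9 false, .arc 6 9 true, .arc 7 8 false, .arc 7 8 true, .hex (0, 1, 4, 6,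
    false), .hex (5, 1, 4, 8, false), .hex (8, 4, 6, 2, true), .hex (2, 6, 9, 5, false), .hex (6,
    4, 8, 7, true), .hex (7, 8, 3, 0, false), .hex (9, 6, 2, 7, false), .hex (7, 2, 0, 1, true),
    .hex (3, 9, 5, 7, true), .hex (7, 5, 1, 4, false), .hex (0, 1, 4, 6, true), .hex (5, 1, 4, 8,
    true), .hex (8, 4, 6, 2, false), .hex (2, 6, 9, 5, true), .hex (6, 4, 8, 7, false), .hex (7,
    8, 3, 0, true), .hex (9, 6, 2, 7, true), .hex (7, 2, 0, 1, false), .hex (3, 9, 5, 7, false),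
    .hex (7, 5, 1, 4, true), .top false, .top true]

/-- The vertices of the Conway-Smith graph as vectors, coded by numbers. -/
def conwaySmithVecs : List ℕ :=
  [2048, 2720, 2570, 2093, 2183, 2168, 2258, 2881, 2508, 2355, 2836, 512, 170, 32, 653, 128, 551,
    8, 626, 2, 728, 1, 876, 12, 481, 3, 436, 4, 915, 64, 825, 48, 331, 192, 286, 16, 966, 768, 85,
    256, 255, 3652, 3126, 3171, 3601, 4080, 3458, 3855, 3368, 3228, 3273, 1928, 1051, 1201, 1826,
    1360, 1731, 1285, 1596, 1252, 1102, 3072, 1024]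

theorem conwaySmith_rigid : rigidCheck 63 conwaySmithMask conwaySmithNbrs 10 3 = true := by
  decide +kernel

theorem conwaySmith_code : codeCheck false 63 conwaySmithMask conwaySmithCodes = true := by
  decide +kernel

/-- The digits of a number in base 4. -/
def digit (c i : ℕ) : ℕ := c / 4 ^ i % 4

/-- Multiplication by `ω` on elements of `𝔽₄` coded by numbers. -/
def omegaMul (d : ℕ) : ℕ := d / 2 + 2 * ((d % 2 + d / 2) % 2)

/-- The number of nonzero digits. -/
def digitWeight (c : ℕ) : ℕ := (List.range 6).countP fun i => !Nat.beq (digit c i) 0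

/-- The digits form a word of the hexacode. -/
def isHexacode (c : ℕ) : Bool :=
  Nat.beq (digit c 3) (((digit c 0) ^^^ (digit c 1)) ^^^ (digit c 2)) &&
  Nat.beq (digit c 4)
    ((omegaMul (omegaMul (digit c 0)) ^^^ omegaMul (digit c 1)) ^^^ (digit c 2)) &&
  Nat.beq (digit c 5)
    ((omegaMul (digit c 0) ^^^ omegaMul (omegaMul (digit c 1))) ^^^ (digit c 2))

/-- The digits represent a vertex of the Conway-Smith graph. -/
def conwaySmithPoint (c : ℕ) : Bool :=
  Nat.beq (digitWeight c) 1 || (Nat.beq (digitWeight c) 4 && isHexacode c)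

/-- Adjacency in the Conway-Smith graph in terms of digits. -/
def conwaySmithAdj (c d : ℕ) : Bool :=
  ((List.range 6).any fun i => !Nat.beq (digit c i) (digit d i)) &&
  ((List.range 6).any fun i => !Nat.beq (digit c i) 0 && !Nat.beq (digit d i) 0) &&
  ((List.range 6).all fun i => Nat.beq (digit c i) 0 || Nat.beq (digit d i) 0 ||
    Nat.beq (digit c i) (digit d i))

theorem conwaySmith_vec : vecCheck 63 conwaySmithMask conwaySmithVecs 4096 conwaySmithPoint
    conwaySmithAdj = true := by decide +kernel

/-- The element of `𝔽₄` coded by a number. -/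
def f4OfNat (d : ℕ) : F4 := ((d : ZMod 2), ((d / 2 : ℕ) : ZMod 2))

theorem f4OfNat_inj : ∀ a < 4, ∀ b < 4, f4OfNat a = f4OfNat b → a = b := by decide

theorem f4OfNat_zero : ∀ a < 4, f4OfNat a = 0 ↔ a = 0 := by decide

theorem f4OfNat_surj : ∀ x : F4, ∃ a < 4, f4OfNat a = x := by decide

theorem f4OfNat_xor : ∀ a < 4, ∀ b < 4, a ^^^ b < 4 ∧ f4OfNat (a ^^^ b) = f4OfNat a + f4OfNat b := by
  decide

theorem f4OfNat_omegaMul : ∀ a < 4, omegaMul a < 4 ∧ f4OfNat (omegaMul a) = mulOmega (f4OfNat a) := by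
  decide

theorem digit_lt (c i : ℕ) : digit c i < 4 := Nat.mod_lt _ (by decide)

/-- The vector over `𝔽₄` coded by a number. -/
def wordOfNat (c : ℕ) : Fin 6 → F4 := fun i => f4OfNat (digit c i)

theorem wordOfNat_apply_eq_zero (c : ℕ) (i : Fin 6) : wordOfNat c i = 0 ↔ digit c i = 0 :=
  f4OfNat_zero _ (digit_lt c i)

theorem wordOfNat_apply_eq (c d : ℕ) (i : Fin 6) :
    wordOfNat c i = wordOfNat d i ↔ digit c i = digit d i :=
  ⟨f4OfNat_inj _ (digit_lt c i) _ (digit_lt d i), fun h => congrArg f4OfNat h⟩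

theorem digitWeight_eq (c : ℕ) : digitWeight c = weight (wordOfNat c) := by
  rw [weight, card_filter_fin 6 (fun i => !Nat.beq (digit c i) 0), digitWeight]
  intro i
  rw [Ne, wordOfNat_apply_eq_zero, Bool.not_eq_true', ← Bool.not_eq_true, Nat.beq_eq]

theorem exists_hexacodeword_iff (x : Fin 6 → F4) : (∃ a b c, x = hexacodeword a b c) ↔
    x 3 = x 0 + x 1 + x 2 ∧ x 4 = mulOmega (mulOmega (x 0)) + mulOmega (x 1) + x 2 ∧
      x 5 = mulOmega (x 0) + mulOmega (mulOmega (x 1)) + x 2 := by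
  constructor
  · rintro ⟨a, b, c, rfl⟩
    exact ⟨rfl, rfl, rfl⟩
  · rintro ⟨h3, h4, h5⟩
    refine ⟨x 0, x 1, x 2, funext fun i => ?_⟩
    fin_cases i
    exacts [rfl, rfl, rfl, h3, h4, h5]

theorem isHexacode_iff (c : ℕ) : isHexacode c = true ↔
    ∃ a b d, wordOfNat c = hexacodeword a b d := by
  have h0 := digit_lt c 0
  have h1 := digit_lt c 1
  have h2 := digit_lt c 2
  have key : ∀ {a b i} (v w : F4), a < 4 ∧ f4OfNat a = v → b < 4 ∧ f4OfNat b = w →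
      i < 4 → (i = a ^^^ b ^^^ digit c 2 ↔ f4OfNat i = v + w + f4OfNat (digit c 2)) := by
    rintro a b i v w ⟨ha, rfl⟩ ⟨hb, rfl⟩ hi
    obtain ⟨h4, h5⟩ := f4OfNat_xor a ha b hb
    obtain ⟨h6, h7⟩ := f4OfNat_xor _ h4 _ h2
    rw [← h5, ← h7]
    exact ⟨fun h => congrArg f4OfNat h, f4OfNat_inj _ hi _ h6⟩
  have hm : ∀ {a} {v : F4}, a < 4 ∧ f4OfNat a = v →
      omegaMul a < 4 ∧ f4OfNat (omegaMul a) = mulOmega v := by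
    rintro a v ⟨ha, rfl⟩
    exact f4OfNat_omegaMul a ha
  rw [exists_hexacodeword_iff]
  simp only [isHexacode, Bool.and_eq_true, Nat.beq_eq, and_assoc]
  rw [key _ _ ⟨h0, rfl⟩ ⟨h1, rfl⟩ (digit_lt c 3),
    key _ _ (hm (hm ⟨h0, rfl⟩)) (hm ⟨h1, rfl⟩) (digit_lt c 4),
    key _ _ (hm ⟨h0, rfl⟩) (hm (hm ⟨h1, rfl⟩)) (digit_lt c 5)]
  rfl

theorem conwaySmithPoint_iff (c : ℕ) : conwaySmithPoint c = true ↔ weight (wordOfNat c) = 1 ∨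
    (weight (wordOfNat c) = 4 ∧ ∃ a b d, wordOfNat c = hexacodeword a b d) := by
  rw [← isHexacode_iff, ← digitWeight_eq]
  simp only [conwaySmithPoint, Bool.and_eq_true, Bool.or_eq_true, Nat.beq_eq]

theorem exists_wordOfNat (x : Fin 6 → F4) : ∃ c < 4096, wordOfNat c = x := by
  choose d hd hx using fun i => f4OfNat_surj (x i)
  have h0 := hd 0
  have h1 := hd 1
  have h2 := hd 2
  have h3 := hd 3
  have h4 := hd 4
  have h5 := hd 5
  refine ⟨d 0 + 4 * d 1 + 16 * d 2 + 64 * d 3 + 256 * d 4 + 1024 * d 5, by omega, ?_⟩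
  have key : ∀ (i : Fin 6) (a : ℕ), a = d i → f4OfNat a = x i := fun i a h => by rw [h, hx]
  funext i
  refine key i _ ?_
  fin_cases i <;> simp only [digit, Fin.zero_eta, Fin.mk_one, Fin.reduceFinMk, Nat.reducePow] <;> omega

theorem wordOfNat_inj {c d : ℕ} (hc : c < 4096) (hd : d < 4096) (h : wordOfNat c = wordOfNat d) :
    c = d := by
  have key : ∀ i : Fin 6, digit c i = digit d i := fun i =>
    (wordOfNat_apply_eq c d i).1 (congrFun h i)
  have h0 : c / 1 % 4 = d / 1 % 4 := key 0
  have h1 : c / 4 % 4 = d / 4 % 4 := key 1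
  have h2 : c / 16 % 4 = d / 16 % 4 := key 2
  have h3 : c / 64 % 4 = d / 64 % 4 := key 3
  have h4 : c / 256 % 4 = d / 256 % 4 := key 4
  have h5 : c / 1024 % 4 = d / 1024 % 4 := key 5
  omega

theorem conwaySmithAdj_iff (c d : ℕ) : conwaySmithAdj c d = true ↔ wordOfNat c ≠ wordOfNat d ∧
    (∃ i, wordOfNat c i ≠ 0 ∧ wordOfNat d i ≠ 0) ∧
      ∀ i, wordOfNat c i ≠ 0 → wordOfNat d i ≠ 0 → wordOfNat c i = wordOfNat d i := by
  have hn : ∀ a b : ℕ, (!Nat.beq a b) = true ↔ a ≠ b := fun a b => by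
    rw [Bool.not_eq_true', ← Bool.not_eq_true, Nat.beq_eq]
  simp only [conwaySmithAdj, Bool.and_eq_true, List.any_eq_true, List.all_eq_true, List.mem_range,
    hn, Bool.or_eq_true, Nat.beq_eq, and_assoc]
  refine and_congr ?_ (and_congr ?_ ?_)
  · rw [Ne, funext_iff, not_forall]
    simp only [wordOfNat_apply_eq]
    exact ⟨fun ⟨i, hi, h⟩ => ⟨⟨i, hi⟩, h⟩, fun ⟨i, h⟩ => ⟨i, i.2, h⟩⟩
  · simp only [Ne, wordOfNat_apply_eq_zero]
    exact ⟨fun ⟨i, hi, h⟩ => ⟨⟨i, hi⟩, h⟩, fun ⟨i, h⟩ => ⟨i, i.2, h⟩⟩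
  · simp only [Ne, wordOfNat_apply_eq_zero, wordOfNat_apply_eq]
    exact ⟨fun h i h1 h2 => (h i i.2).resolve_left (by tauto), fun h i hi => by
      have := h ⟨i, hi⟩
      simp only at this
      tauto⟩

theorem conwaySmith_iso : Nonempty (bitGraph 63 conwaySmithMask ≃g conwaySmithGraph) := by
  refine iso_of_vecCheck conwaySmith_rigid conwaySmith_vec
    (fun c hc => ⟨wordOfNat c, (conwaySmithPoint_iff c).1 hc⟩) ?_ ?_ ?_
  · intro c d hc hd h hc' hd'
    exact wordOfNat_inj hc' hd' (Subtype.ext_iff.1 h)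
  · intro x
    obtain ⟨c, hc, h⟩ := exists_wordOfNat x.1
    exact ⟨c, (conwaySmithPoint_iff c).2 (h.symm ▸ x.2), hc, Subtype.ext h⟩
  · intro c d hc hd
    exact (conwaySmithAdj_iff c d).trans (and_congr
      (not_congr ⟨fun h => Subtype.ext h, fun h => Subtype.ext_iff.1 h⟩) Iff.rfl)

/-- The case of valency 10. -/
theorem LocallyMoore.iso_of_ten {V : Type*} [Fintype V] [DecidableEq V] {G : SimpleGraph V}
    [DecidableRel G.Adj] (hG : LocallyMoore G 10 3) :
    Nonempty (G ≃g doroGraph) ∨ Nonempty (G ≃g conwaySmithGraph) := by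
  obtain ⟨κ, φ, hφ⟩ := hG.exists_code
  cases κ
  · obtain ⟨f⟩ := hG.iso_bitGraph (by decide) conwaySmith_rigid conwaySmith_code hφ
    obtain ⟨g⟩ := conwaySmith_iso
    exact Or.inr ⟨f.trans g⟩
  · obtain ⟨f⟩ := hG.iso_bitGraph (by decide) doro_rigid doro_code hφ
    obtain ⟨g⟩ := doro_iso
    exact Or.inl ⟨f.trans g⟩

end KoolenPark

namespace KoolenPark

/-! ### The icosahedron -/

/-- The adjacency matrix of the icosahedron. -/
def icosahedronMask : ℕ :=
  6885390824445355178704487711943101108604990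

/-- The neighbour lists of the icosahedron. -/
def icosahedronNbrs : List (List ℕ) :=
  [[1, 2, 3, 4, 5], [0, 2, 5, 7, 8], [0, 1, 3, 8, 9], [0, 2, 4, 9, 10], [0, 3, 5, 10, 11], [0, 1, 4, 7, 11],
    [7, 8, 9, 10, 11], [1, 5, 6, 8, 11], [1, 2, 6, 7, 9], [2, 3, 6, 8, 10], [3, 4, 6, 9, 11], [4, 5, 6, 7, 10]]

theorem icosahedron_rigid : rigidCheck 12 icosahedronMask icosahedronNbrs 5 2 = true := by
  decide +kernel

/-- Adjacency in the icosahedron up to symmetry. -/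
def icosahedronRel (p q : Bool × Option (ZMod 5)) : Bool :=
  match p, q with
  | (s, none), (t, some _) => s == t
  | (true, some i), (false, some j) => j == i || j == i + 1
  | (true, some i), (true, some j) => j == i + 1
  | (false, some i), (false, some j) => j == i + 1
  | _, _ => false

theorem icosahedron_adj (p q : Bool × Option (ZMod 5)) : icosahedron.Adj p q ↔
    p ≠ q ∧ (icosahedronRel p q = true ∨ icosahedronRel q p = true) := by
  obtain ⟨s, i⟩ := p
  obtain ⟨t, j⟩ := q
  cases s <;> cases t <;> cases i <;> cases j <;>
    simp [icosahedron, SimpleGraph.fromRel_adj, icosahedronRel]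

/-- A numbering of the vertices of the icosahedron. -/
def icosahedronEquiv : Fin 12 ≃ Bool × Option (ZMod 5) where
  toFun i := (Nat.blt i 6, if i.val % 6 = 0 then none else some (((i.val % 6 - 1 : ℕ) : ZMod 5)))
  invFun p := match p with
    | (true, none) => 0
    | (false, none) => 6
    | (true, some j) => Fin.ofNat 12 (j.val + 1)
    | (false, some j) => Fin.ofNat 12 (j.val + 7)
  left_inv := by decide
  right_inv := by decide

theorem icosahedron_iso : Nonempty (bitGraph 12 icosahedronMask ≃g icosahedron) := by
  refine ⟨⟨icosahedronEquiv, fun {i j} => ?_⟩⟩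
  rw [rigidCheck_adj icosahedron_rigid, icosahedron_adj]
  revert i j
  decide +kernel

namespace LocallyMoore

variable {V : Type*} [Fintype V] [DecidableEq V] {G : SimpleGraph V} [DecidableRel G.Adj]
variable {k : ℕ} {x : V}

theorem eq_of_two (hG : LocallyMoore G k 2) {y z a b t : V} (h : G.Adj y z)
    (ha : G.Adj y a) (ha' : G.Adj z a) (hb : G.Adj y b) (hb' : G.Adj z b) (hab : a ≠ b)
    (ht : G.Adj y t) (ht' : G.Adj z t) : t = a ∨ t = b := by
  obtain ⟨c, d, -, -, -, -, -, hall⟩ := hG.two_cn h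
  rcases hall a ha ha' with rfl | rfl <;> rcases hall b hb hb' with rfl | rfl
  · exact absurd rfl hab
  · exact hall t ht ht'
  · exact (hall t ht ht').symm
  · exact absurd rfl hab

theorem other_cn (hG : LocallyMoore G k 2) {y z a : V} (h : G.Adj y z) (ha : G.Adj y a)
    (ha' : G.Adj z a) : ∃ b, b ≠ a ∧ G.Adj y b ∧ G.Adj z b := by
  obtain ⟨c, d, hcd, h1, h2, h3, h4, hall⟩ := hG.two_cn h
  rcases hall a ha ha' with rfl | rfl
  exacts [⟨d, hcd.symm, h3, h4⟩, ⟨c, hcd, h1, h2⟩]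

/-- The local graph of every vertex is a pentagon. -/
theorem exists_pentagon (hG : LocallyMoore G 5 2) (x : V) : ∃ p : ZMod 5 → V,
    (∀ i, G.Adj x (p i)) ∧ (∀ i, G.Adj (p i) (p (i + 1))) ∧ ∀ i, p i ≠ p (i + 2) := by
  obtain ⟨p₀, x₀⟩ := hG.exists_adj (by decide) x
  obtain ⟨p₁, p₄, n₁₄, x₁, a₀₁, x₄, a₀₄, -⟩ := hG.two_cn x₀
  obtain ⟨p₂, n₂₀, x₂, a₁₂⟩ := hG.other_cn x₁ x₀ a₀₁.symm
  obtain ⟨p₃, n₃₀, x₃, a₄₃⟩ := hG.other_cn x₄ x₀ a₀₄.symm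
  have na₁₄ : ¬ G.Adj p₁ p₄ := fun h => hG.noK4 _ _ _ _ x₀ x₁ x₄ a₀₁ a₀₄ h
  have na₀₂ : ¬ G.Adj p₀ p₂ := fun h => hG.noK4 _ _ _ _ x₀ x₁ x₂ a₀₁ h a₁₂
  have n₂₄ : p₂ ≠ p₄ := fun h => na₁₄ (h ▸ a₁₂)
  have n₁₃ : p₁ ≠ p₃ := fun h => na₁₄ (h ▸ a₄₃.symm)
  have n₂₃ : p₂ ≠ p₃ := by
    rintro rfl
    exact n₂₀ (hG.unique n₁₄ na₁₄ x₁ x₄ a₁₂.symm a₄₃.symm a₀₁ a₀₄ x₂.ne' x₀.ne')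
  have na₂₄ : ¬ G.Adj p₂ p₄ := fun h => by
    rcases hG.eq_of_two x₄ x₀ a₀₄.symm x₃ a₄₃ n₃₀.symm x₂ h.symm with h1 | h1
    exacts [n₂₀ h1, n₂₃ h1]
  obtain ⟨w, w1, w2, w3⟩ := hG.exists_of x p₂ p₄ x₂ x₄ n₂₄ na₂₄
  have a₂₃ : G.Adj p₂ p₃ := by
    rcases hG.eq_of_two x₄ x₀ a₀₄.symm x₃ a₄₃ n₃₀.symm w1 w3.symm with rfl | rfl
    exacts [absurd w2 na₀₂, w2.symm]
  refine ⟨![p₀, p₁, p₂, p₃, p₄], ?_, ?_, ?_⟩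
  · intro i
    fin_cases i <;> assumption
  · intro i
    fin_cases i
    exacts [a₀₁, a₁₂, a₂₃, a₄₃.symm, a₀₄.symm]
  · intro i
    fin_cases i
    exacts [n₂₀.symm, n₁₃, n₂₄, n₃₀, n₁₄.symm]

/-- A graph that is locally a pentagon has a homomorphism from the icosahedron. -/
theorem exists_hom_icosahedron (hG : LocallyMoore G 5 2) :
    ∃ φ : Bool × Option (ZMod 5) → V, ∀ a b, icosahedron.Adj a b → G.Adj (φ a) (φ b) := by
  obtain ⟨x⟩ := hG.conn.nonempty
  obtain ⟨p, xp, pp, pne⟩ := hG.exists_pentagon x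
  have npp : ∀ i, ¬ G.Adj (p i) (p (i + 2)) := fun i h =>
    hG.noK4 _ _ _ _ (xp i) (xp (i + 1)) (xp (i + 2)) (pp i) h
      (by have := pp (i + 1); rwa [add_assoc] at this)
  have hz : ∀ i, ∃ z, z ≠ x ∧ G.Adj (p i) z ∧ G.Adj (p (i + 1)) z := fun i =>
    hG.other_cn (pp i) (xp i).symm (xp (i + 1)).symm
  -- `z i` is adjacent to `p i` and `p (i + 1)`
  choose z zx zp zp' using hz
  have xz : ∀ i, ¬ G.Adj x (z i) := fun i h =>
    hG.noK4 _ _ _ _ (xp i) (xp (i + 1)) h (pp i) (zp i) (zp' i)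
  have zuniq : ∀ i t, G.Adj (p i) t → G.Adj (p (i + 1)) t → t = x ∨ t = z i := fun i t =>
    hG.eq_of_two (pp i) (xp i).symm (xp (i + 1)).symm (zp i) (zp' i) (zx i).symm
  have zpne : ∀ i j, z i ≠ p j := fun i j h => xz i (h ▸ xp j)
  have e2 : ∀ i : ZMod 5, i + 1 + 1 = i + 2 := by decide
  have nzp : ∀ i, ¬ G.Adj (p (i + 2)) (z i) := fun i h => by
    have h1 := (zuniq (i + 1) (z i) (zp' i) (e2 i ▸ h)).resolve_left (zx i)
    exact zpne i (i + 1) (hG.unique (pne i) (npp i) (xp i) (xp (i + 2)) (zp i).symm h.symm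
      (pp i).symm (by have := pp (i + 1); rwa [e2] at this) (zx i) (xp (i + 1)).ne')
  have zz : ∀ i, G.Adj (z i) (z (i + 1)) := fun i => by
    obtain ⟨w, h1, h2, h3⟩ := hG.exists_of (p (i + 1)) (z i) (p (i + 2)) (zp' i)
      (by have := pp (i + 1); rwa [e2] at this) (zpne i _) fun h => nzp i h.symm
    rcases zuniq (i + 1) w h1 (e2 i ▸ h3.symm) with rfl | rfl
    · exact absurd h2 (xz i)
    · exact h2.symm
  have nzp' : ∀ i, ¬ G.Adj (p i) (z (i + 1)) := fun i h => by
    rcases zuniq i _ h (zp (i + 1)) with h1 | h1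
    exacts [zx _ h1, (zz i).ne' h1]
  have zne : ∀ i, z i ≠ z (i + 2) := fun i h => nzp i (h ▸ zp (i + 2))
  have nzz : ∀ i, ¬ G.Adj (z i) (z (i + 2)) := fun i h => by
    have h1 := hG.unique (fun h => zpne i (i + 2) h) (fun h => nzp i h.symm) (x := z (i + 1))
      (zz i).symm (by have := zp' (i + 1); rw [e2] at this; exact this.symm)
      (w := p (i + 1)) (zp' i) (by have := pp (i + 1); rwa [e2] at this) (w' := z (i + 2)) h.symm
      (zp (i + 2)).symm (fun h => zpne _ _ h.symm) (e2 i ▸ (zz (i + 1)).ne')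
    exact zpne _ _ h1.symm
  -- a common neighbour of two consecutive `z i` other than the obvious one is adjacent to the next
  have step : ∀ i y, G.Adj (z i) y → G.Adj (z (i + 1)) y → y ≠ p (i + 1) →
      G.Adj (z (i + 2)) y ∧ y ≠ p (i + 2) := by
    intro i y h1 h2 h3
    refine ⟨?_, fun h => nzp i (h ▸ h1).symm⟩
    obtain ⟨w, w1, w2, w3⟩ := hG.exists_of (z (i + 1)) (z i) (z (i + 2)) (zz i).symm
      (e2 i ▸ zz (i + 1)) (zne i) (nzz i)
    rcases hG.eq_of_two (zz i) (zp' i).symm (zp (i + 1)).symm h1 h2 h3.symm w2.symm w1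
      with rfl | rfl
    · exact absurd (e2 i ▸ w3) (nzp' (i + 1))
    · exact w3.symm
  -- This is the second pole: `step` carries its adjacency from `z 0`, `z 1` around to all `z i`.
  obtain ⟨y, y1, y2, y3⟩ := hG.other_cn (zz 0) (zp' 0).symm (zp (0 + 1)).symm
  obtain ⟨y4, y5⟩ := step 0 y y2 y3 y1
  obtain ⟨y6, y7⟩ := step 1 y y3 y4 y5
  obtain ⟨y8, -⟩ := step 2 y y4 y6 y7
  have yz : ∀ i, G.Adj y (z i) := by
    intro i
    fin_cases i
    exacts [y2.symm, y3.symm, y4.symm, y6.symm, y8.symm]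
  -- The shift is needed because `p i` is adjacent to `z (i - 1)` and `z i`, whereas the model joins
  -- `(true, some i)` to the indices `i` and `i + 1`.
  let φ : Bool × Option (ZMod 5) → V := fun a => match a with
    | (true, none) => x
    | (false, none) => y
    | (true, some i) => p i
    | (false, some i) => z (i - 1)
  have key : ∀ a b, icosahedronRel a b = true → G.Adj (φ a) (φ b) := by
    rintro ⟨s, i⟩ ⟨t, j⟩ h
    cases s <;> cases t <;> cases i <;> cases j <;>
      simp only [icosahedronRel, Bool.or_eq_true, beq_iff_eq, Bool.false_eq_true,
        reduceCtorEq] at h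
    · exact yz _
    · rename_i i j
      subst h
      change G.Adj (z (i - 1)) (z (i + 1 - 1))
      rw [add_sub_right_comm]
      exact zz _
    · rename_i i j
      change G.Adj (p i) (z (j - 1))
      rcases h with rfl | rfl
      · have := zp' (j - 1)
        rwa [sub_add_cancel] at this
      · rw [add_sub_cancel_right]
        exact zp i
    · exact xp _
    · subst h
      exact pp _
  refine ⟨φ, fun a b h => ?_⟩
  rcases ((icosahedron_adj a b).1 h).2 with h1 | h1
  exacts [key _ _ h1, (key _ _ h1).symm]

/-- The case of valency 5. -/
theorem iso_of_five (hG : LocallyMoore G 5 2) : Nonempty (G ≃g icosahedron) := by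
  classical
  obtain ⟨φ, hφ⟩ := hG.exists_hom_icosahedron
  obtain ⟨g⟩ := icosahedron_iso
  obtain ⟨f⟩ := (rigid_of_check icosahedron_rigid).nonempty_iso hG (f := fun i => φ (g i))
    fun i j hij => hφ _ _ (g.map_adj_iff.2 hij)
  exact ⟨f.trans g⟩

end LocallyMoore
end KoolenPark

/-! ### Conclusion and the distance-regular case. -/

namespace KoolenPark

variable {V : Type*} [Fintype V] [DecidableEq V] {G : SimpleGraph V} [DecidableRel G.Adj]

theorem isKnownTerwilliger_of_attainsMuBound {v k lam mu : ℕ} (hc : G.Connected)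
    (hG : IsAmplyRegular G v k lam mu) (hmu : 1 < mu) (h : AttainsMuBound G k lam mu) :
    mu = 2 ∧ IsKnownTerwilliger G := by
  obtain ⟨h1, h2 | h2⟩ := locallyMoore hc hG hmu h
  · exact ⟨h1, Or.inl h2.iso_of_five⟩
  · exact ⟨h1, Or.inr h2.iso_of_ten⟩

theorem card_commonNeighbors_eq (u w : V) : Fintype.card (G.commonNeighbors u w) =
    ((G.neighborFinset w).filter fun x => G.dist u x = 1).card := by
  rw [← Set.toFinset_card]
  congr 1
  ext x
  simp [SimpleGraph.mem_commonNeighbors, SimpleGraph.dist_eq_one_iff_adj, and_comm]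

namespace IsDistanceRegular

variable {b c : ℕ → ℕ}

theorem card_neighborFinset (h : IsDistanceRegular G b c) (w : V) :
    (G.neighborFinset w).card = b 0 := by
  rw [← h.card_farther 0 w w SimpleGraph.dist_self, Finset.filter_true_of_mem]
  intro x hx
  rw [SimpleGraph.mem_neighborFinset] at hx
  rw [SimpleGraph.dist_eq_one_iff_adj.2 hx]

/-- By the triangle inequality, the neighbours of `w` lie at distance 0, 1 or 2 from `u`; those at
distance 1 are the common neighbours. -/
theorem card_add (h : IsDistanceRegular G b c) {u w : V} (huw : G.Adj u w) :
    c 1 + Fintype.card (G.commonNeighbors u w) + b 1 = b 0 := by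
  have h1 : G.dist u w = 1 := SimpleGraph.dist_eq_one_iff_adj.2 huw
  rw [← h.card_closer 1 u w h1, ← h.card_farther 1 u w h1, ← h.card_neighborFinset w,
    card_commonNeighbors_eq, ← Finset.card_union_of_disjoint, ← Finset.card_union_of_disjoint,
    ← Finset.filter_or, ← Finset.filter_or, Finset.filter_true_of_mem]
  · intro x hx
    rw [SimpleGraph.mem_neighborFinset] at hx
    have h2 := h.connected.dist_triangle (u := u) (v := w) (w := x)
    rw [h1, SimpleGraph.dist_eq_one_iff_adj.2 hx] at h2
    omega
  · rw [← Finset.filter_or]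
    exact Finset.disjoint_filter.2 fun x _ h2 h3 => by omega
  · exact Finset.disjoint_filter.2 fun x _ h2 h3 => by omega

theorem isAmplyRegular (h : IsDistanceRegular G b c) :
    IsAmplyRegular G (Fintype.card V) (b 0) (b 0 - b 1 - c 1) (c 2) where
  card := rfl
  regular w := h.card_neighborFinset w
  of_adj u w huw := by
    have := h.card_add huw
    omega
  of_dist_two u w huw := by
    rw [card_commonNeighbors_eq, ← h.card_closer 2 u w huw]
    congr 1
    exact Finset.filter_congr fun x _ => by omega

/-- Diameter at least 2 provides an edge, and `card_add` on that edge shows that the natural number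
subtractions are not truncated. -/
theorem cast_sub (h : IsDistanceRegular G b c) (hd : 2 ≤ G.diam) :
    ((b 0 - b 1 - c 1 : ℕ) : ℚ) = b 0 - b 1 - c 1 := by
  have : Nonempty V := h.connected.nonempty
  obtain ⟨u, v, huv⟩ := G.exists_dist_eq_diam
  obtain ⟨p⟩ := h.connected.preconnected u v
  cases p with
  | nil => rw [SimpleGraph.dist_self] at huv; omega
  | @cons _ w _ hadj _ =>
    have h1 := h.card_add hadj
    have h2 : b 0 - b 1 - c 1 = Fintype.card (G.commonNeighbors u w) := by
      rw [← h1, Nat.add_sub_cancel, Nat.add_sub_cancel_left]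
    rw [h2, ← h1]
    push_cast
    ring

end IsDistanceRegular
end KoolenPark

theorem theorem4p1 {V : Type*} [Fintype V] [DecidableEq V] (Γ : SimpleGraph V)
    [DecidableRel Γ.Adj] :
    (∀ v k lam mu : ℕ, Γ.Connected → KoolenPark.IsAmplyRegular Γ v k lam mu → 1 < mu →
      KoolenPark.AttainsMuBound Γ k lam mu →
        mu = 2 ∧ KoolenPark.IsKnownTerwilliger Γ) ∧
    (∀ b c : ℕ → ℕ, KoolenPark.IsDistanceRegular Γ b c → 2 ≤ Γ.diam → 2 ≤ c 2 →
      KoolenPark.AttainsMuBound Γ (b 0) ((b 0 : ℚ) - b 1 - c 1) (c 2) →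
        c 2 = 2 ∧ KoolenPark.IsKnownTerwilliger Γ) := by
  refine ⟨fun v k lam mu hc hG hmu h =>
    KoolenPark.isKnownTerwilliger_of_attainsMuBound hc hG hmu h, fun b c hd h2 hc2 h => ?_⟩
  rw [← hd.cast_sub h2] at h
  exact KoolenPark.isKnownTerwilliger_of_attainsMuBound hd.connected hd.isAmplyRegular hc2 h
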